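/- **Theorem (Performance of the Generalized Weighted Shortest Path Algorithm).** *Network.* Let $\mathcal N,\mathcal M,\mathcal L$ be finite index sets, and let $\Omega(t)=(\omega(t),\phi(t))$, $t=0,1,2,\dots$, be i.i.d., where $\omega(t)$ has a fixed law on a measurable space and $\phi(t)\in\{0,1\}$ is independent of $\omega(t)$ with $\Pr[\phi(t)=1]=\phi\in(0,1]$. The state $z(t)$ lives in a countable set $\mathcal Z$ with a distinguished state $0$, and $z(0)=0$. In slot $t$ the controller, knowing the whole history and $\Omega(t)$, chooses (possibly at random) an action $I(t)\in\mathcal I_{\Omega(t),z(t)}$ and a vector $\gamma(t)\in\mathbb R^{\mathcal M}$ with $x_m^{\min}-\alpha\le\gamma_m(t)\le x_m^{\max}+\alpha$ for all $m$ $(*)$; then $z(t+1)$ is drawn from the transition probabilities $P_{z(t),\cdot}(I(t),\Omega(t))$, which send the state to $0$ when $\phi(t)=1$. The penalties $x_m(t)$, services $\mu_n(t)$ and arrivals $R_n(t)$ are measurable functions of $(I(t),\Omega(t),z(t))$ with $x_m^{\min}\le x_m(t)\le x_m^{\max}$, $0\le\mu_n(t)\le\mu_n^{\max}$, $0\le R_n(t)\le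 R_n^{\max}$; put $d_n=\mu_n-R_n$. A *$(z,\Omega)$-only policy* chooses $I(t)$ by a fixed, possibly randomized rule from $(z(t),\Omega(t))$ alone. *Functions and queues.* Let $f$ and $h_l$ ($l\in\mathcal L$) be convex and Lipschitz on the set of vectors satisfying $(*)$, with $f_{\min}\le f\le f_{\max}$ there; let $c_l\in\mathbb R$, $V\ge0$, $\alpha\ge0$. The queues $\Theta=(Q,Y,W)$ evolve by $$Q_n(t+1)=\max[Q_n(t)-\mu_n(t),0]+R_n(t),\quad Y_l(t+1)=\max[Y_l(t)-c_l+h_l(\gamma(t)),0],\quad W_m(t+1)=W_m(t)-\gamma_m(t)+x_m(t).$$ The initial $\Theta(0)$ is random with $Q_n(0),Y_l(0)\ge0$ and $E\{L(\Theta(0))\}<\infty$, where $L(\Theta)=\frac12\big[\sum_nQ_n^2+\sum_lY_l^2+\sum_mW_m^2\big]$. *Renewals.* A renewal definition decides at each time $t$ from the history of the slots before $t$ whether $t$ is a renewal time; time $0$ is one, renewals occur only when $z(t)=0$, and: (i) the first and second moments of the inter-renewal times are bounded by finite constants under every policy, regardless of the past; (ii) under a $(z,\Omega)$-only policy, the inter-renewal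 times together with the outcomes, actions and states over the renewal intervals have the same law on every renewal interval, regardless of the past (and of the choice of a constant $\gamma$). Let $0=t_0<t_1<\cdots$ be the renewal times. *Type-2* renewals are time $0$ and the times $t+1$ with $\phi(t)=1$ (and $z(t+1)=0$, which then holds almost surely). For $\epsilon\ge0$ let $\Gamma_\epsilon$ be the set of all $\gamma\in\mathbb R^{\mathcal M}$ with $h_l(\gamma)\le c_l$ for all $l$ for which there is a $(z,\Omega)$-only policy such that for every renewal time $t_g$, with $T^*$ the length of the renewal interval starting there, $$\frac{E\{\sum_{\tau=0}^{T^*-1}x_m^*(t_g+\tau)\}}{E\{T^*\}}=\gamma_m\ \ (m\in\mathcal M),\qquad \frac{E\{\sum_{\tau=0}^{T^*-1}d_n^*(t_g+\tau)\}}{E\{T^*\}}\ge\epsilon\ \ (n\in\mathcal N).$$ *Assumption 3:* $\Gamma_0\neq\emptyset$. Put $f^{opt}=\inf_{\gamma\in\Gamma_0}f(\gamma)$ (the infimum need not be attained). *Assumption 4 for $\epsilon>0$:* $\Gamma_\epsilon\neq\emptyset$. *Algorithm.* Suppose a policy is used which implements an optimal solution of the weighted stochastic shortest path problem in every renewal interval: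 for every renewal time $t_g$, with $T$ the time until the next renewal, it minimizes, over all policies for choosing $I$ and $\gamma$ and almost surely given the history at $t_g$, the conditional expectation of $$-\sum_nQ_n(t_g)\sum_{\tau<T}d_n(t_g+\tau)-\sum_mW_m(t_g)\sum_{\tau<T}[\gamma_m-x_m](t_g+\tau)-\sum_lY_l(t_g)\sum_{\tau<T}[c_l-h_l(\gamma(t_g+\tau))]+V\sum_{\tau<T}f(\gamma(t_g+\tau)).$$ Let $B_2>0$ satisfy, for every history at a renewal time and all admissible values of $\mu_n,R_n,x_m,\gamma$ in one slot, $$B_2\ge\tfrac12E\{T^2\mid\text{history}\}\Big[\sum_n(\mu_n^2+R_n^2)+\sum_m(\gamma_m-x_m)^2+\sum_l(h_l(\gamma)-c_l)^2\Big].$$ Let $\overline x(t)=\frac1t\sum_{\tau=0}^{t-1}E\{x(\tau)\}$. Then, under Assumption 3: (a) $\displaystyle\lim_{t\to\infty}\frac{E\{Q_n(t)\}}t=\lim_{t\to\infty}\frac{E\{Y_l(t)\}}t=\lim_{t\to\infty}\frac{E\{|W_m(t)|\}}t=0$ for all $n\in\mathcal N$, $l\in\mathcal L$, $m\in\mathcal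 M$. (b) $\limsup_{t\to\infty}h_l(\overline x(t))\le c_l$ for all $l\in\mathcal L$. (c) If renewals are type-2 and $V>0$, then $\limsup_{t\to\infty}f(\overline x(t))\le f^{opt}+\phi B_2/V$. (d) If renewals are type-2 and Assumption 4 holds for some $\epsilon>0$, then every $Q_n$ is strongly stable, $\limsup_{t\to\infty}\frac1t\sum_{\tau=0}^{t-1}E\{Q_n(\tau)\}<\infty$, and for every positive integer $G$ $$\frac1G\sum_{g=0}^{G-1}\sum_{n\in\mathcal N}E\{Q_n(t_g)\}\le\frac{\phi B_2+V(f_{\max}-f_{\min})}{\epsilon}+\frac{\phi E\{L(\Theta(0))\}}{\epsilon G}.$$ -/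

import Mathlib

open MeasureTheory ProbabilityTheory Filter Topology Preorder
open scoped ENNReal NNReal

universe u

namespace MarkovNet

/-! ### The network model -/

/-- A Markov modulated network with `φ`-forced renewals.

* `N` indexes the queues to be stabilized, `M` the penalties `x_1, …, x_M`;
* `W` is the space of the outcomes `ω(t)`, and `Ω(t) = (ω(t), φ(t)) : W × Bool`, where
  `φ(t) = true` is a forced renewal event;
* `A` is the space in which the control actions live, `Z` the (countable) state space.

The functions that depend on the action, the outcome and the state take the triple
`(I, Ω, z) : A × (W × Bool) × Z`. -/
structure Network (N M W A Z : Type u) [MeasurableSpace W] [MeasurableSpace A]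
    [MeasurableSpace Z] where
  /-- the set of feasible actions under the outcome `Ω` in the state `z` -/
  actions : W × Bool → Z → Set A
  /-- the law of `ω(t)` -/
  lawω : Measure W
  lawω_prob : IsProbabilityMeasure lawω
  /-- the forced renewal probability -/
  φ : unitInterval
  φ_pos : 0 < φ
  /-- the state `0` -/
  zero : Z
  /-- `trans (I, Ω, y) {z}` is the transition probability `P_{yz}(I, Ω)` -/
  trans : Kernel (A × (W × Bool) × Z) Z
  trans_markov : IsMarkovKernel trans
  /-- a forced renewal event sends the state to `0` -/
  forced : ∀ ω y, ∀ I ∈ actions (ω, true) y, trans (I, (ω, true), y) = Measure.dirac zero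
  /-- service rates -/
  μhat : N → A × (W × Bool) × Z → ℝ
  /-- arrivals -/
  Rhat : N → A × (W × Bool) × Z → ℝ
  /-- penalties -/
  xhat : M → A × (W × Bool) × Z → ℝ
  μhat_meas : ∀ n, Measurable (μhat n)
  Rhat_meas : ∀ n, Measurable (Rhat n)
  xhat_meas : ∀ m, Measurable (xhat m)
  μmax : N → ℝ
  Rmax : N → ℝ
  xmin : M → ℝ
  xmax : M → ℝ
  μhat_bd : ∀ n Ω z, ∀ I ∈ actions Ω z, 0 ≤ μhat n (I, Ω, z) ∧ μhat n (I, Ω, z) ≤ μmax n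
  Rhat_bd : ∀ n Ω z, ∀ I ∈ actions Ω z, 0 ≤ Rhat n (I, Ω, z) ∧ Rhat n (I, Ω, z) ≤ Rmax n
  xhat_bd : ∀ m Ω z, ∀ I ∈ actions Ω z,
    xmin m ≤ xhat m (I, Ω, z) ∧ xhat m (I, Ω, z) ≤ xmax m

section

variable {N M L W A Z : Type u} [MeasurableSpace W] [MeasurableSpace A] [MeasurableSpace Z]

/-- `d̂_n = μ̂_n - R̂_n`. -/
def Network.dhat (S : Network N M W A Z) (n : N) (q : A × (W × Bool) × Z) : ℝ :=
  S.μhat n q - S.Rhat n q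

/-- The law of `Ω(t) = (ω(t), φ(t))`: the components are independent and `φ(t)` is Bernoulli. -/
noncomputable def Network.lawΩ (S : Network N M W A Z) : Measure (W × Bool) :=
  S.lawω.prod (bernoulliMeasure true false S.φ)

instance (S : Network N M W A Z) : IsProbabilityMeasure S.lawΩ := by
  have := S.lawω_prob
  unfold Network.lawΩ
  infer_instance

instance (S : Network N M W A Z) : IsMarkovKernel S.trans := S.trans_markov

/-- The vectors allowed as auxiliary variables. -/
def Network.box (S : Network N M W A Z) (α : ℝ) : Set (M → ℝ) :=
  {γ | ∀ m, S.xmin m - α ≤ γ m ∧ γ m ≤ S.xmax m + α}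

/-- The data of the convex program: minimize `f` of the time average penalty vector subject to
`h_l ≤ c_l`, with the parameters `V` and `α` of the algorithm. The functions are convex and
Lipschitz (for the Euclidean norm) on the set of allowed auxiliary vectors. -/
structure Program [Fintype M] (S : Network N M W A Z) (L : Type u) where
  f : (M → ℝ) → ℝ
  h : L → (M → ℝ) → ℝ
  c : L → ℝ
  V : ℝ
  V_nonneg : 0 ≤ V
  α : ℝ
  α_nonneg : 0 ≤ α
  f_convex : ConvexOn ℝ (S.box α) f
  h_convex : ∀ l, ConvexOn ℝ (S.box α) (h l)
  fmin : ℝ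
  fmax : ℝ
  f_bd : ∀ γ ∈ S.box α, fmin ≤ f γ ∧ f γ ≤ fmax
  β : ℝ
  f_lip : ∀ γ ∈ S.box α, ∀ γ' ∈ S.box α, |f γ - f γ'| ≤ β * ‖WithLp.toLp 2 (γ - γ')‖
  h_lip : ∀ l, ∀ γ ∈ S.box α, ∀ γ' ∈ S.box α,
    |h l γ - h l γ'| ≤ β * ‖WithLp.toLp 2 (γ - γ')‖

/-! ### Trajectories -/

/-- A vector `Θ = (Q, Y, W)` of queue backlogs. -/
abbrev Backlog (N M L : Type u) : Type u := (N → ℝ) × (L → ℝ) × (M → ℝ)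

/-- What happens in a slot `t`: `((Ω(t), (I(t), γ(t))), z(t+1))`. -/
abbrev Slot (M W A Z : Type u) : Type u := ((W × Bool) × (A × (M → ℝ))) × Z

/-- The coordinates of a trajectory: coordinate `0` is the initial backlog `Θ(0)`, coordinate
`t + 1` is the record of the slot `t`. -/
def Coord (N M L W A Z : Type u) : ℕ → Type u
  | 0 => Backlog N M L
  | _ + 1 => Slot M W A Z

instance : (n : ℕ) → MeasurableSpace (Coord N M L W A Z n)
  | 0 => inferInstanceAs (MeasurableSpace (Backlog N M L))
  | _ + 1 => inferInstanceAs (MeasurableSpace (Slot M W A Z))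

/-- The record of a slot, as an element of `Slot`. -/
def slotRec {t : ℕ} (x : Coord N M L W A Z (t + 1)) : Slot M W A Z := x

theorem measurable_slotRec (t : ℕ) :
    Measurable (slotRec (N := N) (M := M) (L := L) (W := W) (A := A) (Z := Z) (t := t)) :=
  measurable_id

/-- A trajectory of the system. -/
abbrev Path (N M L W A Z : Type u) : Type u := (n : ℕ) → Coord N M L W A Z n

/-- The history at the beginning of the slot `t`: the initial backlog and the record of the slots
`0, …, t - 1`. -/
abbrev Hist (N M L W A Z : Type u) (t : ℕ) : Type u :=
  (i : Finset.Iic t) → Coord N M L W A Z i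

/-- The outcome `Ω(t)`. -/
def outcome (p : Path N M L W A Z) (t : ℕ) : W × Bool :=
  (slotRec (p (t + 1))).1.1

/-- The action `I(t)`. -/
def action (p : Path N M L W A Z) (t : ℕ) : A :=
  (slotRec (p (t + 1))).1.2.1

/-- The auxiliary vector `γ(t)`. -/
def aux (p : Path N M L W A Z) (t : ℕ) : M → ℝ :=
  (slotRec (p (t + 1))).1.2.2

/-- The state `z(t)`, with `z(0) = 0`. -/
def state (S : Network N M W A Z) (p : Path N M L W A Z) : ℕ → Z
  | 0 => S.zero
  | t + 1 => (slotRec (p (t + 1))).2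

/-- The state `z(t)` as a function of the history at the beginning of the slot `t`. -/
def histState (S : Network N M W A Z) : (t : ℕ) → Hist N M L W A Z t → Z
  | 0, _ => S.zero
  | t + 1, h => (slotRec (t := t) (h ⟨t + 1, Finset.mem_Iic.2 le_rfl⟩)).2

theorem measurable_histState (S : Network N M W A Z) (t : ℕ) :
    Measurable (histState (L := L) S t) := by
  cases t with
  | zero => exact measurable_const
  | succ t =>
    exact measurable_snd.comp ((measurable_slotRec t).comp
      (measurable_pi_apply (X := fun i : Finset.Iic (t + 1) => Coord N M L W A Z i)
        ⟨t + 1, Finset.mem_Iic.2 le_rfl⟩))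

/-- The triple `(I(t), Ω(t), z(t))`. -/
def point (S : Network N M W A Z) (p : Path N M L W A Z) (t : ℕ) : A × (W × Bool) × Z :=
  (action p t, outcome p t, state S p t)

/-- The backlogs `Θ(t) = (Q(t), Y(t), W(t))`, given by the queue update equations. -/
noncomputable def backlog [Fintype M] (S : Network N M W A Z) (C : Program S L)
    (p : Path N M L W A Z) : ℕ → Backlog N M L
  | 0 => p 0
  | t + 1 =>
    (fun n => max ((backlog S C p t).1 n - S.μhat n (point S p t)) 0 + S.Rhat n (point S p t),
     fun l => max ((backlog S C p t).2.1 l - C.c l + C.h l (aux p t)) 0,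
     fun m => (backlog S C p t).2.2 m - aux p t m + S.xhat m (point S p t))

/-- The quadratic Lyapunov function `L₂`. -/
noncomputable def lyapunov [Fintype N] [Fintype M] [Fintype L] (θ : Backlog N M L) : ℝ :=
  (1 / 2) * (∑ n, θ.1 n ^ 2 + ∑ l, θ.2.1 l ^ 2 + ∑ m, θ.2.2 m ^ 2)

/-! ### Control policies -/

/-- A (causal, possibly randomized and history dependent) control policy: in each slot `t` it
observes the history and `Ω(t)` and chooses a feasible action `I(t)` and an allowed `γ(t)`. -/
structure Policy [Fintype M] (S : Network N M W A Z) (C : Program S L) where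
  act : (t : ℕ) → Kernel (Hist N M L W A Z t × (W × Bool)) (A × (M → ℝ))
  act_markov : ∀ t, IsMarkovKernel (act t)
  act_mem : ∀ t (h : Hist N M L W A Z t) (Ω : W × Bool), ∀ᵐ d ∂(act t (h, Ω)),
    d.1 ∈ S.actions Ω (histState S t h) ∧ d.2 ∈ S.box C.α

/-- A `(z, Ω)`-only policy: a stationary, possibly randomized choice of `I(t)` based only on the
current `z(t)` and `Ω(t)`. -/
structure StatPolicy (S : Network N M W A Z) where
  act : Kernel (Z × (W × Bool)) A
  act_markov : IsMarkovKernel act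
  act_mem : ∀ z Ω, ∀ᵐ I ∂(act (z, Ω)), I ∈ S.actions Ω z

/-- The policy that takes its actions by the `(z, Ω)`-only policy `σ` and always uses the constant
auxiliary vector `γ₀`. -/
noncomputable def StatPolicy.toPolicy [Fintype M] {S : Network N M W A Z} (C : Program S L)
    (σ : StatPolicy S) (γ₀ : S.box C.α) : Policy S C where
  act t :=
    haveI := σ.act_markov
    (σ.act.comap (fun q : Hist N M L W A Z t × (W × Bool) => (histState S t q.1, q.2))
        (((measurable_histState S t).comp measurable_fst).prodMk measurable_snd)) ×ₖ
      Kernel.const _ (Measure.dirac (γ₀ : M → ℝ))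
  act_markov t := by
    have := σ.act_markov
    infer_instance
  act_mem t h Ω := by
    have := σ.act_markov
    rw [Kernel.prod_apply, Kernel.comap_apply, Kernel.const_apply]
    have h1 := (measurePreserving_fst (μ := σ.act (histState S t h, Ω))
      (ν := Measure.dirac (γ₀ : M → ℝ))).quasiMeasurePreserving.ae (σ.act_mem (histState S t h) Ω)
    have h2 : ∀ᵐ d ∂((σ.act (histState S t h, Ω)).prod (Measure.dirac (γ₀ : M → ℝ))),
        d.2 ∈ S.box C.α :=
      (measurePreserving_snd (μ := σ.act (histState S t h, Ω))
        (ν := Measure.dirac (γ₀ : M → ℝ))).quasiMeasurePreserving.ae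
        (p := fun γ => γ ∈ S.box C.α) (ae_iff.2 (by
          rw [Measure.dirac_apply]
          exact Set.indicator_of_notMem (by simp) _))
    filter_upwards [h1, h2] with d h1 h2 using ⟨h1, h2⟩

section

variable [Fintype M] {S : Network N M W A Z} {C : Program S L}

/-- The law of the record of the slot `t` given the history: `Ω(t)` is independent of the history,
then `(I(t), γ(t))` is chosen by the policy, then `z(t+1)` by the transition probabilities. -/
noncomputable def Policy.step (π : Policy S C) (t : ℕ) :
    Kernel (Hist N M L W A Z t) (Coord N M L W A Z (t + 1)) :=
  haveI := π.act_markov t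
  show Kernel (Hist N M L W A Z t) (Slot M W A Z) from
    ((Kernel.const (Hist N M L W A Z t) S.lawΩ) ⊗ₖ π.act t) ⊗ₖ
      S.trans.comap
        (fun q : Hist N M L W A Z t × ((W × Bool) × (A × (M → ℝ))) =>
          (q.2.2.1, q.2.1, histState S t q.1))
        (measurable_snd.snd.fst.prodMk
          (measurable_snd.fst.prodMk ((measurable_histState S t).comp measurable_fst)))

instance (π : Policy S C) (t : ℕ) : IsMarkovKernel (π.step t) := by
  have := π.act_markov t
  change IsMarkovKernel (((Kernel.const (Hist N M L W A Z t) S.lawΩ) ⊗ₖ π.act t) ⊗ₖ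
    S.trans.comap _ _)
  infer_instance

/-- The conditional law of the trajectory given the history `h` at the beginning of the slot `t`,
when the policy `π` is used from then on. -/
noncomputable def Policy.lawFrom (π : Policy S C) (t : ℕ) (h : Hist N M L W A Z t) :
    Measure (Path N M L W A Z) :=
  Kernel.traj π.step t h

/-- The law of the trajectory under the policy `π`, when `Θ(0)` has the law `ρ`. -/
noncomputable def Policy.law (π : Policy S C) (ρ : Measure (Backlog N M L)) :
    Measure (Path N M L W A Z) :=
  Kernel.trajMeasure (X := Coord N M L W A Z) ρ π.step

end

/-! ### Renewals -/

/-- A renewal definition: `R t` is the set of the histories at which a renewal occurs at `t`. -/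
abbrev RenewalRule (N M L W A Z : Type u) : Type u := (t : ℕ) → Set (Hist N M L W A Z t)

/-- A renewal occurs at the time `t` of the trajectory `p`. -/
def RenewsAt (R : RenewalRule N M L W A Z) (p : Path N M L W A Z) (t : ℕ) : Prop :=
  frestrictLe (π := Coord N M L W A Z) t p ∈ R t

/-- The duration from the time `t` until the next renewal (`⊤` if there is none). -/
noncomputable def frameLength (R : RenewalRule N M L W A Z) (t : ℕ) (p : Path N M L W A Z) : ℕ∞ :=
  ⨅ (k : ℕ) (_ : 1 ≤ k ∧ RenewsAt R p (t + k)), (k : ℕ∞)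

/-- The time `t_g` of the `g`-th renewal, with `t_0 = 0`. -/
noncomputable def renewalTime (R : RenewalRule N M L W A Z) (p : Path N M L W A Z) : ℕ → ℕ∞
  | 0 => 0
  | g + 1 => renewalTime R p g + frameLength R (renewalTime R p g).toNat p

/-- The sum of `F` over the renewal interval that starts at `t`. -/
noncomputable def frameSum (R : RenewalRule N M L W A Z) (t : ℕ) (p : Path N M L W A Z)
    (F : ℕ → ℝ) : ℝ :=
  ∑ τ ∈ Finset.range (frameLength R t p).toNat, F (t + τ)

/-- The outcomes, actions and next states in the `k` slots that follow the time `t`. -/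
def segment (t k : ℕ) (p : Path N M L W A Z) : Fin k → ((W × Bool) × A) × Z :=
  fun i => ((outcome p (t + i), action p (t + i)), (slotRec (p (t + i + 1))).2)

/-- The renewal requirements. Renewals occur only in the state `0`, time `0` is a renewal time,
and:

* the first and second moments of the inter-renewal times are bounded by finite constants under
  every policy, regardless of the past;
* under a `(z, Ω)`-only policy the inter-renewal time and the sequence of outcomes, decisions and
  states over the renewal interval (hence also of the penalties) have the same law for every
  renewal and every past, i.e. they are i.i.d. over the renewal intervals. The auxiliary
  variables, which are no part of the network, have no influence on this law. -/
structure IsRenewalDefinition [Fintype M] (S : Network N M W A Z) (C : Program S L)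
    (R : RenewalRule N M L W A Z) : Prop where
  meas : ∀ t, MeasurableSet (R t)
  start : R 0 = Set.univ
  state_zero : ∀ t, ∀ h ∈ R t, histState S t h = S.zero
  moments : ∃ m₁ m₂ : ℝ≥0, ∀ (π : Policy S C) (t : ℕ), ∀ h ∈ R t,
    ∫⁻ p, (frameLength R t p : ℝ≥0∞) ∂(π.lawFrom t h) ≤ m₁ ∧
    ∫⁻ p, (frameLength R t p : ℝ≥0∞) ^ 2 ∂(π.lawFrom t h) ≤ m₂
  iid : ∀ (σ : StatPolicy S) (γ₀ γ₁ : S.box C.α) (t s : ℕ), ∀ h ∈ R t, ∀ h' ∈ R s,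
    ∀ (k : ℕ) (B : Set (Fin k → ((W × Bool) × A) × Z)), MeasurableSet B →
      (σ.toPolicy C γ₀).lawFrom t h {p | frameLength R t p = k ∧ segment t k p ∈ B} =
      (σ.toPolicy C γ₁).lawFrom s h' {p | frameLength R s p = k ∧ segment s k p ∈ B}

/-- Type-2 renewals: time `0` and the ends of the slots with a forced renewal event. -/
def typeTwoRenewals (S : Network N M W A Z) : RenewalRule N M L W A Z
  | 0 => Set.univ
  | t + 1 => {h | histState S (t + 1) h = S.zero ∧
      (slotRec (t := t) (h ⟨t + 1, Finset.mem_Iic.2 le_rfl⟩)).1.1.2 = true}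

/-! ### Feasible vectors and the optimal value -/

section

variable [Fintype M] {S : Network N M W A Z}

/-- There is a `(z, Ω)`-only policy with the average penalty vector `γ` over every renewal interval
and with `E{∑ d_n} / E{T} ≥ ε` for all `n`, and `h_l(γ) ≤ c_l` for all `l`. (The constant auxiliary
vector `γ₀` plays no role.) -/
def Attains (C : Program S L) (R : RenewalRule N M L W A Z) (ε : ℝ) (γ : M → ℝ) : Prop :=
  (∃ σ : StatPolicy S, ∀ (γ₀ : S.box C.α) (t : ℕ), ∀ h ∈ R t,
    (∀ m, (∫ p, frameSum R t p (fun τ => S.xhat m (point S p τ))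
          ∂((σ.toPolicy C γ₀).lawFrom t h)) /
        (∫⁻ p, (frameLength R t p : ℝ≥0∞) ∂((σ.toPolicy C γ₀).lawFrom t h)).toReal = γ m) ∧
    (∀ n, ε ≤ (∫ p, frameSum R t p (fun τ => S.dhat n (point S p τ))
          ∂((σ.toPolicy C γ₀).lawFrom t h)) /
        (∫⁻ p, (frameLength R t p : ℝ≥0∞) ∂((σ.toPolicy C γ₀).lawFrom t h)).toReal)) ∧
  ∀ l, C.h l γ ≤ C.c l

/-- `f^opt`: the infimum of `f` over the feasible average penalty vectors of `(z, Ω)`-only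
policies. -/
noncomputable def optimalValue (C : Program S L) (R : RenewalRule N M L W A Z) : ℝ :=
  sInf (C.f '' {γ | Attains C R 0 γ})

/-! ### The weighted stochastic shortest path problem -/

variable [Fintype N] [Fintype L]

/-- The drift-plus-penalty expression `D₂(Θ(t)) + V E{∑ f(γ)}` over the renewal interval that
starts at the time `t` with the history `h`, when the policy `π` is used. -/
noncomputable def driftPlusPenalty (R : RenewalRule N M L W A Z) {C : Program S L}
    (π : Policy S C) (t : ℕ) (h : Hist N M L W A Z t) : ℝ :=
  ∫ p,
    (- ∑ n, (backlog S C p t).1 n * frameSum R t p (fun τ => S.dhat n (point S p τ))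
     - ∑ m, (backlog S C p t).2.2 m *
          frameSum R t p (fun τ => aux p τ m - S.xhat m (point S p τ))
     - ∑ l, (backlog S C p t).2.1 l * frameSum R t p (fun τ => C.c l - C.h l (aux p τ))
     + C.V * frameSum R t p (fun τ => C.f (aux p τ))) ∂(π.lawFrom t h)

/-- The policy `π` implements an optimal solution of the weighted stochastic shortest path problem
in every renewal interval: given the history at the start of the interval, no other policy
has a smaller drift-plus-penalty expression over the interval. -/
def SolvesShortestPath (R : RenewalRule N M L W A Z) {C : Program S L} (π : Policy S C)
    (ρ : Measure (Backlog N M L)) : Prop :=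
  ∀ (π' : Policy S C) (t : ℕ), ∀ᵐ p ∂(π.law ρ), RenewsAt R p t →
    driftPlusPenalty R π t (frestrictLe (π := Coord N M L W A Z) t p) ≤
      driftPlusPenalty R π' t (frestrictLe (π := Coord N M L W A Z) t p)

/-- `B₂` is a valid drift constant for the policy `π`. -/
def IsDriftConstant (R : RenewalRule N M L W A Z) {C : Program S L} (π : Policy S C)
    (B₂ : ℝ) : Prop :=
  0 < B₂ ∧ ∀ (t : ℕ), ∀ h ∈ R t, ∀ (Ω : W × Bool) (z : Z), ∀ I ∈ S.actions Ω z,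
    ∀ γ ∈ S.box C.α,
      (∫⁻ p, (frameLength R t p : ℝ≥0∞) ^ 2 ∂(π.lawFrom t h)) / 2 *
        ENNReal.ofReal (∑ n, (S.μhat n (I, Ω, z) ^ 2 + S.Rhat n (I, Ω, z) ^ 2) +
          ∑ m, (γ m - S.xhat m (I, Ω, z)) ^ 2 + ∑ l, (C.h l γ - C.c l) ^ 2) ≤
      ENNReal.ofReal B₂

/-- The expected time average penalty vector `x̄(t)`. -/
noncomputable def avgPenalty {C : Program S L} (π : Policy S C) (ρ : Measure (Backlog N M L))
    (t : ℕ) : M → ℝ :=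
  fun m => (1 / (t : ℝ)) * ∑ τ ∈ Finset.range t, ∫ p, S.xhat m (point S p τ) ∂(π.law ρ)

end

end

end MarkovNet

set_option linter.unusedSectionVars false

/-! The proof is a Lyapunov drift argument carried out over whole renewal intervals. Squaring the
queue recursions over an interval of length `T` gives, path by path, L(end) ≤ L(start) + κT²/2 +
(drift term), where the drift term is linear in the backlog at the start and κ bounds the cost of
one slot (`lyapunov_le_add_driftTerm`). After taking conditional expectations, the quadratic part is
at most `B₂`, and the drift term plus the penalty `V ∑ f(γ)` is exactly the expression minimized by
the shortest path policy. That policy may therefore be compared with a `(z, Ω)`-only policy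
attaining a vector γ while γ itself is used as the constant auxiliary vector. For this competitor
the `W` terms vanish, the `Y` terms have a favourable sign, each queue gains at least ε times the
expected length, and the penalty is `V f(γ)` times the expected length (`weightedCost_toPolicy_le`).
Integrating over the past gives `HasFrameDrift`, from which all four claims follow.

Telescoping is done along deterministic time: `potential` evaluates the Lyapunov function at the
first renewal not before `t` and adds the penalty paid until then. It is unchanged when no renewal
occurs at `t`, and otherwise `HasFrameDrift` applies (`lintegral_potential_le`). Thus the expected
Lyapunov value at the next renewal is O(t). The overshoot up to that renewal has second moment O(t)
and the queues have bounded increments, so each queue has expected modulus O(√t); this is (a). For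
(b), `Y_l(t)` dominates the accumulated constraint violation of the auxiliary vectors, and `W(t) -
W(0)` is the accumulated difference between penalties and auxiliary vectors. Jensen's inequality and
the Lipschitz bound transfer the constraint to the average penalty.

For type-2 renewals, `φ(t)` is independent of the past, so the expected interval length is `1/φ`
under every policy (`lintegral_frameLength_typeTwo`). The lengths of the two compared policies then
agree in mean, and at most about `φt` renewals are expected before `t`. Telescoping yields (c) for
each attained γ, and then for the infimum. With ε > 0 the retained queue terms give the bound at
renewal times by telescoping along the `t_g`. Strong stability follows because a renewal at `t + 1`
is independent of `Q(t)`, so queues observed at renewals control queues at all times.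

Two devices keep the analysis rigorous. Since `f` and `h_l` need not be measurable outside the box,
calculations use `C.reg`, which agrees with `C` on almost every trajectory. Most expectations of
unbounded quantities are taken in `ℝ≥0∞`, with `f - fmin` in place of `f` and the ε-terms moved to
the left, so no integrability has to be known in advance. -/

namespace MarkovNet

/-! ### Conditioning the law of the trajectory on its past -/

section Disintegration

variable {N M L W A Z : Type u} [MeasurableSpace W] [MeasurableSpace A] [MeasurableSpace Z]

/-- The history of a trajectory at the beginning of the slot `t`. -/
abbrev past (t : ℕ) (p : Path N M L W A Z) : Hist N M L W A Z t :=
  frestrictLe (π := Coord N M L W A Z) t p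

theorem measurable_past (t : ℕ) :
    Measurable (past t : Path N M L W A Z → Hist N M L W A Z t) :=
  measurable_frestrictLe t

/-- The events that are known at the beginning of the slot `t`. -/
@[reducible] def pastSigma (N M L W A Z : Type u) [MeasurableSpace W] [MeasurableSpace A]
    [MeasurableSpace Z] (t : ℕ) : MeasurableSpace (Path N M L W A Z) :=
  MeasurableSpace.comap (past t) inferInstance

theorem pastSigma_le (t : ℕ) : pastSigma N M L W A Z t ≤ MeasurableSpace.pi :=
  (measurable_past t).comap_le

theorem measurable_coord {s t : ℕ} (hst : s ≤ t) :
    Measurable[pastSigma N M L W A Z t] (fun p : Path N M L W A Z => p s) := by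
  have h : Measurable[pastSigma N M L W A Z t] (past t : Path N M L W A Z → _) :=
    comap_measurable _
  exact (measurable_pi_apply (X := fun i : Finset.Iic t => Coord N M L W A Z i)
    ⟨s, Finset.mem_Iic.2 hst⟩).comp h

theorem pastSigma_mono {s t : ℕ} (hst : s ≤ t) :
    pastSigma N M L W A Z s ≤ pastSigma N M L W A Z t := by
  refine (@measurable_iff_comap_le _ _ (pastSigma N M L W A Z t) _ _).1 ?_
  exact (@measurable_pi_iff _ _ _ (pastSigma N M L W A Z t) _ _).2 fun i =>
    measurable_coord ((Finset.mem_Iic.1 i.2).trans hst)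

variable [Fintype M] {S : Network N M W A Z} {C : Program S L}

instance (π : Policy S C) (t : ℕ) (h : Hist N M L W A Z t) :
    IsProbabilityMeasure (π.lawFrom t h) := by
  unfold Policy.lawFrom
  infer_instance

instance (π : Policy S C) (ρ : Measure (Backlog N M L)) [IsProbabilityMeasure ρ] :
    IsProbabilityMeasure (π.law ρ) := by
  let ρ' : Measure (Coord N M L W A Z 0) := ρ
  have : IsProbabilityMeasure ρ' := ‹IsProbabilityMeasure ρ›
  change IsProbabilityMeasure (Kernel.trajMeasure ρ' π.step)
  infer_instance

theorem Policy.measurable_lawFrom (π : Policy S C) (t : ℕ) : Measurable (π.lawFrom t) :=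
  (Kernel.traj π.step t).measurable

/-- From the slot `t` on, the trajectory with the law `μ` is controlled by `π`. -/
def Follows (π : Policy S C) (t : ℕ) (μ : Measure (Path N M L W A Z)) : Prop :=
  ∀ τ, t ≤ τ → (μ.map (past τ)).bind (π.lawFrom τ) = μ

/-- Consistency of the Ionescu-Tulcea construction: running the partial trajectory up to `τ` and
continuing from there reproduces the full law. `Follows` abstracts this so that `lawFrom` and `law`
are handled by the same lemmas. -/
theorem follows_lawFrom (π : Policy S C) (t : ℕ) (h : Hist N M L W A Z t) :
    Follows π t (π.lawFrom t h) := by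
  intro τ hτ
  have h1 := Kernel.traj_comp_partialTraj (κ := π.step) hτ
  have h2 : (π.lawFrom t h).map (past τ) = Kernel.partialTraj π.step t τ h :=
    Kernel.traj_map_frestrictLe_apply t τ h
  rw [h2]
  exact congrArg (fun k : Kernel _ _ => k h) h1

theorem follows_law (π : Policy S C) (ρ : Measure (Backlog N M L)) [IsProbabilityMeasure ρ] :
    Follows π 0 (π.law ρ) := by
  intro τ hτ
  have h1 := Kernel.traj_comp_partialTraj (κ := π.step) hτ
  have h2 := Kernel.traj_map_frestrictLe (κ := π.step) 0 τ
  change ((Measure.bind _ (Kernel.traj π.step 0)).map (frestrictLe τ)).bind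
    (Kernel.traj π.step τ) = Measure.bind _ (Kernel.traj π.step 0)
  rw [Measure.map_comp _ _ (by fun_prop), h2, Measure.comp_assoc, h1]

/-- The partial trajectory from `t` to `t` is the identity kernel, so the past under the conditional
law is a Dirac mass at `h`. The form with a measurable set `E` is needed because singletons of
histories need not be measurable. -/
theorem ae_past_mem (π : Policy S C) (t : ℕ) {h : Hist N M L W A Z t}
    {E : Set (Hist N M L W A Z t)} (hE : MeasurableSet E) (hh : h ∈ E) :
    ∀ᵐ q ∂π.lawFrom t h, past t q ∈ E := by
  have h2 : (π.lawFrom t h).map (past t) = Measure.dirac h := by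
    refine (Kernel.traj_map_frestrictLe_apply (κ := π.step) t t h).trans ?_
    rw [Kernel.partialTraj_self, Kernel.id_apply]
  have h3 : ∀ᵐ x ∂(π.lawFrom t h).map (past t), x ∈ E := by
    rw [h2]
    exact (ae_dirac_iff hE).2 hh
  exact ae_of_ae_map (measurable_past t).aemeasurable h3

theorem ae_mem_lawFrom (π : Policy S C) (t : ℕ) {E : Set (Path N M L W A Z)}
    (hE : MeasurableSet[pastSigma N M L W A Z t] E) {p : Path N M L W A Z} (hp : p ∈ E) :
    ∀ᵐ q ∂π.lawFrom t (past t p), q ∈ E := by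
  obtain ⟨E', hE', rfl⟩ := hE
  exact ae_past_mem π t hE' hp

theorem ae_eq_lawFrom (π : Policy S C) (t : ℕ) {X : Type*} [MeasurableSpace X]
    [MeasurableSingletonClass X] {g : Path N M L W A Z → X}
    (hg : Measurable[pastSigma N M L W A Z t] g) (p : Path N M L W A Z) :
    ∀ᵐ q ∂π.lawFrom t (past t p), g q = g p :=
  ae_mem_lawFrom π t (E := {q | g q = g p}) (hg (measurableSet_singleton (g p))) rfl

theorem Follows.lintegral {π : Policy S C} {t : ℕ} {μ : Measure (Path N M L W A Z)}
    (hμ : Follows π t μ) {τ : ℕ} (hτ : t ≤ τ) {G : Path N M L W A Z → ℝ≥0∞} (hG : Measurable G) :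
    ∫⁻ p, G p ∂μ = ∫⁻ p, ∫⁻ q, G q ∂π.lawFrom τ (past τ p) ∂μ := by
  conv_lhs => rw [← hμ τ hτ]
  rw [Measure.lintegral_bind (π.measurable_lawFrom τ).aemeasurable hG.aemeasurable]
  exact lintegral_map ((Measure.measurable_lintegral hG).comp (π.measurable_lawFrom τ))
    (measurable_past τ)

/-- The tower property on an event of the past. Given the past of `p`, the indicator of `E` is
almost surely equal to its value at `p`, so it can be pulled out of the inner integral. -/
theorem Follows.setLIntegral {π : Policy S C} {t : ℕ} {μ : Measure (Path N M L W A Z)}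
    (hμ : Follows π t μ) {τ : ℕ} (hτ : t ≤ τ) {E : Set (Path N M L W A Z)}
    (hE : MeasurableSet[pastSigma N M L W A Z τ] E) {G : Path N M L W A Z → ℝ≥0∞}
    (hG : Measurable G) :
    ∫⁻ p in E, G p ∂μ = ∫⁻ p in E, ∫⁻ q, G q ∂π.lawFrom τ (past τ p) ∂μ := by
  have hE' := pastSigma_le τ _ hE
  rw [← lintegral_indicator hE', ← lintegral_indicator hE',
    hμ.lintegral hτ (hG.indicator hE')]
  refine lintegral_congr fun p => ?_
  by_cases hp : p ∈ E
  · rw [Set.indicator_of_mem hp]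
    refine lintegral_congr_ae ?_
    filter_upwards [ae_mem_lawFrom π τ hE hp] with q hq using Set.indicator_of_mem hq _
  · rw [Set.indicator_of_notMem hp]
    refine (lintegral_congr_ae (g := fun _ => 0) ?_).trans lintegral_zero
    filter_upwards [ae_mem_lawFrom π τ hE.compl hp] with q hq using Set.indicator_of_notMem hq _

theorem Follows.ae_of_forall {π : Policy S C} {t : ℕ} {μ : Measure (Path N M L W A Z)}
    (hμ : Follows π t μ) {τ : ℕ} (hτ : t ≤ τ) {P : Path N M L W A Z → Prop}
    (hPm : MeasurableSet {p | P p}) (hP : ∀ h, ∀ᵐ p ∂π.lawFrom τ h, P p) : ∀ᵐ p ∂μ, P p := by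
  rw [ae_iff]
  have h1 := hμ.lintegral hτ (measurable_const.indicator hPm.compl : Measurable
    ({p | P p}ᶜ.indicator fun _ => (1 : ℝ≥0∞)))
  rw [lintegral_indicator_const hPm.compl, one_mul] at h1
  refine h1.trans ?_
  refine (lintegral_congr (g := fun _ => 0) fun p => ?_).trans lintegral_zero
  rw [lintegral_indicator_const hPm.compl, one_mul]
  exact hP _

theorem map_lawFrom_succ (π : Policy S C) (t : ℕ) (h : Hist N M L W A Z t) :
    (π.lawFrom t h).map (fun p => p (t + 1)) = π.step t h := by
  have h1 := Kernel.map_traj_succ_self (κ := π.step) (a := t)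
  have h2 := congrArg (fun k : Kernel _ _ => k h) h1
  exact (Kernel.map_apply _ (measurable_pi_apply (t + 1)) h).symm.trans h2

theorem ae_step_decision (π : Policy S C) (t : ℕ) (h : Hist N M L W A Z t)
    {P : (A × (W × Bool) × Z) × (M → ℝ) → Prop} (hPm : MeasurableSet {x | P x})
    (hP : ∀ Ω, ∀ᵐ d ∂π.act t (h, Ω), P ((d.1, Ω, histState S t h), d.2)) :
    ∀ᵐ x ∂π.step t h, P (((slotRec x).1.2.1, (slotRec x).1.1, histState S t h),
      (slotRec x).1.2.2) := by
  have := π.act_markov t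
  have hm : Measurable fun x : (W × Bool) × A × (M → ℝ) =>
      (((x.2.1, x.1, histState S t h), x.2.2) : (A × (W × Bool) × Z) × (M → ℝ)) := by fun_prop
  change ∀ᵐ x : Slot M W A Z ∂((((Kernel.const (Hist N M L W A Z t) S.lawΩ) ⊗ₖ π.act t) ⊗ₖ
    S.trans.comap _ _) h), P ((x.1.2.1, x.1.1, histState S t h), x.1.2.2)
  refine (Kernel.ae_compProd_iff (p := fun x : ((W × Bool) × A × (M → ℝ)) × Z =>
    P ((x.1.2.1, x.1.1, histState S t h), x.1.2.2)) ((hm.comp measurable_fst) hPm)).2 ?_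
  have h2 : ∀ᵐ b ∂((Kernel.const (Hist N M L W A Z t) S.lawΩ) ⊗ₖ π.act t) h,
      P ((b.2.1, b.1, histState S t h), b.2.2) := by
    refine (Kernel.ae_compProd_iff (p := fun b : (W × Bool) × A × (M → ℝ) =>
      P ((b.2.1, b.1, histState S t h), b.2.2)) (hm hPm)).2 ?_
    exact ae_of_all _ hP
  filter_upwards [h2] with b hb using ae_of_all _ fun _ => hb

theorem ae_step_next (π : Policy S C) (t : ℕ) (h : Hist N M L W A Z t)
    {P : (A × (W × Bool) × Z) × Z → Prop} (hPm : MeasurableSet {x | P x})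
    (hP : ∀ Ω, ∀ I ∈ S.actions Ω (histState S t h),
      ∀ᵐ z ∂S.trans (I, Ω, histState S t h), P ((I, Ω, histState S t h), z)) :
    ∀ᵐ x ∂π.step t h, P (((slotRec x).1.2.1, (slotRec x).1.1, histState S t h),
      (slotRec x).2) := by
  have := π.act_markov t
  have hm : Measurable fun x : Slot M W A Z =>
      (((x.1.2.1, x.1.1, histState S t h), x.2) : (A × (W × Bool) × Z) × Z) := by fun_prop
  change ∀ᵐ x : Slot M W A Z ∂((((Kernel.const (Hist N M L W A Z t) S.lawΩ) ⊗ₖ π.act t) ⊗ₖ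
    S.trans.comap _ _) h), P ((x.1.2.1, x.1.1, histState S t h), x.2)
  -- Disintegrating the almost sure statement requires a measurable event; this one is the zero set
  -- of the kernel mass of the sections of the complement.
  have hm' : MeasurableSet {q : A × (W × Bool) × Z | ∀ᵐ z ∂S.trans q, P (q, z)} := by
    have := Kernel.measurable_kernel_prodMk_left (κ := S.trans) hPm.compl
    exact this (measurableSet_singleton 0)
  have hm2 : Measurable fun x : (W × Bool) × A × (M → ℝ) =>
      ((x.2.1, x.1, histState S t h) : A × (W × Bool) × Z) := by fun_prop
  refine (Kernel.ae_compProd_iff (p := fun x : ((W × Bool) × A × (M → ℝ)) × Z =>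
    P ((x.1.2.1, x.1.1, histState S t h), x.2)) (hm hPm)).2 ?_
  refine (Kernel.ae_compProd_iff (p := fun x : (W × Bool) × A × (M → ℝ) =>
    ∀ᵐ z ∂S.trans (x.2.1, x.1, histState S t h), P ((x.2.1, x.1, histState S t h), z))
    (hm2 hm')).2 ?_
  refine ae_of_all _ fun Ω => ?_
  filter_upwards [π.act_mem t h Ω] with d hd using hP Ω d.1 hd.1

end Disintegration

section Regularity

variable {N M L W A Z : Type u} [MeasurableSpace W] [MeasurableSpace A] [MeasurableSpace Z]

/-! ### Measurability of the coordinates -/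

theorem state_eq_histState (S : Network N M W A Z) (p : Path N M L W A Z) (t : ℕ) :
    state S p t = histState S t (past t p) := by
  cases t <;> rfl

theorem measurable_slot {s t : ℕ} (hst : s < t) :
    Measurable[pastSigma N M L W A Z t] (fun p : Path N M L W A Z => slotRec (p (s + 1))) :=
  (measurable_slotRec s).comp (measurable_coord hst)

theorem measurable_outcome {s t : ℕ} (hst : s < t) :
    Measurable[pastSigma N M L W A Z t] (fun p : Path N M L W A Z => outcome p s) :=
  (measurable_fst.comp measurable_fst).comp (measurable_slot hst)

theorem measurable_action {s t : ℕ} (hst : s < t) :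
    Measurable[pastSigma N M L W A Z t] (fun p : Path N M L W A Z => action p s) :=
  (measurable_fst.comp (measurable_snd.comp measurable_fst)).comp (measurable_slot hst)

theorem measurable_aux {s t : ℕ} (hst : s < t) :
    Measurable[pastSigma N M L W A Z t] (fun p : Path N M L W A Z => aux p s) :=
  (measurable_snd.comp (measurable_snd.comp measurable_fst)).comp (measurable_slot hst)

theorem measurable_state (S : Network N M W A Z) {s t : ℕ} (hst : s ≤ t) :
    Measurable[pastSigma N M L W A Z t] (fun p : Path N M L W A Z => state S p s) := by
  have h : Measurable[pastSigma N M L W A Z s] (past s : Path N M L W A Z → _) :=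
    comap_measurable _
  have h2 := ((measurable_histState S s).comp h).mono (pastSigma_mono hst) le_rfl
  have h3 : (fun p : Path N M L W A Z => state S p s) = histState S s ∘ past s :=
    funext fun p => state_eq_histState S p s
  rwa [h3]

theorem measurable_point (S : Network N M W A Z) {s t : ℕ} (hst : s < t) :
    Measurable[pastSigma N M L W A Z t] (fun p : Path N M L W A Z => point S p s) := by
  change Measurable[pastSigma N M L W A Z t] fun p : Path N M L W A Z =>
    (action p s, outcome p s, state S p s)
  exact (measurable_action hst).prodMk ((measurable_outcome hst).prodMk (measurable_state S hst.le))

/-! ### Programs with globally measurable functions -/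

theorem box_eq_Icc (S : Network N M W A Z) (α : ℝ) :
    S.box α = Set.Icc (fun m => S.xmin m - α) (fun m => S.xmax m + α) := by
  ext γ
  simp only [Network.box, Set.mem_ofPred_eq, Set.mem_Icc, Pi.le_def, forall_and]

theorem isCompact_box (S : Network N M W A Z) (α : ℝ) : IsCompact (S.box α) := by
  rw [box_eq_Icc]
  exact isCompact_Icc

theorem convex_box (S : Network N M W A Z) (α : ℝ) : Convex ℝ (S.box α) := by
  rw [box_eq_Icc]
  exact convex_Icc _ _

variable [Fintype M] {S : Network N M W A Z}

theorem measurableSet_box (S : Network N M W A Z) (α : ℝ) : MeasurableSet (S.box α) :=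
  (isCompact_box S α).isClosed.measurableSet

/-- The Lipschitz bound is Euclidean while `M → ℝ` carries the product topology; the continuity of
`toLp` bridges the two. -/
theorem continuousOn_of_lipschitz {s : Set (M → ℝ)} {g : (M → ℝ) → ℝ} {β : ℝ}
    (hg : ∀ γ ∈ s, ∀ γ' ∈ s, |g γ - g γ'| ≤ β * ‖WithLp.toLp 2 (γ - γ')‖) : ContinuousOn g s := by
  intro γ hγ
  have h1 : Continuous fun γ' : M → ℝ => β * ‖WithLp.toLp 2 (γ' - γ)‖ :=
    continuous_const.mul ((PiLp.continuous_toLp 2 _).comp (continuous_id.sub continuous_const)).norm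
  have h2 : Tendsto (fun γ' : M → ℝ => β * ‖WithLp.toLp 2 (γ' - γ)‖) (𝓝[s] γ) (𝓝 0) := by
    have := h1.tendsto γ
    simp only [sub_self, WithLp.toLp_zero, norm_zero, mul_zero] at this
    exact this.mono_left nhdsWithin_le_nhds
  refine tendsto_iff_dist_tendsto_zero.2 (squeeze_zero' (Eventually.of_forall fun _ => dist_nonneg)
    ?_ h2)
  filter_upwards [self_mem_nhdsWithin] with γ' hγ'
  rw [Real.dist_eq]
  exact hg γ' hγ' γ hγ

theorem Program.continuousOn_f (C : Program S L) : ContinuousOn C.f (S.box C.α) :=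
  continuousOn_of_lipschitz C.f_lip

theorem Program.continuousOn_h (C : Program S L) (l : L) : ContinuousOn (C.h l) (S.box C.α) :=
  continuousOn_of_lipschitz (C.h_lip l)

/-- The program with `f` and `h_l` set to `0` outside of the set of allowed vectors. -/
noncomputable def Program.reg (C : Program S L) : Program S L where
  f := (S.box C.α).indicator C.f
  h l := (S.box C.α).indicator (C.h l)
  c := C.c
  V := C.V
  V_nonneg := C.V_nonneg
  α := C.α
  α_nonneg := C.α_nonneg
  f_convex := C.f_convex.congr fun _ hγ => (Set.indicator_of_mem hγ _).symm
  h_convex l := (C.h_convex l).congr fun _ hγ => (Set.indicator_of_mem hγ _).symm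
  fmin := C.fmin
  fmax := C.fmax
  f_bd γ hγ := by
    rw [Set.indicator_of_mem hγ]
    exact C.f_bd γ hγ
  β := C.β
  f_lip γ hγ γ' hγ' := by
    rw [Set.indicator_of_mem hγ, Set.indicator_of_mem hγ']
    exact C.f_lip γ hγ γ' hγ'
  h_lip l γ hγ γ' hγ' := by
    rw [Set.indicator_of_mem hγ, Set.indicator_of_mem hγ']
    exact C.h_lip l γ hγ γ' hγ'

theorem Program.reg_f (C : Program S L) {γ : M → ℝ} (hγ : γ ∈ S.box C.α) : C.reg.f γ = C.f γ :=
  Set.indicator_of_mem hγ _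

theorem Program.reg_h (C : Program S L) (l : L) {γ : M → ℝ} (hγ : γ ∈ S.box C.α) :
    C.reg.h l γ = C.h l γ :=
  Set.indicator_of_mem hγ _

theorem measurable_indicator_of_continuousOn {s : Set (M → ℝ)} (hs : MeasurableSet s)
    {g : (M → ℝ) → ℝ} (hg : ContinuousOn g s) : Measurable (s.indicator g) := by
  classical
  rw [← Set.piecewise_eq_indicator]
  exact hg.measurable_piecewise continuousOn_const hs

theorem Program.measurable_reg_f (C : Program S L) : Measurable C.reg.f :=
  measurable_indicator_of_continuousOn (measurableSet_box S _) C.continuousOn_f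

theorem Program.measurable_reg_h (C : Program S L) (l : L) : Measurable (C.reg.h l) :=
  measurable_indicator_of_continuousOn (measurableSet_box S _) (C.continuousOn_h l)

theorem Program.exists_bound_h (C : Program S L) (l : L) :
    ∃ b, ∀ γ ∈ S.box C.α, |C.h l γ| ≤ b :=
  (isCompact_box S _).exists_bound_of_continuousOn (C.continuousOn_h l)

/-! ### Admissible slots -/

/-- The bounds which hold for the decision taken in a slot. -/
def Network.Admissible (S : Network N M W A Z) (α : ℝ) (q : A × (W × Bool) × Z) (γ : M → ℝ) :
    Prop :=
  γ ∈ S.box α ∧ (∀ n, 0 ≤ S.μhat n q ∧ S.μhat n q ≤ S.μmax n) ∧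
    (∀ n, 0 ≤ S.Rhat n q ∧ S.Rhat n q ≤ S.Rmax n) ∧
    ∀ m, S.xmin m ≤ S.xhat m q ∧ S.xhat m q ≤ S.xmax m

/-- `Admissible` records only numerical bounds and membership in the box, because the sets
`S.actions Ω z` are not assumed measurable. The bounds form a measurable event, which can be
transferred to almost every trajectory. -/
theorem measurableSet_admissible [Finite N] (S : Network N M W A Z) (α : ℝ) :
    MeasurableSet {x : (A × (W × Bool) × Z) × (M → ℝ) | S.Admissible α x.1 x.2} := by
  have hq (g : A × (W × Bool) × Z → ℝ) (hg : Measurable g) (a b : ℝ) :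
      Measurable fun x : (A × (W × Bool) × Z) × (M → ℝ) => a ≤ g x.1 ∧ g x.1 ≤ b :=
    have hg' := hg.comp (measurable_fst (β := M → ℝ))
    (measurableSet_le measurable_const hg').mem.and (measurableSet_le hg' measurable_const).mem
  exact ((measurable_snd (measurableSet_box S α)).mem.and
    ((Measurable.forall fun n => hq _ (S.μhat_meas n) _ _).and
      ((Measurable.forall fun n => hq _ (S.Rhat_meas n) _ _).and
        (Measurable.forall fun m => hq _ (S.xhat_meas m) _ _)))).setOf

variable {C : Program S L}

theorem measurable_backlog (hC : ∀ l, Measurable (C.h l)) (t : ℕ) :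
    (∀ n, Measurable[pastSigma N M L W A Z t] fun p => (backlog S C p t).1 n) ∧
    (∀ l, Measurable[pastSigma N M L W A Z t] fun p => (backlog S C p t).2.1 l) ∧
    (∀ m, Measurable[pastSigma N M L W A Z t] fun p => (backlog S C p t).2.2 m) := by
  induction t with
  | zero =>
    have h : Measurable[pastSigma N M L W A Z 0] (fun p : Path N M L W A Z => backlog S C p 0) :=
      measurable_coord le_rfl
    exact ⟨fun n => (measurable_pi_apply n).comp (measurable_fst.comp h),
      fun l => (measurable_pi_apply l).comp (measurable_fst.comp (measurable_snd.comp h)),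
      fun m => (measurable_pi_apply m).comp (measurable_snd.comp (measurable_snd.comp h))⟩
  | succ t ih =>
    obtain ⟨hQ, hY, hW⟩ := ih
    have hle := pastSigma_mono (N := N) (M := M) (L := L) (W := W) (A := A) (Z := Z) t.le_succ
    have hp := measurable_point (L := L) S t.lt_succ_self
    have ha := measurable_aux (N := N) (M := M) (L := L) (W := W) (A := A) (Z := Z) t.lt_succ_self
    refine ⟨fun n => ?_, fun l => ?_, fun m => ?_⟩
    · exact ((((hQ n).mono hle le_rfl).sub ((S.μhat_meas n).comp hp)).max measurable_const).add
        ((S.Rhat_meas n).comp hp)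
    · exact ((((hY l).mono hle le_rfl).sub measurable_const).add ((hC l).comp ha)).max
        measurable_const
    · exact (((hW m).mono hle le_rfl).sub ((measurable_pi_apply m).comp ha)).add
        ((S.xhat_meas m).comp hp)

/-! ### Almost sure properties of the trajectories -/

variable [Countable Z] [DiscreteMeasurableSpace Z]

theorem Follows.ae_decision {π : Policy S C} {t : ℕ} {μ : Measure (Path N M L W A Z)}
    (hμ : Follows π t μ) {P : (A × (W × Bool) × Z) × (M → ℝ) → Prop} (hPm : MeasurableSet {x | P x})
    (hP : ∀ τ, t ≤ τ → ∀ (h : Hist N M L W A Z τ) Ω,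
      ∀ᵐ d ∂π.act τ (h, Ω), P ((d.1, Ω, histState S τ h), d.2)) :
    ∀ᵐ p ∂μ, ∀ τ, t ≤ τ → P (point S p τ, aux p τ) := by
  refine ae_all_iff.2 fun τ => ?_
  by_cases hτ : t ≤ τ
  swap
  · exact ae_of_all _ fun p h => absurd h hτ
  have hm : Measurable fun p : Path N M L W A Z => (point S p τ, aux p τ) :=
    ((measurable_point S τ.lt_succ_self).mono (pastSigma_le _) le_rfl).prodMk
      ((measurable_aux τ.lt_succ_self).mono (pastSigma_le _) le_rfl)
  have h0 : ∀ᵐ p ∂μ, P (point S p τ, aux p τ) := by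
    refine hμ.ae_of_forall hτ (hm hPm) fun h => ?_
    have h1 := ae_step_decision π τ h hPm (hP τ hτ h)
    rw [← map_lawFrom_succ] at h1
    have h2 := ae_of_ae_map (measurable_pi_apply (τ + 1)).aemeasurable h1
    -- The state space is discrete, so the state at `τ` is almost surely the one recorded in `h`.
    -- This lets the kernel statement, phrased with `histState`, be read off the trajectory.
    have h3 := ae_past_mem π τ (E := {h' | histState S τ h' = histState S τ h})
      (measurable_histState S τ (measurableSet_singleton _)) rfl
    filter_upwards [h2, h3] with p hp2 hp3
    have h4 : state S p τ = histState S τ h := (state_eq_histState S p τ).trans hp3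
    change P ((action p τ, outcome p τ, state S p τ), aux p τ)
    rw [h4]
    exact hp2
  filter_upwards [h0] with p hp _ using hp

theorem Follows.ae_next {π : Policy S C} {t : ℕ} {μ : Measure (Path N M L W A Z)}
    (hμ : Follows π t μ) {P : (A × (W × Bool) × Z) × Z → Prop} (hPm : MeasurableSet {x | P x})
    (hP : ∀ Ω y, ∀ I ∈ S.actions Ω y, ∀ᵐ z ∂S.trans (I, Ω, y), P ((I, Ω, y), z)) :
    ∀ᵐ p ∂μ, ∀ τ, t ≤ τ → P (point S p τ, state S p (τ + 1)) := by
  refine ae_all_iff.2 fun τ => ?_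
  by_cases hτ : t ≤ τ
  swap
  · exact ae_of_all _ fun p h => absurd h hτ
  have hm : Measurable fun p : Path N M L W A Z => (point S p τ, state S p (τ + 1)) :=
    ((measurable_point S τ.lt_succ_self).mono (pastSigma_le _) le_rfl).prodMk
      ((measurable_state S le_rfl).mono (pastSigma_le _) le_rfl)
  have h0 : ∀ᵐ p ∂μ, P (point S p τ, state S p (τ + 1)) := by
    refine hμ.ae_of_forall hτ (hm hPm) fun h => ?_
    have h1 := ae_step_next π τ h hPm fun Ω => hP Ω _
    rw [← map_lawFrom_succ] at h1
    have h2 := ae_of_ae_map (measurable_pi_apply (τ + 1)).aemeasurable h1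
    have h3 := ae_past_mem π τ (E := {h' | histState S τ h' = histState S τ h})
      (measurable_histState S τ (measurableSet_singleton _)) rfl
    filter_upwards [h2, h3] with p hp2 hp3
    have h4 : state S p τ = histState S τ h := (state_eq_histState S p τ).trans hp3
    change P ((action p τ, outcome p τ, state S p τ), _)
    rw [h4]
    exact hp2
  filter_upwards [h0] with p hp _ using hp

theorem Follows.ae_admissible [Finite N] {π : Policy S C} {t : ℕ}
    {μ : Measure (Path N M L W A Z)} (hμ : Follows π t μ) :
    ∀ᵐ p ∂μ, ∀ τ, t ≤ τ → S.Admissible C.α (point S p τ) (aux p τ) :=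
  hμ.ae_decision (P := fun x => S.Admissible C.α x.1 x.2) (measurableSet_admissible S C.α)
    fun τ _ h Ω => (π.act_mem τ h Ω).mono fun _ hd =>
      ⟨hd.2, fun n => S.μhat_bd n _ _ _ hd.1, fun n => S.Rhat_bd n _ _ _ hd.1,
        fun m => S.xhat_bd m _ _ _ hd.1⟩

theorem Follows.ae_forced {π : Policy S C} {t : ℕ}
    {μ : Measure (Path N M L W A Z)} (hμ : Follows π t μ) :
    ∀ᵐ p ∂μ, ∀ τ, t ≤ τ → (outcome p τ).2 = true → state S p (τ + 1) = S.zero := by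
  refine hμ.ae_next (P := fun x => x.1.2.1.2 = true → x.2 = S.zero) ?_ fun Ω y I hI => ?_
  · exact MeasurableSet.imp
      (((measurable_snd.comp (measurable_fst.comp (measurable_snd.comp measurable_fst)))
        (measurableSet_singleton true)))
      (measurable_snd (measurableSet_singleton S.zero))
  · obtain ⟨ω, b⟩ := Ω
    cases b with
    | false => exact ae_of_all _ fun _ h => absurd h (by simp)
    | true =>
      rw [S.forced ω y I hI]
      have h : ∀ᵐ z ∂Measure.dirac S.zero, z = S.zero :=
        (ae_dirac_iff (p := fun z => z = S.zero) (.of_discrete)).2 rfl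
      filter_upwards [h] with z hz _ using hz

end Regularity

/-! ### Sample path bounds for the queues -/

/-- Induction on `k`, carrying along `q 0 - ∑ a ≤ q k ≤ q 0 + ∑ b`. One step costs `-2 q k (a - b) +
a² + b²`; replacing `q k` by `q 0` with the lower bound in the service part and the upper bound in
the arrival part completes the two squares separately. No mixed term `(∑ a)(∑ b)` arises, which is
why `B₂` only needs `μ² + R²`. -/
theorem sq_queue_le {q a b : ℕ → ℝ} (h0 : 0 ≤ q 0) {k : ℕ} (ha : ∀ i < k, 0 ≤ a i)
    (hb : ∀ i < k, 0 ≤ b i) (hq : ∀ i < k, q (i + 1) = max (q i - a i) 0 + b i) :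
    q k ^ 2 ≤ q 0 ^ 2 - 2 * q 0 * ∑ i ∈ Finset.range k, (a i - b i) +
      (∑ i ∈ Finset.range k, a i) ^ 2 + (∑ i ∈ Finset.range k, b i) ^ 2 := by
  suffices H : 0 ≤ q k ∧ q 0 - ∑ i ∈ Finset.range k, a i ≤ q k ∧
      q k ≤ q 0 + ∑ i ∈ Finset.range k, b i ∧
      q k ^ 2 ≤ q 0 ^ 2 - 2 * q 0 * ∑ i ∈ Finset.range k, (a i - b i) +
        (∑ i ∈ Finset.range k, a i) ^ 2 + (∑ i ∈ Finset.range k, b i) ^ 2 from H.2.2.2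
  induction k with
  | zero => simp [h0]
  | succ k ih =>
    obtain ⟨h1, h2, h3, h4⟩ := ih (fun i hi => ha i (hi.trans k.lt_succ_self))
      (fun i hi => hb i (hi.trans k.lt_succ_self)) (fun i hi => hq i (hi.trans k.lt_succ_self))
    have ha' := ha k k.lt_succ_self
    have hb' := hb k k.lt_succ_self
    have hA : 0 ≤ ∑ i ∈ Finset.range k, a i :=
      Finset.sum_nonneg fun i hi => ha i ((Finset.mem_range.1 hi).trans k.lt_succ_self)
    have hB : 0 ≤ ∑ i ∈ Finset.range k, b i :=
      Finset.sum_nonneg fun i hi => hb i ((Finset.mem_range.1 hi).trans k.lt_succ_self)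
    simp only [Finset.sum_range_succ]
    rw [hq k k.lt_succ_self]
    set A := ∑ i ∈ Finset.range k, a i
    set B := ∑ i ∈ Finset.range k, b i
    set D := ∑ i ∈ Finset.range k, (a i - b i)
    have e1 : max (q k - a k) 0 ≤ q k := max_le (by linarith) h1
    have e2 : q k - a k ≤ max (q k - a k) 0 := le_max_left _ _
    have e3 : 0 ≤ max (q k - a k) 0 := le_max_right _ _
    have e4 : max (q k - a k) 0 ^ 2 ≤ (q k - a k) ^ 2 := by
      rcases max_cases (q k - a k) 0 with ⟨h, _⟩ | ⟨h, _⟩ <;> rw [h]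
      nlinarith [sq_nonneg (q k - a k)]
    set x := max (q k - a k) 0
    refine ⟨by linarith, by linarith, by linarith, ?_⟩
    nlinarith [mul_le_mul_of_nonneg_right e1 hb', mul_nonneg (sub_nonneg.2 h3) hb',
      mul_nonneg (sub_nonneg.2 h2) ha']

/-- Reflection at `0` does not increase the square, and it does not increase the size of the step
since `y k ≥ 0`. Hence `|y k - y 0| ≤ ∑ |a|`, which bounds the error made when `y k` is replaced by
`y 0` in the linear term. -/
theorem sq_reflected_le {y a : ℕ → ℝ} {k : ℕ} (hy : ∀ i < k, y (i + 1) = max (y i + a i) 0)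
    (h0 : 0 ≤ y 0) :
    y k ^ 2 ≤ y 0 ^ 2 + 2 * y 0 * ∑ i ∈ Finset.range k, a i +
      (∑ i ∈ Finset.range k, |a i|) ^ 2 := by
  suffices H : 0 ≤ y k ∧ |y k - y 0| ≤ ∑ i ∈ Finset.range k, |a i| ∧
      y k ^ 2 ≤ y 0 ^ 2 + 2 * y 0 * ∑ i ∈ Finset.range k, a i +
        (∑ i ∈ Finset.range k, |a i|) ^ 2 from H.2.2
  induction k with
  | zero => simp [h0]
  | succ k ih =>
    obtain ⟨h1, h2, h3⟩ := ih fun i hi => hy i (hi.trans k.lt_succ_self)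
    simp only [Finset.sum_range_succ]
    rw [hy k k.lt_succ_self]
    set B := ∑ i ∈ Finset.range k, |a i|
    set D := ∑ i ∈ Finset.range k, a i
    have e1 : |max (y k + a k) 0 - y k| ≤ |a k| := by
      rcases max_cases (y k + a k) 0 with ⟨h, h'⟩ | ⟨h, h'⟩ <;> rw [h]
      · simp
      · rw [zero_sub, abs_neg, abs_of_nonneg h1, abs_of_nonpos (by linarith)]
        linarith
    have e2 : max (y k + a k) 0 ^ 2 ≤ (y k + a k) ^ 2 := by
      rcases max_cases (y k + a k) 0 with ⟨h, _⟩ | ⟨h, _⟩ <;> rw [h]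
      nlinarith [sq_nonneg (y k + a k)]
    refine ⟨le_max_right _ _, ?_, ?_⟩
    · calc |max (y k + a k) 0 - y 0| = |(max (y k + a k) 0 - y k) + (y k - y 0)| := by ring_nf
        _ ≤ |a k| + B := (abs_add_le _ _).trans (add_le_add e1 h2)
        _ = B + |a k| := add_comm _ _
    · have e3 : (y k - y 0) * a k ≤ B * |a k| := (le_abs_self _).trans
        (by rw [abs_mul]; exact mul_le_mul_of_nonneg_right h2 (abs_nonneg _))
      nlinarith [sq_abs (a k)]

/-- The comparison runs backwards in time: it bounds a queue at an arbitrary slot by its value at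
the next renewal. -/
theorem abs_le_abs_add_of_step {g : ℕ → ℝ} {b : ℝ} {s : ℕ} (hg : ∀ τ, s ≤ τ → |g (τ + 1) - g τ| ≤ b)
    {t : ℕ} (hst : s ≤ t) : |g s| ≤ |g t| + ((t - s : ℕ) : ℝ) * b := by
  induction t, hst using Nat.le_induction with
  | base => simp
  | succ t ht ih =>
    have h1 : |g t| ≤ |g (t + 1)| + b := by
      have h2 := hg t ht
      have h3 := abs_sub_abs_le_abs_sub (g t) (g (t + 1))
      rw [abs_sub_comm] at h3
      linarith
    rw [Nat.succ_sub ht]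
    push_cast
    linarith

/-! ### The backlog vector and its Lyapunov drift over several slots -/

section Backlog

variable {N M L W A Z : Type u} [MeasurableSpace W] [MeasurableSpace A] [MeasurableSpace Z]
  [Fintype M] {S : Network N M W A Z} {C : Program S L} {p : Path N M L W A Z}

/-- The auxiliary vectors lie in the box on almost every trajectory, so this identity carries
results for the measurable program `C.reg` over to `C`. -/
theorem backlog_reg {t : ℕ} (hp : ∀ τ < t, aux p τ ∈ S.box C.α) :
    backlog S C.reg p t = backlog S C p t := by
  induction t with
  | zero => rfl
  | succ t ih =>
    have h := ih fun τ hτ => hp τ (hτ.trans t.lt_succ_self)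
    simp only [backlog, h, C.reg_h _ (hp t t.lt_succ_self)]
    rfl

theorem backlog_nonneg (h0 : (∀ n, 0 ≤ (p 0 : Backlog N M L).1 n) ∧
    ∀ l, 0 ≤ (p 0 : Backlog N M L).2.1 l) {t : ℕ}
    (hp : ∀ τ < t, S.Admissible C.α (point S p τ) (aux p τ)) :
    (∀ n, 0 ≤ (backlog S C p t).1 n) ∧ ∀ l, 0 ≤ (backlog S C p t).2.1 l := by
  cases t with
  | zero => exact h0
  | succ t =>
    exact ⟨fun n => add_nonneg (le_max_right _ _) ((hp t t.lt_succ_self).2.2.1 n).1,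
      fun l => le_max_right _ _⟩

theorem abs_queue_step_le {t : ℕ} (hp : S.Admissible C.α (point S p t) (aux p t))
    (n : N) (h0 : 0 ≤ (backlog S C p t).1 n) :
    |(backlog S C p (t + 1)).1 n - (backlog S C p t).1 n| ≤ S.μmax n + S.Rmax n := by
  obtain ⟨h1, h2⟩ := hp.2.1 n
  obtain ⟨h3, h4⟩ := hp.2.2.1 n
  simp only [backlog]
  rcases max_cases ((backlog S C p t).1 n - S.μhat n (point S p t)) 0 with ⟨h, h'⟩ | ⟨h, h'⟩ <;>
    rw [h, abs_le] <;> constructor <;> linarith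

theorem queue_le_succ_add {t : ℕ} (hp : S.Admissible C.α (point S p t) (aux p t)) (n : N) :
    (backlog S C p t).1 n ≤ (backlog S C p (t + 1)).1 n + S.μmax n := by
  have h1 := (hp.2.1 n).2
  have h3 := (hp.2.2.1 n).1
  have h5 := le_max_left ((backlog S C p t).1 n - S.μhat n (point S p t)) 0
  simp only [backlog]
  linarith

theorem abs_virtual_step_le {t : ℕ} {l : L} {b : ℝ} (hb : ∀ γ ∈ S.box C.α, |C.h l γ| ≤ b)
    (hp : aux p t ∈ S.box C.α) (h0 : 0 ≤ (backlog S C p t).2.1 l) :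
    |(backlog S C p (t + 1)).2.1 l - (backlog S C p t).2.1 l| ≤ |C.c l| + b := by
  have h1 := abs_le.1 (hb _ hp)
  have h2 := le_abs_self (C.c l)
  have h3 := neg_abs_le (C.c l)
  simp only [backlog]
  rcases max_cases ((backlog S C p t).2.1 l - C.c l + C.h l (aux p t)) 0 with ⟨h, h'⟩ | ⟨h, h'⟩ <;>
    rw [h, abs_le] <;> constructor <;> linarith

theorem abs_aux_sub_le {t : ℕ} (hp : S.Admissible C.α (point S p t) (aux p t)) (m : M) :
    |aux p t m - S.xhat m (point S p t)| ≤ S.xmax m - S.xmin m + C.α := by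
  obtain ⟨h1, h2⟩ := hp.1 m
  obtain ⟨h3, h4⟩ := hp.2.2.2 m
  rw [abs_le]
  constructor <;> linarith

/-- The expression bounded by the drift constant. -/
noncomputable def slotCost [Fintype N] [Fintype L] (S : Network N M W A Z) (C : Program S L)
    (q : A × (W × Bool) × Z) (γ : M → ℝ) : ℝ :=
  ∑ n, (S.μhat n q ^ 2 + S.Rhat n q ^ 2) + ∑ m, (γ m - S.xhat m q) ^ 2 +
    ∑ l, (C.h l γ - C.c l) ^ 2

variable [Fintype N] [Fintype L]

/-- The drift of the queues over `k` slots, without the penalty. -/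
noncomputable def driftTerm (S : Network N M W A Z) (C : Program S L) (p : Path N M L W A Z)
    (s k : ℕ) : ℝ :=
  - ∑ n, (backlog S C p s).1 n * ∑ i ∈ Finset.range k, S.dhat n (point S p (s + i))
    - ∑ m, (backlog S C p s).2.2 m *
        ∑ i ∈ Finset.range k, (aux p (s + i) m - S.xhat m (point S p (s + i)))
    - ∑ l, (backlog S C p s).2.1 l * ∑ i ∈ Finset.range k, (C.c l - C.h l (aux p (s + i)))

/-- The bounds on the squares of the individual queues are summed. Cauchy-Schwarz, `(∑ a)² ≤ k ∑
a²`, reduces the quadratic remainder to a sum of slot costs, each at most `κ`; the two factors `k`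
are the origin of `T²` in the drift constant. -/
theorem lyapunov_le_add_driftTerm {s k : ℕ}
    (hp : ∀ i < k, S.Admissible C.α (point S p (s + i)) (aux p (s + i)))
    (hQ : ∀ n, 0 ≤ (backlog S C p s).1 n) (hY : ∀ l, 0 ≤ (backlog S C p s).2.1 l) {κ : ℝ}
    (hκ : ∀ i < k, slotCost S C (point S p (s + i)) (aux p (s + i)) ≤ κ) :
    lyapunov (backlog S C p (s + k)) ≤
      lyapunov (backlog S C p s) + κ * (k : ℝ) ^ 2 / 2 + driftTerm S C p s k := by
  have hcs : ∀ a : ℕ → ℝ, (∑ i ∈ Finset.range k, a i) ^ 2 ≤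
      k * ∑ i ∈ Finset.range k, a i ^ 2 := fun a => by
    simpa using sq_sum_le_card_mul_sum_sq (s := Finset.range k) (f := a)
  have h1 : ∀ n, (backlog S C p (s + k)).1 n ^ 2 ≤ (backlog S C p s).1 n ^ 2 -
      2 * ((backlog S C p s).1 n * ∑ i ∈ Finset.range k, S.dhat n (point S p (s + i))) +
      k * ∑ i ∈ Finset.range k,
        (S.μhat n (point S p (s + i)) ^ 2 + S.Rhat n (point S p (s + i)) ^ 2) := fun n => by
    have := sq_queue_le (q := fun i => (backlog S C p (s + i)).1 n)
      (a := fun i => S.μhat n (point S p (s + i))) (b := fun i => S.Rhat n (point S p (s + i)))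
      (k := k) (hQ n) (fun i hi => ((hp i hi).2.1 n).1) (fun i hi => ((hp i hi).2.2.1 n).1)
      (fun i _ => rfl)
    have e1 := hcs fun i => S.μhat n (point S p (s + i))
    have e2 := hcs fun i => S.Rhat n (point S p (s + i))
    simp only [add_zero] at this
    rw [Finset.sum_add_distrib, mul_add]
    simp only [Network.dhat]
    linarith
  have h2 : ∀ l, (backlog S C p (s + k)).2.1 l ^ 2 ≤ (backlog S C p s).2.1 l ^ 2 -
      2 * ((backlog S C p s).2.1 l * ∑ i ∈ Finset.range k, (C.c l - C.h l (aux p (s + i)))) +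
      k * ∑ i ∈ Finset.range k, (C.h l (aux p (s + i)) - C.c l) ^ 2 := fun l => by
    have := sq_reflected_le (y := fun i => (backlog S C p (s + i)).2.1 l)
      (a := fun i => C.h l (aux p (s + i)) - C.c l) (k := k)
      (fun i _ => by rw [add_sub_left_comm, add_comm _ (_ - _)]; rfl) (hY l)
    have e1 := hcs fun i => |C.h l (aux p (s + i)) - C.c l|
    simp only [sq_abs] at e1
    have e2 : ∑ i ∈ Finset.range k, (C.h l (aux p (s + i)) - C.c l) =
        - ∑ i ∈ Finset.range k, (C.c l - C.h l (aux p (s + i))) := by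
      rw [← Finset.sum_neg_distrib]
      exact Finset.sum_congr rfl fun i _ => by ring
    simp only [add_zero, e2] at this
    linarith
  have h3 : ∀ m, (backlog S C p (s + k)).2.2 m ^ 2 ≤ (backlog S C p s).2.2 m ^ 2 -
      2 * ((backlog S C p s).2.2 m *
        ∑ i ∈ Finset.range k, (aux p (s + i) m - S.xhat m (point S p (s + i)))) +
      k * ∑ i ∈ Finset.range k, (aux p (s + i) m - S.xhat m (point S p (s + i))) ^ 2 := fun m => by
    have e1 := hcs fun i => aux p (s + i) m - S.xhat m (point S p (s + i))
    -- `W` is not reflected, so it is an exact telescoping sum and its square expands with equality.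
    have e2 : ∀ j, (backlog S C p (s + j)).2.2 m = (backlog S C p s).2.2 m -
        ∑ i ∈ Finset.range j, (aux p (s + i) m - S.xhat m (point S p (s + i))) := fun j => by
      induction j with
      | zero => simp
      | succ j ih =>
        rw [Finset.sum_range_succ]
        change (backlog S C p (s + j)).2.2 m - aux p (s + j) m +
          S.xhat m (point S p (s + j)) = _
        rw [ih]
        ring
    rw [e2 k]
    nlinarith
  have h4 : (k : ℝ) * ∑ i ∈ Finset.range k, slotCost S C (point S p (s + i)) (aux p (s + i)) ≤
      κ * (k : ℝ) ^ 2 := by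
    have : ∑ i ∈ Finset.range k, slotCost S C (point S p (s + i)) (aux p (s + i)) ≤ k * κ := by
      simpa using Finset.sum_le_sum (s := Finset.range k)
        (fun i hi => hκ i (Finset.mem_range.1 hi))
    nlinarith [mul_le_mul_of_nonneg_left this k.cast_nonneg]
  have h5 := Finset.sum_le_sum fun n (_ : n ∈ Finset.univ) => h1 n
  have h6 := Finset.sum_le_sum fun l (_ : l ∈ Finset.univ) => h2 l
  have h7 := Finset.sum_le_sum fun m (_ : m ∈ Finset.univ) => h3 m
  simp only [Finset.sum_add_distrib, Finset.sum_sub_distrib, ← Finset.mul_sum] at h5 h6 h7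
  have h8 : ∑ i ∈ Finset.range k, slotCost S C (point S p (s + i)) (aux p (s + i)) =
      ∑ n, ∑ i ∈ Finset.range k, S.μhat n (point S p (s + i)) ^ 2 +
      ∑ n, ∑ i ∈ Finset.range k, S.Rhat n (point S p (s + i)) ^ 2 +
      ∑ m, ∑ i ∈ Finset.range k, (aux p (s + i) m - S.xhat m (point S p (s + i))) ^ 2 +
      ∑ l, ∑ i ∈ Finset.range k, (C.h l (aux p (s + i)) - C.c l) ^ 2 := by
    simp only [slotCost, Finset.sum_add_distrib]
    rw [Finset.sum_comm, Finset.sum_comm (s := Finset.range k) (f := fun i n => S.Rhat n _ ^ 2),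
      Finset.sum_comm (s := Finset.range k) (f := fun i m => (aux p (s + i) m - _) ^ 2),
      Finset.sum_comm (s := Finset.range k) (f := fun i l => (C.h l _ - _) ^ 2)]
  rw [h8] at h4
  simp only [lyapunov, driftTerm, Finset.sum_sub_distrib] at h5 h6 h7 h4 ⊢
  linarith

theorem lyapunov_nonneg (θ : Backlog N M L) : 0 ≤ lyapunov θ := by
  unfold lyapunov
  positivity

theorem sq_le_two_mul_lyapunov (θ : Backlog N M L) :
    (∀ n, θ.1 n ^ 2 ≤ 2 * lyapunov θ) ∧ (∀ l, θ.2.1 l ^ 2 ≤ 2 * lyapunov θ) ∧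
      ∀ m, θ.2.2 m ^ 2 ≤ 2 * lyapunov θ := by
  have e1 : 0 ≤ ∑ n, θ.1 n ^ 2 := Finset.sum_nonneg fun _ _ => sq_nonneg _
  have e2 : 0 ≤ ∑ n, θ.2.1 n ^ 2 := Finset.sum_nonneg fun _ _ => sq_nonneg _
  have e3 : 0 ≤ ∑ n, θ.2.2 n ^ 2 := Finset.sum_nonneg fun _ _ => sq_nonneg _
  unfold lyapunov
  refine ⟨fun n => ?_, fun l => ?_, fun m => ?_⟩
  · have := Finset.single_le_sum (fun i _ => sq_nonneg (θ.1 i)) (Finset.mem_univ n)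
    linarith
  · have := Finset.single_le_sum (fun i _ => sq_nonneg (θ.2.1 i)) (Finset.mem_univ l)
    linarith
  · have := Finset.single_le_sum (fun i _ => sq_nonneg (θ.2.2 i)) (Finset.mem_univ m)
    linarith

end Backlog

section Renewals

variable {N M L W A Z : Type u} [MeasurableSpace W] [MeasurableSpace A] [MeasurableSpace Z]
  {R : RenewalRule N M L W A Z} {p : Path N M L W A Z} {t : ℕ}

/-! ### Renewal intervals -/

theorem frameLength_le {k : ℕ} (hk : 1 ≤ k) (h : RenewsAt R p (t + k)) :
    frameLength R t p ≤ k :=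
  iInf₂_le k ⟨hk, h⟩

/-- The right-hand side mentions renewals up to `t + k` only, so the event that the interval is
still running is known at time `t + k`. -/
theorem coe_lt_frameLength_iff {k : ℕ} :
    (k : ℕ∞) < frameLength R t p ↔ ∀ j, 1 ≤ j → j ≤ k → ¬ RenewsAt R p (t + j) := by
  constructor
  · intro h j h1 h2 h3
    exact absurd (h.trans_le (frameLength_le h1 h3)) (by simpa using h2)
  · intro h
    rw [← ENat.add_one_le_iff (ENat.natCast_ne_top k)]
    refine le_iInf₂ fun j hj => ?_
    have : k < j := by
      by_contra hlt
      exact h j hj.1 (not_lt.1 hlt) hj.2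
    exact_mod_cast this

theorem one_le_frameLength : 1 ≤ frameLength R t p :=
  le_iInf₂ fun j hj => by exact_mod_cast hj.1

/-- This separates what is known at time `t + k` from the renewal decided by the slot `t + k`, and
drives both measurability and the mean length of a type-2 interval. -/
theorem frameLength_eq_succ_iff {k : ℕ} :
    frameLength R t p = (k + 1 : ℕ) ↔ (k : ℕ∞) < frameLength R t p ∧ RenewsAt R p (t + (k + 1)) := by
  constructor
  · intro h
    have h1 : (k : ℕ∞) < frameLength R t p := by
      rw [h]
      exact_mod_cast k.lt_succ_self
    refine ⟨h1, ?_⟩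
    by_contra h2
    have h3 : ((k + 1 : ℕ) : ℕ∞) < frameLength R t p := by
      rw [coe_lt_frameLength_iff] at h1 ⊢
      intro j hj hjk
      rcases hjk.lt_or_eq with h4 | rfl
      · exact h1 j hj (Nat.lt_succ_iff.1 h4)
      · exact h2
    exact absurd h3 (by rw [h]; exact lt_irrefl _)
  · rintro ⟨h1, h2⟩
    refine le_antisymm (frameLength_le k.succ_pos h2) ?_
    have := (ENat.add_one_le_iff (ENat.natCast_ne_top k)).2 h1
    exact_mod_cast this

/-- The length of the renewal interval, as a natural number. -/
noncomputable def frameNat (R : RenewalRule N M L W A Z) (t : ℕ) (p : Path N M L W A Z) : ℕ :=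
  (frameLength R t p).toNat

/-- Finiteness matters: an interval that never ends has `frameNat` equal to `0`, and none of the
conclusions would be meaningful. -/
theorem frameNat_spec (h : frameLength R t p < ⊤) :
    (frameNat R t p : ℕ∞) = frameLength R t p ∧ 1 ≤ frameNat R t p ∧
      RenewsAt R p (t + frameNat R t p) ∧
      ∀ j, 1 ≤ j → j < frameNat R t p → ¬ RenewsAt R p (t + j) := by
  have h0 : (frameNat R t p : ℕ∞) = frameLength R t p := ENat.natCast_toNat h.ne
  have h1 : 1 ≤ frameNat R t p := by
    have := one_le_frameLength (R := R) (t := t) (p := p)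
    rw [← h0] at this
    exact_mod_cast this
  obtain ⟨k, hk⟩ := Nat.exists_eq_add_of_le' h1
  rw [hk] at h0 ⊢
  obtain ⟨h2, h3⟩ := frameLength_eq_succ_iff.1 h0.symm
  exact ⟨h0, k.succ_pos, h3, fun j hj hjk =>
    coe_lt_frameLength_iff.1 h2 j hj (Nat.lt_succ_iff.1 hjk)⟩

theorem measurableSet_renewsAt (hR : ∀ t, MeasurableSet (R t)) {s t : ℕ} (hst : s ≤ t) :
    MeasurableSet[pastSigma N M L W A Z t] {p | RenewsAt R p s} :=
  pastSigma_mono hst _ ⟨R s, hR s, rfl⟩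

theorem measurableSet_coe_lt_frameLength (hR : ∀ t, MeasurableSet (R t)) (t k : ℕ) :
    MeasurableSet[pastSigma N M L W A Z (t + k)] {p | (k : ℕ∞) < frameLength R t p} := by
  simp only [coe_lt_frameLength_iff, Set.ofPred_forall]
  exact MeasurableSet.iInter fun j => MeasurableSet.iInter fun _ => MeasurableSet.iInter fun hj =>
    (measurableSet_renewsAt hR (Nat.add_le_add_left hj t)).compl

theorem measurableSet_frameLength_eq (hR : ∀ t, MeasurableSet (R t)) (t k : ℕ) :
    MeasurableSet[pastSigma N M L W A Z (t + k)] {p | frameLength R t p = k} := by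
  cases k with
  | zero =>
    have : {p | frameLength R t p = (0 : ℕ)} = ∅ := by
      ext p
      have := one_le_frameLength (R := R) (t := t) (p := p)
      simp only [Set.mem_ofPred_eq, Set.mem_empty_iff_false, iff_false]
      intro h
      rw [h] at this
      simp at this
    rw [this]
    exact @MeasurableSet.empty _ (pastSigma N M L W A Z _)
  | succ k =>
    simp only [frameLength_eq_succ_iff]
    exact (pastSigma_mono (by lia) _ (measurableSet_coe_lt_frameLength hR t k)).inter
      (measurableSet_renewsAt hR le_rfl)

theorem measurable_frameLength (hR : ∀ t, MeasurableSet (R t)) (t : ℕ) :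
    Measurable (frameLength R t) :=
  ENat.measurable_iff.2 fun k => pastSigma_le _ _ (measurableSet_frameLength_eq hR t k)

theorem measurable_frameNat (hR : ∀ t, MeasurableSet (R t)) (t : ℕ) :
    Measurable (frameNat R t) :=
  (measurable_of_countable ENat.toNat).comp (measurable_frameLength hR t)

theorem measurable_coe_frameLength (hR : ∀ t, MeasurableSet (R t)) (t : ℕ) :
    Measurable fun p => (frameLength R t p : ℝ≥0∞) :=
  (measurable_of_countable ENat.toENNReal).comp (measurable_frameLength hR t)

theorem coe_frameNat (h : frameLength R t p < ⊤) :
    (frameNat R t p : ℝ≥0∞) = (frameLength R t p : ℝ≥0∞) := by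
  rw [← (frameNat_spec h).1, ENat.toENNReal_coe]

open Classical in
/-- The first renewal time which is not smaller than `t`. -/
noncomputable def nextRenewal (R : RenewalRule N M L W A Z) (p : Path N M L W A Z) : ℕ → ℕ
  | 0 => 0
  | t + 1 => if RenewsAt R p t then t + frameNat R t p else nextRenewal R p t

theorem nextRenewal_succ_of_renewsAt (h : RenewsAt R p t) :
    nextRenewal R p (t + 1) = t + frameNat R t p :=
  if_pos h

theorem nextRenewal_succ_of_not (h : ¬ RenewsAt R p t) :
    nextRenewal R p (t + 1) = nextRenewal R p t :=
  if_neg h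

theorem nextRenewal_spec (h0 : RenewsAt R p 0)
    (hp : ∀ s, RenewsAt R p s → frameLength R s p < ⊤) (t : ℕ) :
    t ≤ nextRenewal R p t ∧ RenewsAt R p (nextRenewal R p t) ∧
      ∀ j, t ≤ j → j < nextRenewal R p t → ¬ RenewsAt R p j := by
  induction t with
  | zero => exact ⟨le_rfl, h0, fun j _ hj => absurd hj (Nat.not_lt_zero j)⟩
  | succ t ih =>
    by_cases h : RenewsAt R p t
    · obtain ⟨-, h2, h3, h4⟩ := frameNat_spec (hp t h)
      rw [nextRenewal_succ_of_renewsAt h]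
      refine ⟨by lia, h3, fun j hj hjk => ?_⟩
      obtain ⟨i, rfl⟩ := Nat.exists_eq_add_of_le (show t ≤ j by lia)
      exact h4 i (by lia) (by lia)
    · obtain ⟨h1, h2, h3⟩ := ih
      rw [nextRenewal_succ_of_not h]
      refine ⟨Nat.succ_le_of_lt (lt_of_le_of_ne h1 fun h4 => h (h4 ▸ h2)), h2, fun j hj => ?_⟩
      exact h3 j (by lia)

theorem nextRenewal_of_renewsAt (h0 : RenewsAt R p 0)
    (hp : ∀ s, RenewsAt R p s → frameLength R s p < ⊤) (h : RenewsAt R p t) :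
    nextRenewal R p t = t := by
  obtain ⟨h1, -, h3⟩ := nextRenewal_spec h0 hp t
  by_contra h2
  exact h3 t le_rfl (by lia) h

theorem measurable_nextRenewal (hR : ∀ t, MeasurableSet (R t)) (t : ℕ) :
    Measurable fun p => nextRenewal R p t := by
  classical
  induction t with
  | zero => exact measurable_const
  | succ t ih =>
    exact Measurable.ite (pastSigma_le t _ (measurableSet_renewsAt hR le_rfl))
      (measurable_const.add (measurable_frameNat hR t)) ih

/-- A process observed at a random integer time: since `ℕ` is countable, measurability for each
fixed time suffices for joint measurability. -/
theorem measurable_comp_nat {α β : Type*} [MeasurableSpace α] [MeasurableSpace β] {ν : α → ℕ}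
    (hν : Measurable ν) {g : ℕ → α → β} (hg : ∀ s, Measurable (g s)) :
    Measurable fun x => g (ν x) x :=
  (measurable_from_prod_countable_right (f := fun y : ℕ × α => g y.1 y.2) hg).comp
    (hν.prodMk measurable_id)

/-! ### Moments of the renewal intervals -/

variable [Fintype M] {S : Network N M W A Z} {C : Program S L} {π : Policy S C}

theorem IsRenewalDefinition.ae_frameLength_lt_top (hR : IsRenewalDefinition S C R)
    (π : Policy S C) {t : ℕ} {h : Hist N M L W A Z t} (hh : h ∈ R t) :
    ∀ᵐ p ∂π.lawFrom t h, frameLength R t p < ⊤ := by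
  obtain ⟨m₁, m₂, hm⟩ := hR.moments
  have h1 := ae_lt_top (measurable_coe_frameLength hR.meas t)
    (((hm π t h hh).1.trans_lt ENNReal.coe_lt_top).ne)
  filter_upwards [h1] with p hp
  exact lt_top_iff_ne_top.2 fun h2 => by simp [h2] at hp

theorem IsRenewalDefinition.renewsAt_zero (hR : IsRenewalDefinition S C R)
    (p : Path N M L W A Z) : RenewsAt R p 0 := by
  rw [RenewsAt, hR.start]
  exact Set.mem_univ _

/-- The bounded conditional mean makes an infinite interval a null event given any past at which a
renewal occurs; integrating over the past and using countably many times gives a single exceptional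
set. -/
theorem IsRenewalDefinition.ae_frameLength_lt_top_of_follows (hR : IsRenewalDefinition S C R)
    {s : ℕ} {μ : Measure (Path N M L W A Z)} (hμ : Follows π s μ) :
    ∀ᵐ p ∂μ, ∀ t, s ≤ t → RenewsAt R p t → frameLength R t p < ⊤ := by
  refine ae_all_iff.2 fun t => ?_
  by_cases hst : s ≤ t
  swap
  · exact ae_of_all _ fun p h => absurd h hst
  have hE := measurableSet_renewsAt hR.meas (R := R) (le_refl t)
  have hF : MeasurableSet {p | frameLength R t p = ⊤} :=
    measurable_frameLength hR.meas t (measurableSet_singleton ⊤)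
  have h1 := hμ.setLIntegral hst hE
    (measurable_const.indicator hF : Measurable ({p | frameLength R t p = ⊤}.indicator
      fun _ => (1 : ℝ≥0∞)))
  have h2 : ∫⁻ p in {p | RenewsAt R p t}, ∫⁻ q,
      {p | frameLength R t p = ⊤}.indicator (fun _ => (1 : ℝ≥0∞)) q ∂π.lawFrom t (past t p) ∂μ
      = 0 := by
    refine (setLIntegral_congr_fun (g := fun _ => 0) (pastSigma_le _ _ hE) fun p hp => ?_).trans
      lintegral_zero
    have h3 := hR.ae_frameLength_lt_top π (h := past t p) hp
    refine (lintegral_indicator_const hF 1).trans ?_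
    rw [one_mul]
    refine measure_mono_null (fun q hq => ?_) (ae_iff.1 h3)
    exact not_lt.2 (le_of_eq hq.symm)
  rw [h2, lintegral_indicator_const hF, one_mul, Measure.restrict_apply hF] at h1
  have h4 : ∀ᵐ p ∂μ, ¬ (frameLength R t p = ⊤ ∧ RenewsAt R p t) := by
    rw [ae_iff]
    simp only [not_not]
    exact h1
  filter_upwards [h4] with p hp _ hpt
  exact lt_top_iff_ne_top.2 fun h5 => hp ⟨h5, hpt⟩

section Moments

variable {h : Hist N M L W A Z t}

theorem IsRenewalDefinition.lintegral_frameNat (hR : IsRenewalDefinition S C R)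
    (π : Policy S C) (hh : h ∈ R t) (j : ℕ) :
    ∫⁻ p, (frameNat R t p : ℝ≥0∞) ^ j ∂π.lawFrom t h =
      ∫⁻ p, (frameLength R t p : ℝ≥0∞) ^ j ∂π.lawFrom t h := by
  refine lintegral_congr_ae ?_
  filter_upwards [hR.ae_frameLength_lt_top π hh] with p hp
  rw [coe_frameNat hp]

theorem IsRenewalDefinition.measurable_frameNat_real (hR : IsRenewalDefinition S C R) (t : ℕ) :
    Measurable fun p => (frameNat R t p : ℝ) :=
  measurable_from_nat.comp (measurable_frameNat hR.meas t)

theorem IsRenewalDefinition.integrable_frameNat_sq (hR : IsRenewalDefinition S C R)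
    (π : Policy S C) (hh : h ∈ R t) :
    Integrable (fun p => (frameNat R t p : ℝ) ^ 2) (π.lawFrom t h) := by
  obtain ⟨m₁, m₂, hm⟩ := hR.moments
  refine ⟨((hR.measurable_frameNat_real t).pow_const 2).aestronglyMeasurable, ?_⟩
  have h1 := hR.lintegral_frameNat π hh 2
  have h2 : ∫⁻ p, ‖(frameNat R t p : ℝ) ^ 2‖ₑ ∂π.lawFrom t h =
      ∫⁻ p, (frameNat R t p : ℝ≥0∞) ^ 2 ∂π.lawFrom t h := by
    refine lintegral_congr fun p => ?_
    rw [Real.enorm_of_nonneg (by positivity), ENNReal.ofReal_pow (by positivity),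
      ENNReal.ofReal_natCast]
  rw [HasFiniteIntegral, h2, h1]
  exact (hm π t h hh).2.trans_lt ENNReal.coe_lt_top

theorem IsRenewalDefinition.integral_frameNat_sq (hR : IsRenewalDefinition S C R)
    (π : Policy S C) (hh : h ∈ R t) :
    ∫ p, (frameNat R t p : ℝ) ^ 2 ∂π.lawFrom t h =
      (∫⁻ p, (frameLength R t p : ℝ≥0∞) ^ 2 ∂π.lawFrom t h).toReal := by
  rw [← hR.lintegral_frameNat π hh 2, integral_eq_lintegral_of_nonneg_ae
    (ae_of_all _ fun p => by positivity) (hR.integrable_frameNat_sq π hh).1]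
  congr 1
  refine lintegral_congr fun p => ?_
  rw [ENNReal.ofReal_pow (by positivity), ENNReal.ofReal_natCast]

theorem IsRenewalDefinition.integrable_frameNat (hR : IsRenewalDefinition S C R)
    (π : Policy S C) (hh : h ∈ R t) :
    Integrable (fun p => (frameNat R t p : ℝ)) (π.lawFrom t h) := by
  refine (hR.integrable_frameNat_sq π hh).mono'
    (hR.measurable_frameNat_real t).aestronglyMeasurable (ae_of_all _ fun p => ?_)
  rw [Real.norm_of_nonneg (by positivity)]
  exact_mod_cast Nat.le_self_pow two_ne_zero _

theorem IsRenewalDefinition.integral_frameNat (hR : IsRenewalDefinition S C R)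
    (π : Policy S C) (hh : h ∈ R t) :
    ∫ p, (frameNat R t p : ℝ) ∂π.lawFrom t h =
      (∫⁻ p, (frameLength R t p : ℝ≥0∞) ∂π.lawFrom t h).toReal := by
  have h1 := hR.lintegral_frameNat π hh 1
  simp only [pow_one] at h1
  rw [← h1, integral_eq_lintegral_of_nonneg_ae
    (ae_of_all _ fun p => by positivity) (hR.integrable_frameNat π hh).1]
  simp only [ENNReal.ofReal_natCast]

theorem IsRenewalDefinition.one_le_integral_frameNat (hR : IsRenewalDefinition S C R)
    (π : Policy S C) (hh : h ∈ R t) : 1 ≤ ∫ p, (frameNat R t p : ℝ) ∂π.lawFrom t h := by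
  have h1 : ∫ p, (1 : ℝ) ∂π.lawFrom t h ≤ ∫ p, (frameNat R t p : ℝ) ∂π.lawFrom t h := by
    refine integral_mono_ae (integrable_const 1) (hR.integrable_frameNat π hh) ?_
    filter_upwards [hR.ae_frameLength_lt_top π hh] with p hp
    exact_mod_cast (frameNat_spec hp).2.1
  simpa using h1

end Moments

/-! ### Forced renewals -/

variable [Countable Z] [DiscreteMeasurableSpace Z]

/-- Forgetting the next state and then the decision leaves the first marginal `S.lawΩ` of the slot
record, which depends neither on the history nor on the policy. -/
theorem lawFrom_outcome_true (π : Policy S C) (t : ℕ) (h : Hist N M L W A Z t) :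
    π.lawFrom t h {p | (outcome p t).2 = true} = ENNReal.ofReal S.φ := by
  have := π.act_markov t
  have := S.lawω_prob
  have hm2 : MeasurableSet {Ω : W × Bool | Ω.2 = true} :=
    measurable_snd (measurableSet_singleton true)
  have h1 : S.lawΩ {Ω | Ω.2 = true} = ENNReal.ofReal S.φ := by
    have : {Ω : W × Bool | Ω.2 = true} = Set.univ ×ˢ {true} := by
      ext Ω
      simp
    rw [this, Network.lawΩ, Measure.prod_prod, measure_univ, one_mul,
      bernoulliMeasure_apply_of_mem_of_notMem _ (measurableSet_singleton true) rfl (by simp)]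
    rw [ENNReal.ofReal, ENNReal.coe_inj]
    ext
    rw [Real.coe_toNNReal _ S.φ.2.1]
    rfl
  have h2 : ((Kernel.const (Hist N M L W A Z t) S.lawΩ) ⊗ₖ π.act t) h {b | b.1.2 = true} =
      ENNReal.ofReal S.φ := by
    have := Kernel.fst_apply' ((Kernel.const (Hist N M L W A Z t) S.lawΩ) ⊗ₖ π.act t) h hm2
    rw [Kernel.fst_compProd, Kernel.const_apply, h1] at this
    exact this.symm
  have h3 : π.step t h {x | (slotRec x).1.1.2 = true} = ENNReal.ofReal S.φ := by
    have h4 := Kernel.fst_apply' (π.step t : Kernel (Hist N M L W A Z t) (Slot M W A Z)) h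
      (measurable_fst hm2 : MeasurableSet {b : (W × Bool) × A × (M → ℝ) | b.1.2 = true})
    refine h4.symm.trans ?_
    refine Eq.trans ?_ h2
    exact congrArg (fun k : Kernel (Hist N M L W A Z t) _ => k h {b : (W × Bool) × A × (M → ℝ) | b.1.2 = true})
      (Kernel.fst_compProd _ _)
  rw [← h3, ← map_lawFrom_succ, Measure.map_apply (measurable_pi_apply (t + 1))]
  · rfl
  · exact (measurable_fst.comp (measurable_fst.comp (measurable_slotRec t))) hm2

/-- A forced renewal event sends the state to `0` almost surely, so the state requirement in
`typeTwoRenewals` is redundant. -/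
theorem Follows.ae_renewsAt_typeTwo {s : ℕ} {μ : Measure (Path N M L W A Z)}
    (hμ : Follows π s μ) :
    ∀ᵐ p ∂μ, ∀ τ, s ≤ τ → (RenewsAt (typeTwoRenewals S) p (τ + 1) ↔ (outcome p τ).2 = true) := by
  filter_upwards [hμ.ae_forced] with p hp τ hτ
  exact ⟨fun h => h.2, fun h => ⟨hp τ hτ h, h⟩⟩

/-- A renewal at `τ + 1` is decided by `φ(τ)`, which is independent of everything known at `τ`, in
particular of `g`. -/
theorem Follows.setLIntegral_typeTwo {s : ℕ} {μ : Measure (Path N M L W A Z)}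
    (hμ : Follows π s μ) {τ : ℕ} (hτ : s ≤ τ) {g : Path N M L W A Z → ℝ≥0∞}
    (hg : Measurable[pastSigma N M L W A Z τ] g) :
    ∫⁻ p in {p | RenewsAt (typeTwoRenewals S) p (τ + 1)}, g p ∂μ =
      ENNReal.ofReal S.φ * ∫⁻ p, g p ∂μ := by
  have hO : MeasurableSet {p : Path N M L W A Z | (outcome p τ).2 = true} :=
    (measurable_snd.comp ((measurable_outcome τ.lt_succ_self).mono (pastSigma_le _) le_rfl))
      (measurableSet_singleton true)
  have hg' : Measurable g := hg.mono (pastSigma_le _) le_rfl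
  have h1 : ∫⁻ p in {p | RenewsAt (typeTwoRenewals S) p (τ + 1)}, g p ∂μ =
      ∫⁻ p in {p | (outcome p τ).2 = true}, g p ∂μ := by
    refine setLIntegral_congr ?_
    filter_upwards [hμ.ae_renewsAt_typeTwo] with p hp using propext (hp τ hτ)
  rw [h1, ← lintegral_indicator hO, hμ.lintegral hτ (hg'.indicator hO), ← lintegral_const_mul _ hg']
  refine lintegral_congr fun p => ?_
  have h2 : ∫⁻ q, {p | (outcome p τ).2 = true}.indicator g q ∂π.lawFrom τ (past τ p) =
      ∫⁻ q, {p | (outcome p τ).2 = true}.indicator (fun _ => g p) q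
        ∂π.lawFrom τ (past τ p) := by
    refine lintegral_congr_ae ?_
    filter_upwards [ae_eq_lawFrom π τ hg p] with q hq
    by_cases h3 : q ∈ {p | (outcome p τ).2 = true}
    · rw [Set.indicator_of_mem h3, Set.indicator_of_mem h3, hq]
    · rw [Set.indicator_of_notMem h3, Set.indicator_of_notMem h3]
  rw [h2, lintegral_indicator_const hO, lawFrom_outcome_true, mul_comm]

/-- The mean is the sum over `k` of `P(T > k)`. Since the event `T > k` is known at `t + k`,
independence of the next forced event gives `φ P(T > k) = P(T = k + 1)`, and these probabilities add
up to `1` because `T` is almost surely finite. -/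
theorem lintegral_frameLength_typeTwo (hR : IsRenewalDefinition S C (typeTwoRenewals S))
    (π : Policy S C) {t : ℕ} {h : Hist N M L W A Z t} (hh : h ∈ typeTwoRenewals S t) :
    ENNReal.ofReal S.φ * ∫⁻ p, (frameLength (typeTwoRenewals S) t p : ℝ≥0∞) ∂π.lawFrom t h = 1 := by
  have hfin := hR.ae_frameLength_lt_top π hh
  have hm (k : ℕ) := measurableSet_coe_lt_frameLength hR.meas t k
  have h1 : ∫⁻ p, (frameLength (typeTwoRenewals S) t p : ℝ≥0∞) ∂π.lawFrom t h =
      ∑' k : ℕ, π.lawFrom t h {p | (k : ℕ∞) < frameLength (typeTwoRenewals S) t p} := by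
    have h2 : ∀ k : ℕ, π.lawFrom t h {p | (k : ℕ∞) < frameLength (typeTwoRenewals S) t p} =
        ∫⁻ p, {p | (k : ℕ∞) < frameLength (typeTwoRenewals S) t p}.indicator
          (fun _ => (1 : ℝ≥0∞)) p ∂π.lawFrom t h := fun k => by
      rw [lintegral_indicator_const (pastSigma_le _ _ (hm k)), one_mul]
    simp only [h2]
    rw [← lintegral_tsum fun k =>
      (measurable_const.indicator (pastSigma_le _ _ (hm k))).aemeasurable]
    refine lintegral_congr_ae ?_
    filter_upwards [hfin] with p hp
    have h3 := (frameNat_spec hp).1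
    rw [tsum_eq_sum (s := Finset.range (frameNat (typeTwoRenewals S) t p))]
    · rw [Finset.sum_congr rfl (g := fun _ => 1)]
      · simp [coe_frameNat hp]
      · intro k hk
        refine Set.indicator_of_mem ?_ _
        rw [Set.mem_ofPred_eq, ← h3]
        exact_mod_cast Finset.mem_range.1 hk
    · intro k hk
      refine Set.indicator_of_notMem ?_ _
      rw [Set.mem_ofPred_eq, ← h3]
      exact_mod_cast fun h4 => hk (Finset.mem_range.2 h4)
  have h4 : ∀ k : ℕ, ENNReal.ofReal S.φ *
      π.lawFrom t h {p | (k : ℕ∞) < frameLength (typeTwoRenewals S) t p} =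
      π.lawFrom t h {p | frameLength (typeTwoRenewals S) t p = (k + 1 : ℕ)} := fun k => by
    have h5 := (follows_lawFrom π t h).setLIntegral_typeTwo (Nat.le_add_right t k)
      ((measurable_const (a := (1 : ℝ≥0∞))).indicator (hm k))
    rw [lintegral_indicator_const (pastSigma_le _ _ (hm k)),
      lintegral_indicator_const (pastSigma_le _ _ (hm k)), one_mul, one_mul,
      Measure.restrict_apply (pastSigma_le _ _ (hm k))] at h5
    rw [← h5]
    congr 1
    ext p
    exact frameLength_eq_succ_iff.symm
  rw [h1, ← ENNReal.tsum_mul_left]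
  simp only [h4]
  -- The events `T = k + 1` are disjoint and cover almost every trajectory, so the sum is the total
  -- mass.
  rw [← measure_iUnion]
  · have h6 : ∀ᵐ p ∂π.lawFrom t h,
        p ∈ ⋃ k : ℕ, {p | frameLength (typeTwoRenewals S) t p = (k + 1 : ℕ)} := by
      filter_upwards [hfin] with p hp
      obtain ⟨h7, h8, -⟩ := frameNat_spec hp
      obtain ⟨k, hk⟩ := Nat.exists_eq_add_of_le' h8
      exact Set.mem_iUnion.2 ⟨k, by rw [Set.mem_ofPred_eq, ← hk, h7]⟩
    exact (measure_congr (eventuallyEq_univ.2 h6)).trans measure_univ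
  · intro i j hij
    refine Set.disjoint_left.2 fun p hp hp' => hij ?_
    have := hp.symm.trans hp'
    exact Nat.succ_injective (by exact_mod_cast this)
  · exact fun k => pastSigma_le _ _ (measurableSet_frameLength_eq hR.meas t _)

end Renewals

section Drift

variable {N M L W A Z : Type u} [MeasurableSpace W] [MeasurableSpace A] [MeasurableSpace Z]
  [Countable Z] [DiscreteMeasurableSpace Z] [Fintype M]
  {S : Network N M W A Z} {C : Program S L} {R : RenewalRule N M L W A Z} {t : ℕ}

/-! ### Sums over a renewal interval -/

/-- A sum of terms bounded by `b` over the interval is dominated by `b T`, and `T` has finite mean.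
-/
theorem IsRenewalDefinition.integrable_frame_sum (hR : IsRenewalDefinition S C R)
    (π : Policy S C) {h : Hist N M L W A Z t} (hh : h ∈ R t) {g : ℕ → Path N M L W A Z → ℝ}
    (hg : ∀ τ, Measurable (g τ)) {b : ℝ}
    (hb : ∀ᵐ p ∂π.lawFrom t h, ∀ τ, t ≤ τ → |g τ p| ≤ b) :
    Integrable (fun p => ∑ i ∈ Finset.range (frameNat R t p), g (t + i) p) (π.lawFrom t h) := by
  refine ((hR.integrable_frameNat π hh).mul_const b).mono'
    (measurable_comp_nat (measurable_frameNat hR.meas t)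
      (g := fun k p => ∑ i ∈ Finset.range k, g (t + i) p)
      fun k => Finset.measurable_fun_sum _ fun i _ => hg _).aestronglyMeasurable ?_
  filter_upwards [hb] with p hp
  rw [Real.norm_eq_abs]
  refine (Finset.abs_sum_le_sum_abs _ _).trans ?_
  simpa using Finset.sum_le_sum (s := Finset.range (frameNat R t p))
    fun i _ => hp (t + i) (Nat.le_add_right t i)

theorem integral_neg_sub_sub_add {α : Type*} [MeasurableSpace α] {μ : Measure α}
    {a b c d : α → ℝ} (ha : Integrable a μ) (hb : Integrable b μ) (hc : Integrable c μ)
    (hd : Integrable d μ) : ∫ x, (-a x - b x - c x + d x) ∂μ =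
      -∫ x, a x ∂μ - ∫ x, b x ∂μ - ∫ x, c x ∂μ + ∫ x, d x ∂μ := by
  have h1 : Integrable (fun x => -a x) μ := ha.neg
  have h2 : Integrable (fun x => -a x - b x) μ := h1.sub hb
  have h3 : Integrable (fun x => -a x - b x - c x) μ := h2.sub hc
  rw [integral_add h3 hd, integral_sub h2 hc, integral_sub h1 hb, integral_neg]

theorem exists_abs_le_of_mem_Icc (a b : ℝ) : ∃ c, ∀ x, a ≤ x → x ≤ b → |x| ≤ c :=
  ⟨max |a| |b|, fun _ h1 h2 => abs_le_max_abs_abs h1 h2⟩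

theorem IsRenewalDefinition.integrable_frame_xhat [Finite N] (hR : IsRenewalDefinition S C R)
    (π : Policy S C) {h : Hist N M L W A Z t} (hh : h ∈ R t) (m : M) :
    Integrable (fun p => ∑ i ∈ Finset.range (frameNat R t p), S.xhat m (point S p (t + i)))
      (π.lawFrom t h) := by
  obtain ⟨b, hb⟩ := exists_abs_le_of_mem_Icc (S.xmin m) (S.xmax m)
  refine hR.integrable_frame_sum π hh (g := fun τ p => S.xhat m (point S p τ)) (b := b)
    (fun τ => (S.xhat_meas m).comp ((measurable_point S τ.lt_succ_self).mono
      (pastSigma_le _) le_rfl)) ?_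
  filter_upwards [(follows_lawFrom π t h).ae_admissible] with p hp τ hτ
  exact hb _ ((hp τ hτ).2.2.2 m).1 ((hp τ hτ).2.2.2 m).2

theorem IsRenewalDefinition.integrable_frame_aux [Finite N] (hR : IsRenewalDefinition S C R)
    (π : Policy S C) {h : Hist N M L W A Z t} (hh : h ∈ R t) (m : M) :
    Integrable (fun p => ∑ i ∈ Finset.range (frameNat R t p), aux p (t + i) m)
      (π.lawFrom t h) := by
  obtain ⟨b, hb⟩ := exists_abs_le_of_mem_Icc (S.xmin m - C.α) (S.xmax m + C.α)
  refine hR.integrable_frame_sum π hh (g := fun τ p => aux p τ m) (b := b)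
    (fun τ => (measurable_pi_apply m).comp ((measurable_aux τ.lt_succ_self).mono
      (pastSigma_le _) le_rfl)) ?_
  filter_upwards [(follows_lawFrom π t h).ae_admissible] with p hp τ hτ
  exact hb _ ((hp τ hτ).1 m).1 ((hp τ hτ).1 m).2

theorem IsRenewalDefinition.integrable_frame_dhat [Finite N] (hR : IsRenewalDefinition S C R)
    (π : Policy S C) {h : Hist N M L W A Z t} (hh : h ∈ R t) (n : N) :
    Integrable (fun p => ∑ i ∈ Finset.range (frameNat R t p), S.dhat n (point S p (t + i)))
      (π.lawFrom t h) := by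
  obtain ⟨b, hb⟩ := exists_abs_le_of_mem_Icc (-S.Rmax n) (S.μmax n)
  refine hR.integrable_frame_sum π hh (g := fun τ p => S.dhat n (point S p τ)) (b := b)
    (fun τ => ((S.μhat_meas n).sub (S.Rhat_meas n)).comp
      ((measurable_point S τ.lt_succ_self).mono (pastSigma_le _) le_rfl)) ?_
  filter_upwards [(follows_lawFrom π t h).ae_admissible] with p hp τ hτ
  have h1 := (hp τ hτ).2.1 n
  have h2 := (hp τ hτ).2.2.1 n
  exact hb _ (by simp only [Network.dhat]; linarith) (by simp only [Network.dhat]; linarith)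

theorem IsRenewalDefinition.integrable_frame_h [Finite N] (hR : IsRenewalDefinition S C R)
    (π : Policy S C) {h : Hist N M L W A Z t} (hh : h ∈ R t) (l : L) :
    Integrable (fun p => ∑ i ∈ Finset.range (frameNat R t p),
      (C.c l - C.reg.h l (aux p (t + i)))) (π.lawFrom t h) := by
  obtain ⟨b, hb⟩ := C.exists_bound_h l
  refine hR.integrable_frame_sum π hh (g := fun τ p => C.c l - C.reg.h l (aux p τ))
    (b := |C.c l| + b) (fun τ => measurable_const.sub ((C.measurable_reg_h l).comp
      ((measurable_aux τ.lt_succ_self).mono (pastSigma_le _) le_rfl))) ?_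
  filter_upwards [(follows_lawFrom π t h).ae_admissible] with p hp τ hτ
  rw [C.reg_h l (hp τ hτ).1]
  exact (abs_sub _ _).trans (add_le_add le_rfl (hb _ (hp τ hτ).1))

theorem IsRenewalDefinition.integrable_frame_f [Finite N] (hR : IsRenewalDefinition S C R)
    (π : Policy S C) {h : Hist N M L W A Z t} (hh : h ∈ R t) :
    Integrable (fun p => ∑ i ∈ Finset.range (frameNat R t p), C.reg.f (aux p (t + i)))
      (π.lawFrom t h) := by
  obtain ⟨b, hb⟩ := exists_abs_le_of_mem_Icc C.fmin C.fmax
  refine hR.integrable_frame_sum π hh (g := fun τ p => C.reg.f (aux p τ))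
    (b := b) (fun τ => C.measurable_reg_f.comp
      ((measurable_aux τ.lt_succ_self).mono (pastSigma_le _) le_rfl)) ?_
  filter_upwards [(follows_lawFrom π t h).ae_admissible] with p hp τ hτ
  rw [C.reg_f (hp τ hτ).1]
  exact hb _ (C.f_bd _ (hp τ hτ).1).1 (C.f_bd _ (hp τ hτ).1).2

/-! ### Attained vectors -/

theorem StatPolicy.ae_aux_toPolicy (σ : StatPolicy S) (γ₀ : S.box C.α)
    (h : Hist N M L W A Z t) :
    ∀ᵐ p ∂(σ.toPolicy C γ₀).lawFrom t h, ∀ τ, t ≤ τ → aux p τ = γ₀ := by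
  refine (follows_lawFrom (σ.toPolicy C γ₀) t h).ae_decision (P := fun x => x.2 = (γ₀ : M → ℝ))
    (measurable_snd (measurableSet_singleton (γ₀ : M → ℝ))) fun τ _ h' Ω => ?_
  have := σ.act_markov
  change ∀ᵐ d ∂((σ.act.comap _ _) ×ₖ Kernel.const _ (Measure.dirac (γ₀ : M → ℝ))) (h', Ω), _
  rw [Kernel.prod_apply, Kernel.comap_apply, Kernel.const_apply]
  refine (measurePreserving_snd (μ := σ.act (histState S τ h', Ω))
    (ν := Measure.dirac (γ₀ : M → ℝ))).quasiMeasurePreserving.ae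
    (p := fun γ => γ = (γ₀ : M → ℝ)) ?_
  exact (ae_dirac_iff (p := fun γ => γ = (γ₀ : M → ℝ)) (measurableSet_singleton _)).2 rfl

/-- `Attains` quantifies over constant auxiliary vectors in the box, so its averaging requirement
would be vacuous for an empty box. The existence of a policy excludes this, since its choices lie in
the box almost surely. -/
theorem Policy.box_nonempty [Finite N] (π : Policy S C) : (S.box C.α).Nonempty := by
  have h : Hist N M L W A Z 0 := fun i => match i with
    | ⟨0, _⟩ => ((fun _ => 0, fun _ => 0, fun _ => 0) : Backlog N M L)
    | ⟨k + 1, hk⟩ => absurd (Finset.mem_Iic.1 hk) (by simp)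
  obtain ⟨p, hp⟩ := ((follows_lawFrom π 0 h).ae_admissible).exists
  exact ⟨_, (hp 0 le_rfl).1⟩

/-- An attained vector is a ratio of an expected interval sum to the expected length, hence lies
between `xmin` and `xmax`; `α ≥ 0` then puts it in the box. This is what allows γ itself to serve as
the constant auxiliary vector of the competitor. -/
theorem Attains.mem_box [Finite N] (hR : IsRenewalDefinition S C R) (π : Policy S C) {ε : ℝ}
    {γ : M → ℝ} (hγ : Attains C R ε γ) : γ ∈ S.box C.α := by
  obtain ⟨⟨σ, hσ⟩, -⟩ := hγ
  obtain ⟨γ₀, hγ₀⟩ := π.box_nonempty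
  have h : Hist N M L W A Z 0 := fun i => match i with
    | ⟨0, _⟩ => ((fun _ => 0, fun _ => 0, fun _ => 0) : Backlog N M L)
    | ⟨k + 1, hk⟩ => absurd (Finset.mem_Iic.1 hk) (by simp)
  have hh : h ∈ R 0 := by
    rw [hR.start]
    exact Set.mem_univ _
  intro m
  have h1 := (hσ ⟨γ₀, hγ₀⟩ 0 h hh).1 m
  rw [← hR.integral_frameNat _ hh] at h1
  have h2 := hR.one_le_integral_frameNat (σ.toPolicy C ⟨γ₀, hγ₀⟩) hh
  have h3 := hR.integrable_frameNat (σ.toPolicy C ⟨γ₀, hγ₀⟩) hh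
  have h4 := hR.integrable_frame_xhat (σ.toPolicy C ⟨γ₀, hγ₀⟩) hh m
  have h5 := (follows_lawFrom (σ.toPolicy C ⟨γ₀, hγ₀⟩) 0 h).ae_admissible
  have h6 : S.xmin m * ∫ p, (frameNat R 0 p : ℝ) ∂(σ.toPolicy C ⟨γ₀, hγ₀⟩).lawFrom 0 h ≤
      ∫ p, ∑ i ∈ Finset.range (frameNat R 0 p), S.xhat m (point S p (0 + i))
        ∂(σ.toPolicy C ⟨γ₀, hγ₀⟩).lawFrom 0 h := by
    rw [← integral_const_mul]
    refine integral_mono_ae (h3.const_mul _) h4 ?_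
    filter_upwards [h5] with p hp
    simpa [mul_comm] using Finset.sum_le_sum (s := Finset.range (frameNat R 0 p))
      fun i _ => ((hp (0 + i) (Nat.zero_le _)).2.2.2 m).1
  have h7 : ∫ p, ∑ i ∈ Finset.range (frameNat R 0 p), S.xhat m (point S p (0 + i))
        ∂(σ.toPolicy C ⟨γ₀, hγ₀⟩).lawFrom 0 h ≤
      S.xmax m * ∫ p, (frameNat R 0 p : ℝ) ∂(σ.toPolicy C ⟨γ₀, hγ₀⟩).lawFrom 0 h := by
    rw [← integral_const_mul]
    refine integral_mono_ae h4 (h3.const_mul _) ?_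
    filter_upwards [h5] with p hp
    simpa [mul_comm] using Finset.sum_le_sum (s := Finset.range (frameNat R 0 p))
      fun i _ => ((hp (0 + i) (Nat.zero_le _)).2.2.2 m).2
  have h8 := C.α_nonneg
  rw [div_eq_iff (by linarith)] at h1
  change ∫ p, ∑ i ∈ Finset.range (frameNat R 0 p), S.xhat m (point S p (0 + i))
    ∂(σ.toPolicy C ⟨γ₀, hγ₀⟩).lawFrom 0 h = _ at h1
  rw [h1] at h6 h7
  have h9 := le_of_mul_le_mul_right h6 (by linarith)
  have h10 := le_of_mul_le_mul_right h7 (by linarith)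
  constructor <;> linarith

/-! ### The drift-plus-penalty expression -/

variable [Fintype N] [Fintype L]

/-- The drift-plus-penalty expression over a renewal interval, for a given backlog at its start. -/
noncomputable def weightedCost (R : RenewalRule N M L W A Z) {C : Program S L} (π : Policy S C)
    (t : ℕ) (h : Hist N M L W A Z t) (θ : Backlog N M L) : ℝ :=
  - ∑ n, θ.1 n * ∫ p, ∑ i ∈ Finset.range (frameNat R t p), S.dhat n (point S p (t + i))
      ∂π.lawFrom t h
    - ∑ m, θ.2.2 m * ∫ p, ∑ i ∈ Finset.range (frameNat R t p),
        (aux p (t + i) m - S.xhat m (point S p (t + i))) ∂π.lawFrom t h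
    - ∑ l, θ.2.1 l * ∫ p, ∑ i ∈ Finset.range (frameNat R t p),
        (C.c l - C.reg.h l (aux p (t + i))) ∂π.lawFrom t h
    + C.V * ∫ p, ∑ i ∈ Finset.range (frameNat R t p), C.reg.f (aux p (t + i)) ∂π.lawFrom t h

theorem ae_admissible_of_past (π : Policy S C) {p₀ : Path N M L W A Z}
    (hp₀ : ∀ τ < t, S.Admissible C.α (point S p₀ τ) (aux p₀ τ)) :
    ∀ᵐ p ∂π.lawFrom t (past t p₀), ∀ τ, S.Admissible C.α (point S p τ) (aux p τ) := by
  have h1 : MeasurableSet[pastSigma N M L W A Z t]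
      {p : Path N M L W A Z | ∀ τ < t, S.Admissible C.α (point S p τ) (aux p τ)} := by
    simp only [Set.ofPred_forall]
    refine MeasurableSet.iInter fun τ => MeasurableSet.iInter fun hτ => ?_
    exact ((measurable_point S hτ).prodMk (measurable_aux hτ)) (measurableSet_admissible S C.α)
  filter_upwards [ae_mem_lawFrom π t h1 hp₀, (follows_lawFrom π t _).ae_admissible] with p hp hp' τ
  rcases lt_or_ge τ t with h | h
  · exact hp τ h
  · exact hp' τ h

theorem ae_backlog_reg_eq (π : Policy S C) (p₀ : Path N M L W A Z) :
    ∀ᵐ p ∂π.lawFrom t (past t p₀), backlog S C.reg p t = backlog S C.reg p₀ t := by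
  obtain ⟨hQ, hY, hW⟩ := measurable_backlog (S := S) C.measurable_reg_h t
  filter_upwards [ae_all_iff.2 fun n => ae_eq_lawFrom π t (hQ n) p₀,
    ae_all_iff.2 fun n => ae_eq_lawFrom π t (hY n) p₀,
    ae_all_iff.2 fun n => ae_eq_lawFrom π t (hW n) p₀] with p h1 h2 h3
  exact Prod.ext (funext h1) (Prod.ext (funext h2) (funext h3))

/-- Given the past, the backlog at `t` is almost surely constant, so it acts as a fixed weight in
front of integrable interval sums. -/
theorem IsRenewalDefinition.integral_driftTerm_add (hR : IsRenewalDefinition S C R)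
    (π : Policy S C) {p₀ : Path N M L W A Z} (ht : RenewsAt R p₀ t) :
    Integrable (fun p => driftTerm S C.reg p t (frameNat R t p) +
        C.V * ∑ i ∈ Finset.range (frameNat R t p), C.reg.f (aux p (t + i)))
      (π.lawFrom t (past t p₀)) ∧
    ∫ p, (driftTerm S C.reg p t (frameNat R t p) +
        C.V * ∑ i ∈ Finset.range (frameNat R t p), C.reg.f (aux p (t + i)))
      ∂π.lawFrom t (past t p₀) = weightedCost R π t (past t p₀) (backlog S C.reg p₀ t) := by
  set θ := backlog S C.reg p₀ t with hθ
  set μ := π.lawFrom t (past t p₀) with hμ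
  have i1 : ∀ n, Integrable (fun p => θ.1 n *
      ∑ i ∈ Finset.range (frameNat R t p), S.dhat n (point S p (t + i))) μ :=
    fun n => (hR.integrable_frame_dhat π ht n).const_mul _
  have i2 : ∀ m, Integrable (fun p => θ.2.2 m * ∑ i ∈ Finset.range (frameNat R t p),
      (aux p (t + i) m - S.xhat m (point S p (t + i)))) μ := fun m => by
    simp only [Finset.sum_sub_distrib]
    exact ((hR.integrable_frame_aux π ht m).sub (hR.integrable_frame_xhat π ht m)).const_mul _
  have i3 : ∀ l, Integrable (fun p => θ.2.1 l * ∑ i ∈ Finset.range (frameNat R t p),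
      (C.c l - C.reg.h l (aux p (t + i)))) μ :=
    fun l => (hR.integrable_frame_h π ht l).const_mul _
  have i4 : Integrable (fun p => C.V * ∑ i ∈ Finset.range (frameNat R t p),
      C.reg.f (aux p (t + i))) μ := (hR.integrable_frame_f π ht).const_mul _
  have j1 := integrable_finsetSum Finset.univ fun n _ => i1 n
  have j2 := integrable_finsetSum Finset.univ fun m _ => i2 m
  have j3 := integrable_finsetSum Finset.univ fun l _ => i3 l
  have hae : (fun p => driftTerm S C.reg p t (frameNat R t p) +
      C.V * ∑ i ∈ Finset.range (frameNat R t p), C.reg.f (aux p (t + i))) =ᵐ[μ]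
      fun p => - ∑ n, θ.1 n * ∑ i ∈ Finset.range (frameNat R t p), S.dhat n (point S p (t + i))
        - ∑ m, θ.2.2 m * ∑ i ∈ Finset.range (frameNat R t p),
          (aux p (t + i) m - S.xhat m (point S p (t + i)))
        - ∑ l, θ.2.1 l * ∑ i ∈ Finset.range (frameNat R t p),
          (C.c l - C.reg.h l (aux p (t + i)))
        + C.V * ∑ i ∈ Finset.range (frameNat R t p), C.reg.f (aux p (t + i)) := by
    filter_upwards [ae_backlog_reg_eq π p₀] with p hp
    rw [driftTerm, hp]
    rfl
  refine ⟨(((j1.neg.sub j2).sub j3).add i4).congr hae.symm, ?_⟩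
  rw [integral_congr_ae hae]
  refine (integral_neg_sub_sub_add j1 j2 j3 i4).trans ?_
  rw [integral_finsetSum _ fun n _ => i1 n, integral_finsetSum _ fun n _ => i2 n,
    integral_finsetSum _ fun n _ => i3 n]
  simp only [integral_const_mul]
  rfl

/-- The shortest path objective is written with `C`, whose functions are uncontrolled outside the
box. Admissibility of the slots before `t` is also required, because the backlog at `t` depends on
them. -/
theorem IsRenewalDefinition.driftPlusPenalty_eq (hR : IsRenewalDefinition S C R)
    (π : Policy S C) {p₀ : Path N M L W A Z} (ht : RenewsAt R p₀ t)
    (hp₀ : ∀ τ < t, S.Admissible C.α (point S p₀ τ) (aux p₀ τ)) :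
    driftPlusPenalty R π t (past t p₀) =
      weightedCost R π t (past t p₀) (backlog S C.reg p₀ t) := by
  rw [← (hR.integral_driftTerm_add π ht).2]
  change ∫ p, (driftTerm S C p t (frameNat R t p) +
    C.V * ∑ i ∈ Finset.range (frameNat R t p), C.f (aux p (t + i))) ∂π.lawFrom t (past t p₀) = _
  refine integral_congr_ae ?_
  filter_upwards [ae_admissible_of_past π hp₀] with p hp
  simp only [driftTerm, backlog_reg fun τ _ => (hp τ).1, C.reg_h _ (hp _).1, C.reg_f (hp _).1]
  rfl

/-- The competitor holds the auxiliary vector at γ, its own average penalty, so auxiliary and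
penalty sums have equal means and the `W` terms cancel whatever their signs. Nonnegative `Y` meets
`c_l - h_l(γ) ≥ 0`, and nonnegative `Q` meets a mean service surplus of at least ε per slot. -/
theorem IsRenewalDefinition.weightedCost_toPolicy_le (hR : IsRenewalDefinition S C R)
    {ε : ℝ} {γ : S.box C.α} {σ : StatPolicy S} {h : Hist N M L W A Z t} (hh : h ∈ R t)
    (hx : ∀ m, (∫ p, frameSum R t p (fun τ => S.xhat m (point S p τ))
          ∂((σ.toPolicy C γ).lawFrom t h)) /
        (∫⁻ p, (frameLength R t p : ℝ≥0∞) ∂((σ.toPolicy C γ).lawFrom t h)).toReal = γ.1 m)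
    (hd : ∀ n, ε ≤ (∫ p, frameSum R t p (fun τ => S.dhat n (point S p τ))
          ∂((σ.toPolicy C γ).lawFrom t h)) /
        (∫⁻ p, (frameLength R t p : ℝ≥0∞) ∂((σ.toPolicy C γ).lawFrom t h)).toReal)
    (hl : ∀ l, C.h l γ ≤ C.c l) {θ : Backlog N M L} (hQ : ∀ n, 0 ≤ θ.1 n)
    (hY : ∀ l, 0 ≤ θ.2.1 l) :
    weightedCost R (σ.toPolicy C γ) t h θ ≤
      (C.V * C.f γ - ε * ∑ n, θ.1 n) *
        ∫ p, (frameNat R t p : ℝ) ∂(σ.toPolicy C γ).lawFrom t h := by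
  rw [← hR.integral_frameNat _ hh] at hx hd
  have hT := hR.one_le_integral_frameNat (σ.toPolicy C γ) hh
  have haux := σ.ae_aux_toPolicy γ h
  set μ := (σ.toPolicy C γ).lawFrom t h with hμ
  set T := ∫ p, (frameNat R t p : ℝ) ∂μ with hTdef
  have h1 : ∀ n, ε * T ≤
      ∫ p, ∑ i ∈ Finset.range (frameNat R t p), S.dhat n (point S p (t + i)) ∂μ := fun n =>
    (le_div_iff₀ (by linarith)).1 (hd n)
  have h2 : ∀ m, ∫ p, ∑ i ∈ Finset.range (frameNat R t p),
      (aux p (t + i) m - S.xhat m (point S p (t + i))) ∂μ = 0 := fun m => by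
    have e1 : ∫ p, ∑ i ∈ Finset.range (frameNat R t p), S.xhat m (point S p (t + i)) ∂μ =
        γ.1 m * T := (div_eq_iff (by linarith)).1 (hx m)
    have e2 : ∫ p, ∑ i ∈ Finset.range (frameNat R t p), aux p (t + i) m ∂μ = γ.1 m * T := by
      rw [hTdef, ← integral_const_mul]
      refine integral_congr_ae ?_
      filter_upwards [haux] with p hp
      simp [hp _ (Nat.le_add_right t _), mul_comm]
    simp only [Finset.sum_sub_distrib]
    rw [integral_sub (hR.integrable_frame_aux _ hh m) (hR.integrable_frame_xhat _ hh m), e1, e2,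
      sub_self]
  have h3 : ∀ l, 0 ≤ ∫ p, ∑ i ∈ Finset.range (frameNat R t p),
      (C.c l - C.reg.h l (aux p (t + i))) ∂μ := fun l => by
    refine integral_nonneg_of_ae ?_
    filter_upwards [haux] with p hp
    refine Finset.sum_nonneg fun i _ => ?_
    rw [hp _ (Nat.le_add_right t _), C.reg_h l γ.2]
    exact sub_nonneg.2 (hl l)
  have h4 : ∫ p, ∑ i ∈ Finset.range (frameNat R t p), C.reg.f (aux p (t + i)) ∂μ =
      C.f γ * T := by
    rw [hTdef, ← integral_const_mul]
    refine integral_congr_ae ?_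
    filter_upwards [haux] with p hp
    simp [hp _ (Nat.le_add_right t _), C.reg_f γ.2, mul_comm]
  have h5 : ε * (∑ n, θ.1 n) * T ≤ ∑ n, θ.1 n *
      ∫ p, ∑ i ∈ Finset.range (frameNat R t p), S.dhat n (point S p (t + i)) ∂μ := by
    rw [mul_right_comm, mul_comm (ε * T), Finset.sum_mul]
    exact Finset.sum_le_sum fun n _ => mul_le_mul_of_nonneg_left (h1 n) (hQ n)
  have h6 : 0 ≤ ∑ l, θ.2.1 l * ∫ p, ∑ i ∈ Finset.range (frameNat R t p),
      (C.c l - C.reg.h l (aux p (t + i))) ∂μ :=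
    Finset.sum_nonneg fun l _ => mul_nonneg (hY l) (h3 l)
  rw [weightedCost, ← hμ, h4]
  simp only [h2, mul_zero, Finset.sum_const_zero, sub_zero]
  linarith

end Drift

/-! ### Expected drift-plus-penalty inequality over one renewal interval -/

section FrameDrift

variable {N M L W A Z : Type u} [MeasurableSpace W] [MeasurableSpace A] [MeasurableSpace Z]
  [Countable Z] [DiscreteMeasurableSpace Z] [Fintype M] [Fintype N] [Fintype L]
  {S : Network N M W A Z} {C : Program S L} {R : RenewalRule N M L W A Z} {t : ℕ}

theorem natCast_le_sq (k : ℕ) : (k : ℝ) ≤ (k : ℝ) ^ 2 := by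
  exact_mod_cast Nat.le_self_pow two_ne_zero k

theorem measurable_slotCost : Measurable fun x : (A × (W × Bool) × Z) × (M → ℝ) =>
    slotCost S C.reg x.1 x.2 := by
  have h1 (n : N) : Measurable fun x : (A × (W × Bool) × Z) × (M → ℝ) => S.μhat n x.1 :=
    (S.μhat_meas n).comp measurable_fst
  have h2 (n : N) : Measurable fun x : (A × (W × Bool) × Z) × (M → ℝ) => S.Rhat n x.1 :=
    (S.Rhat_meas n).comp measurable_fst
  have h3 (m : M) : Measurable fun x : (A × (W × Bool) × Z) × (M → ℝ) => S.xhat m x.1 :=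
    (S.xhat_meas m).comp measurable_fst
  have h4 (l : L) : Measurable fun x : (A × (W × Bool) × Z) × (M → ℝ) => C.reg.h l x.2 :=
    (C.measurable_reg_h l).comp measurable_snd
  have h5 (m : M) : Measurable fun x : (A × (W × Bool) × Z) × (M → ℝ) => x.2 m :=
    (measurable_pi_apply m).comp measurable_snd
  refine ((Finset.measurable_fun_sum _ fun n _ => ((h1 n).pow_const 2).add
    ((h2 n).pow_const 2)).add (Finset.measurable_fun_sum _ fun m _ =>
      ((h5 m).sub (h3 m)).pow_const 2)).add (Finset.measurable_fun_sum _ fun l _ =>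
        ((h4 l).sub measurable_const).pow_const 2)

/-- The defining inequality of `B₂` is divided by the second moment of the length, which is positive
because `T ≥ 1`. The resulting bound κ satisfies `κ E{T²} / 2 = B₂`, so the quadratic remainder of
the drift costs exactly `B₂` in mean. -/
theorem IsDriftConstant.ae_slotCost_le {π : Policy S C} {B₂ : ℝ} (hB : IsDriftConstant R π B₂)
    (hR : IsRenewalDefinition S C R) {h : Hist N M L W A Z t} (hh : h ∈ R t) :
    ∀ᵐ p ∂π.lawFrom t h, ∀ τ, t ≤ τ → slotCost S C.reg (point S p τ) (aux p τ) ≤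
      2 * B₂ / ∫ p, (frameNat R t p : ℝ) ^ 2 ∂π.lawFrom t h := by
  have hT := hR.one_le_integral_frameNat π hh
  have hT2 : ∫ p, (frameNat R t p : ℝ) ∂π.lawFrom t h ≤
      ∫ p, (frameNat R t p : ℝ) ^ 2 ∂π.lawFrom t h :=
    integral_mono (hR.integrable_frameNat π hh) (hR.integrable_frameNat_sq π hh)
      fun p => natCast_le_sq _
  obtain ⟨m₁, m₂, hm⟩ := hR.moments
  have hfin : ∫⁻ p, (frameLength R t p : ℝ≥0∞) ^ 2 ∂π.lawFrom t h ≠ ⊤ :=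
    ((hm π t h hh).2.trans_lt ENNReal.coe_lt_top).ne
  have hB' := hB.2 t h hh
  rw [← ENNReal.ofReal_toReal hfin, ← hR.integral_frameNat_sq π hh] at hB'
  set e := ∫ p, (frameNat R t p : ℝ) ^ 2 ∂π.lawFrom t h
  have he : 0 < e := by linarith
  refine (follows_lawFrom π t h).ae_decision (P := fun x => slotCost S C.reg x.1 x.2 ≤ 2 * B₂ / e)
    (measurableSet_le measurable_slotCost measurable_const) fun τ _ h' Ω => ?_
  filter_upwards [π.act_mem τ h' Ω] with d hd
  have h1 := hB' Ω _ d.1 hd.1 d.2 hd.2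
  have h2 : slotCost S C.reg (d.1, Ω, histState S τ h') d.2 =
      slotCost S C (d.1, Ω, histState S τ h') d.2 := by
    simp only [slotCost, C.reg_h _ hd.2]
    rfl
  rw [h2]
  change ENNReal.ofReal e / 2 * ENNReal.ofReal (slotCost S C (d.1, Ω, histState S τ h') d.2) ≤ _
    at h1
  rw [← ENNReal.ofReal_ofNat, ← ENNReal.ofReal_div_of_pos two_pos,
    ← ENNReal.ofReal_mul (by positivity), ENNReal.ofReal_le_ofReal_iff hB.1.le] at h1
  rw [le_div_iff₀ he]
  linarith

/-- The expected value of the Lyapunov function and of the penalty at the end of a renewal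
interval, when the policy does not do worse than a `(z, Ω)`-only policy which attains `γ`. -/
theorem IsRenewalDefinition.lintegral_frame_le (hR : IsRenewalDefinition S C R)
    {π : Policy S C} {B₂ : ℝ} (hB : IsDriftConstant R π B₂) {p₀ : Path N M L W A Z}
    (ht : RenewsAt R p₀ t)
    (hp₀ : ∀ τ < t, S.Admissible C.α (point S p₀ τ) (aux p₀ τ))
    (hQ : ∀ n, 0 ≤ (backlog S C.reg p₀ t).1 n) (hY : ∀ l, 0 ≤ (backlog S C.reg p₀ t).2.1 l)
    {ε : ℝ} (hε : 0 ≤ ε) {γ : S.box C.α} {σ : StatPolicy S}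
    (hx : ∀ m, (∫ p, frameSum R t p (fun τ => S.xhat m (point S p τ))
          ∂((σ.toPolicy C γ).lawFrom t (past t p₀))) /
        (∫⁻ p, (frameLength R t p : ℝ≥0∞)
          ∂((σ.toPolicy C γ).lawFrom t (past t p₀))).toReal = γ.1 m)
    (hd : ∀ n, ε ≤ (∫ p, frameSum R t p (fun τ => S.dhat n (point S p τ))
          ∂((σ.toPolicy C γ).lawFrom t (past t p₀))) /
        (∫⁻ p, (frameLength R t p : ℝ≥0∞) ∂((σ.toPolicy C γ).lawFrom t (past t p₀))).toReal)
    (hl : ∀ l, C.h l γ ≤ C.c l)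
    (hopt : driftPlusPenalty R π t (past t p₀) ≤
      driftPlusPenalty R (σ.toPolicy C γ) t (past t p₀)) :
    ∫⁻ p, ENNReal.ofReal (lyapunov (backlog S C.reg p (t + frameNat R t p)) +
        C.V * ∑ i ∈ Finset.range (frameNat R t p), (C.reg.f (aux p (t + i)) - C.fmin))
        ∂π.lawFrom t (past t p₀) +
      ENNReal.ofReal (ε * (∑ n, (backlog S C.reg p₀ t).1 n) *
        ∫ p, (frameNat R t p : ℝ) ∂(σ.toPolicy C γ).lawFrom t (past t p₀)) ≤
    ENNReal.ofReal (lyapunov (backlog S C.reg p₀ t)) +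
      ENNReal.ofReal (B₂ + C.V * (C.f γ *
          ∫ p, (frameNat R t p : ℝ) ∂(σ.toPolicy C γ).lawFrom t (past t p₀) -
        C.fmin * ∫ p, (frameNat R t p : ℝ) ∂π.lawFrom t (past t p₀))) := by
  have h1 := hR.weightedCost_toPolicy_le (C := C) ht hx hd hl hQ hY
  rw [← hR.driftPlusPenalty_eq _ ht hp₀] at h1
  have h2 := hopt.trans h1
  rw [hR.driftPlusPenalty_eq _ ht hp₀, ← (hR.integral_driftTerm_add π ht).2] at h2
  have i1 := (hR.integral_driftTerm_add π ht).1
  have i2 := hR.integrable_frameNat_sq π ht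
  have i3 := hR.integrable_frameNat π ht
  have hT2 : 1 ≤ ∫ p, (frameNat R t p : ℝ) ^ 2 ∂π.lawFrom t (past t p₀) :=
    (hR.one_le_integral_frameNat π ht).trans (integral_mono i3 i2
      fun p => natCast_le_sq _)
  have hK := hB.ae_slotCost_le hR ht
  have hb := ae_backlog_reg_eq (C := C) (t := t) π p₀
  have hadm := (follows_lawFrom π t (past t p₀)).ae_admissible
  have hT' := hR.one_le_integral_frameNat (σ.toPolicy C γ) ht
  set μ := π.lawFrom t (past t p₀) with hμ
  set θ := backlog S C.reg p₀ t with hθ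
  set e := ∫ p, (frameNat R t p : ℝ) ^ 2 ∂μ with he
  set T' := ∫ p, (frameNat R t p : ℝ) ∂(σ.toPolicy C γ).lawFrom t (past t p₀)
  -- `Y` is an integrable pathwise majorant of the quantity under the integral. Its mean is computed
  -- exactly, so integrability of the Lyapunov function at the end of the interval need not be known
  -- beforehand.
  set Y : Path N M L W A Z → ℝ := fun p =>
    lyapunov θ + (2 * B₂ / e / 2 * (frameNat R t p : ℝ) ^ 2 +
      ((driftTerm S C.reg p t (frameNat R t p) +
        C.V * ∑ i ∈ Finset.range (frameNat R t p), C.reg.f (aux p (t + i))) -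
      C.V * C.fmin * (frameNat R t p : ℝ))) with hYdef
  have iY : Integrable Y μ :=
    (integrable_const _).add ((i2.const_mul _).add (i1.sub (i3.const_mul _)))
  have eY : ∫ p, Y p ∂μ = lyapunov θ + (B₂ +
      (∫ p, (driftTerm S C.reg p t (frameNat R t p) +
        C.V * ∑ i ∈ Finset.range (frameNat R t p), C.reg.f (aux p (t + i))) ∂μ -
      C.V * C.fmin * ∫ p, (frameNat R t p : ℝ) ∂μ)) := by
    have i4 := (i2.const_mul (2 * B₂ / e / 2))
    have i5 := (i3.const_mul (C.V * C.fmin))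
    have i6 : Integrable (fun p => (driftTerm S C.reg p t (frameNat R t p) +
        C.V * ∑ i ∈ Finset.range (frameNat R t p), C.reg.f (aux p (t + i))) -
      C.V * C.fmin * (frameNat R t p : ℝ)) μ := i1.sub i5
    have i7 : Integrable (fun p => 2 * B₂ / e / 2 * (frameNat R t p : ℝ) ^ 2 +
      ((driftTerm S C.reg p t (frameNat R t p) +
        C.V * ∑ i ∈ Finset.range (frameNat R t p), C.reg.f (aux p (t + i))) -
      C.V * C.fmin * (frameNat R t p : ℝ))) μ := i4.add i6
    rw [hYdef, integral_add (integrable_const _) i7, integral_add i4 i6, integral_sub i1 i5,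
      integral_const_mul, integral_const_mul, ← he]
    -- The second moment of the length cancels against the one in the slot bound.
    have : 2 * B₂ / e / 2 * e = B₂ := by
      field_simp
    simp [this]
  have hXY : ∀ᵐ p ∂μ, 0 ≤ lyapunov (backlog S C.reg p (t + frameNat R t p)) +
        C.V * ∑ i ∈ Finset.range (frameNat R t p), (C.reg.f (aux p (t + i)) - C.fmin) ∧
      lyapunov (backlog S C.reg p (t + frameNat R t p)) +
        C.V * ∑ i ∈ Finset.range (frameNat R t p), (C.reg.f (aux p (t + i)) - C.fmin) ≤ Y p := by
    filter_upwards [hK, hb, hadm] with p hK hb hadm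
    constructor
    · refine add_nonneg (lyapunov_nonneg _) (mul_nonneg C.V_nonneg (Finset.sum_nonneg fun i _ => ?_))
      have h3 := (hadm (t + i) (Nat.le_add_right t i)).1
      rw [C.reg_f h3]
      exact sub_nonneg.2 (C.f_bd _ h3).1
    · have h3 := lyapunov_le_add_driftTerm (C := C.reg) (p := p) (s := t) (k := frameNat R t p)
        (fun i _ => hadm (t + i) (Nat.le_add_right t i)) (by rw [hb]; exact hQ)
        (by rw [hb]; exact hY) (fun i _ => hK (t + i) (Nat.le_add_right t i))
      rw [hb] at h3
      have h4 : ∑ i ∈ Finset.range (frameNat R t p), (C.reg.f (aux p (t + i)) - C.fmin) =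
          ∑ i ∈ Finset.range (frameNat R t p), C.reg.f (aux p (t + i)) -
            frameNat R t p * C.fmin := by
        simp [Finset.sum_sub_distrib]
      rw [h4, hYdef]
      simp only
      linarith
  have h5 : ∫⁻ p, ENNReal.ofReal (lyapunov (backlog S C.reg p (t + frameNat R t p)) +
        C.V * ∑ i ∈ Finset.range (frameNat R t p), (C.reg.f (aux p (t + i)) - C.fmin)) ∂μ ≤
      ENNReal.ofReal (∫ p, Y p ∂μ) := by
    rw [ofReal_integral_eq_lintegral_ofReal iY (hXY.mono fun p hp => hp.1.trans hp.2)]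
    exact lintegral_mono_ae (hXY.mono fun p hp => ENNReal.ofReal_le_ofReal hp.2)
  have hY0 : 0 ≤ ∫ p, Y p ∂μ := integral_nonneg_of_ae (hXY.mono fun p hp => hp.1.trans hp.2)
  have hQ0 : 0 ≤ ε * (∑ n, θ.1 n) * T' :=
    mul_nonneg (mul_nonneg hε (Finset.sum_nonneg fun n _ => hQ n)) (by linarith)
  refine (add_le_add_left h5 _).trans ?_
  rw [← ENNReal.ofReal_add hY0 hQ0]
  refine le_trans (ENNReal.ofReal_le_ofReal ?_) ENNReal.ofReal_add_le
  rw [eY]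
  linarith

end FrameDrift

section Law

variable {N M L W A Z : Type u} [MeasurableSpace W] [MeasurableSpace A] [MeasurableSpace Z]
  [Countable Z] [DiscreteMeasurableSpace Z] [Fintype M]
  {S : Network N M W A Z} {C : Program S L} {R : RenewalRule N M L W A Z}

/-! ### The law of the trajectory -/

/-- The initial backlog `Θ(0)`. -/
def initialBacklog (p : Path N M L W A Z) : Backlog N M L := p 0

theorem measurable_initialBacklog : Measurable (initialBacklog : Path N M L W A Z → _) :=
  measurable_pi_apply (X := Coord N M L W A Z) 0

theorem map_law_initialBacklog (π : Policy S C) (ρ : Measure (Backlog N M L))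
    [IsProbabilityMeasure ρ] : (π.law ρ).map initialBacklog = ρ := by
  let ρ' : Measure (Coord N M L W A Z 0) := ρ
  let e : Hist N M L W A Z 0 ≃ᵐ Coord N M L W A Z 0 :=
    MeasurableEquiv.piUnique (fun i : Finset.Iic 0 => Coord N M L W A Z i)
  have h1 : (π.law ρ).map (past 0) = ρ'.map e.symm := by
    change (Measure.bind (ρ'.map e.symm) (Kernel.traj π.step 0)).map (frestrictLe 0) = _
    rw [Measure.map_comp _ _ (measurable_frestrictLe 0), Kernel.traj_map_frestrictLe,
      Kernel.partialTraj_self, Measure.id_comp]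
  have h2 := Measure.map_map (μ := π.law ρ) e.measurable (measurable_past 0)
  rw [h1, e.map_map_symm] at h2
  exact h2.symm

/-- The properties which almost all trajectories have. -/
structure IsTypical (S : Network N M W A Z) (C : Program S L) (R : RenewalRule N M L W A Z)
    (p : Path N M L W A Z) : Prop where
  admissible : ∀ τ, S.Admissible C.α (point S p τ) (aux p τ)
  nonneg : ∀ t, (∀ n, 0 ≤ (backlog S C.reg p t).1 n) ∧ ∀ l, 0 ≤ (backlog S C.reg p t).2.1 l
  zero : RenewsAt R p 0
  finite : ∀ t, RenewsAt R p t → frameLength R t p < ⊤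

theorem IsTypical.backlog_eq {p : Path N M L W A Z} (hp : IsTypical S C R p) (t : ℕ) :
    backlog S C p t = backlog S C.reg p t :=
  (backlog_reg fun τ _ => (hp.admissible τ).1).symm

theorem ae_isTypical [Finite N] (hR : IsRenewalDefinition S C R) (π : Policy S C)
    (ρ : Measure (Backlog N M L)) [IsProbabilityMeasure ρ]
    (hρ : ∀ᵐ θ ∂ρ, (∀ n, 0 ≤ θ.1 n) ∧ ∀ l, 0 ≤ θ.2.1 l) :
    ∀ᵐ p ∂π.law ρ, IsTypical S C R p := by
  have h0 : ∀ᵐ p ∂π.law ρ, (∀ n, 0 ≤ (initialBacklog p).1 n) ∧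
      ∀ l, 0 ≤ (initialBacklog p).2.1 l := by
    rw [← map_law_initialBacklog π ρ] at hρ
    exact ae_of_ae_map measurable_initialBacklog.aemeasurable hρ
  filter_upwards [h0, (follows_law π ρ).ae_admissible,
    hR.ae_frameLength_lt_top_of_follows (follows_law π ρ)] with p h1 h2 h3
  exact ⟨fun τ => h2 τ (Nat.zero_le _),
    fun t => backlog_nonneg (C := C.reg) h1 fun τ _ => h2 τ (Nat.zero_le _),
    hR.renewsAt_zero p, fun t => h3 t (Nat.zero_le _)⟩

section Step

variable [Fintype N] [Fintype L]

theorem measurable_lyapunov_backlog (t : ℕ) :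
    Measurable[pastSigma N M L W A Z t] fun p => lyapunov (backlog S C.reg p t) := by
  obtain ⟨hQ, hY, hW⟩ := measurable_backlog (S := S) C.measurable_reg_h t
  exact (((Finset.measurable_fun_sum _ fun n _ => (hQ n).pow_const 2).add
    (Finset.measurable_fun_sum _ fun l _ => (hY l).pow_const 2)).add
      (Finset.measurable_fun_sum _ fun m _ => (hW m).pow_const 2)).const_mul _

theorem measurable_sum_queue (t : ℕ) :
    Measurable[pastSigma N M L W A Z t] fun p => ∑ n, (backlog S C.reg p t).1 n :=
  Finset.measurable_fun_sum _ fun n _ => (measurable_backlog (S := S) C.measurable_reg_h t).1 n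

theorem measurable_reg_f_aux (τ : ℕ) :
    Measurable fun p : Path N M L W A Z => C.reg.f (aux p τ) :=
  C.measurable_reg_f.comp ((measurable_aux τ.lt_succ_self).mono (pastSigma_le _) le_rfl)

/-- One renewal interval decreases the Lyapunov function by the sum of the queues, up to a
constant. -/
def HasFrameDrift (R : RenewalRule N M L W A Z) (π : Policy S C) (ρ : Measure (Backlog N M L))
    (c K : ℝ) : Prop :=
  ∀ t, ∀ E ⊆ {p | RenewsAt R p t}, MeasurableSet[pastSigma N M L W A Z t] E →
    ∫⁻ p in E, ENNReal.ofReal (lyapunov (backlog S C.reg p (t + frameNat R t p)) +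
        C.V * ∑ i ∈ Finset.range (frameNat R t p), (C.reg.f (aux p (t + i)) - C.fmin)) ∂π.law ρ +
      ENNReal.ofReal c * ∫⁻ p in E, ENNReal.ofReal (∑ n, (backlog S C.reg p t).1 n) ∂π.law ρ ≤
    ∫⁻ p in E, ENNReal.ofReal (lyapunov (backlog S C.reg p t)) ∂π.law ρ +
      ENNReal.ofReal K * π.law ρ E

/-- The conditional inequality for one interval is integrated over `E`. The constants `c` and `K`
bound the expected lengths uniformly, which removes the dependence on the history. -/
theorem hasFrameDrift (hR : IsRenewalDefinition S C R) {π : Policy S C}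
    {ρ : Measure (Backlog N M L)} [IsProbabilityMeasure ρ]
    (hρ : ∀ᵐ θ ∂ρ, (∀ n, 0 ≤ θ.1 n) ∧ ∀ l, 0 ≤ θ.2.1 l)
    (hπ : SolvesShortestPath R π ρ) {B₂ : ℝ} (hB : IsDriftConstant R π B₂) {ε : ℝ} (hε : 0 ≤ ε)
    {γ : M → ℝ} (hγ : Attains C R ε γ) {c K : ℝ}
    (hc : ∀ (π' : Policy S C) t, ∀ h ∈ R t, c ≤ ε * ∫ p, (frameNat R t p : ℝ) ∂π'.lawFrom t h)
    (hK : ∀ (π' : Policy S C) t, ∀ h ∈ R t,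
      B₂ + C.V * (C.f γ * ∫ p, (frameNat R t p : ℝ) ∂π'.lawFrom t h -
        C.fmin * ∫ p, (frameNat R t p : ℝ) ∂π.lawFrom t h) ≤ K) :
    HasFrameDrift R π ρ c K := by
  intro t E hER hE
  have hbox := hγ.mem_box hR π
  obtain ⟨⟨σ, hσ⟩, hl⟩ := hγ
  have hE' := pastSigma_le _ _ hE
  have mQ : Measurable fun p : Path N M L W A Z =>
      ENNReal.ofReal (∑ n, (backlog S C.reg p t).1 n) :=
    ((measurable_sum_queue t).mono (pastSigma_le _) le_rfl).ennreal_ofReal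
  have mL : Measurable fun p : Path N M L W A Z =>
      ENNReal.ofReal (lyapunov (backlog S C.reg p t)) :=
    ((measurable_lyapunov_backlog t).mono (pastSigma_le _) le_rfl).ennreal_ofReal
  have mG : Measurable fun p : Path N M L W A Z =>
      ENNReal.ofReal (lyapunov (backlog S C.reg p (t + frameNat R t p)) +
        C.V * ∑ i ∈ Finset.range (frameNat R t p), (C.reg.f (aux p (t + i)) - C.fmin)) :=
    (measurable_comp_nat (measurable_frameNat hR.meas t)
      (g := fun k p => lyapunov (backlog S C.reg p (t + k)) +
        C.V * ∑ i ∈ Finset.range k, (C.reg.f (aux p (t + i)) - C.fmin)) fun k =>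
        ((measurable_lyapunov_backlog _).mono (pastSigma_le _) le_rfl).add
          ((Finset.measurable_fun_sum _ fun i _ =>
            (measurable_reg_f_aux (t + i)).sub measurable_const).const_mul _)).ennreal_ofReal
  rw [(follows_law π ρ).setLIntegral (Nat.zero_le t) hE mG, ← lintegral_const_mul _ mQ,
    ← lintegral_add_right _ (mQ.const_mul _), ← setLIntegral_const,
    ← lintegral_add_left mL]
  refine lintegral_mono_ae ((ae_restrict_iff' hE').2 ?_)
  -- Optimality holds off a null set that may depend on the competitor; a single competitor, fixed
  -- before the trajectory, is all that is used.
  filter_upwards [ae_isTypical hR π ρ hρ, hπ (σ.toPolicy C ⟨γ, hbox⟩) t] with p hp hopt hpE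
  have ht : RenewsAt R p t := hER hpE
  have hs := hσ ⟨γ, hbox⟩ t (past t p) ht
  have h1 := hR.lintegral_frame_le hB ht (fun τ _ => hp.admissible τ) (hp.nonneg t).1
    (hp.nonneg t).2 hε (γ := ⟨γ, hbox⟩) hs.1 hs.2 hl (hopt ht)
  refine le_trans (add_le_add_right ?_ _) (h1.trans (add_le_add_right
    (ENNReal.ofReal_le_ofReal (hK _ t _ ht)) _))
  have h2 := Finset.sum_nonneg fun n (_ : n ∈ Finset.univ) => (hp.nonneg t).1 n
  rw [← ENNReal.ofReal_mul' h2]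
  refine ENNReal.ofReal_le_ofReal ?_
  rw [mul_right_comm]
  exact mul_le_mul_of_nonneg_right (hc _ t _ ht) h2

/-- The Lyapunov function at the first renewal time which is not smaller than `t`, plus the
penalty incurred until then. -/
noncomputable def potential (S : Network N M W A Z) (C : Program S L)
    (R : RenewalRule N M L W A Z) (t : ℕ) (p : Path N M L W A Z) : ℝ :=
  lyapunov (backlog S C.reg p (nextRenewal R p t)) +
    C.V * ∑ τ ∈ Finset.range (nextRenewal R p t), (C.reg.f (aux p τ) - C.fmin)

theorem lintegral_initial (π : Policy S C) {ρ : Measure (Backlog N M L)} [IsProbabilityMeasure ρ]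
    (hρL : Integrable lyapunov ρ) :
    ∫⁻ p, ENNReal.ofReal (lyapunov (backlog S C.reg p 0)) ∂π.law ρ =
      ENNReal.ofReal (∫ θ, lyapunov θ ∂ρ) := by
  rw [ofReal_integral_eq_lintegral_ofReal hρL (ae_of_all _ lyapunov_nonneg)]
  conv_rhs => rw [← map_law_initialBacklog π ρ]
  rw [lintegral_map' (by rw [map_law_initialBacklog π ρ]; exact hρL.1.aemeasurable.ennreal_ofReal)
    measurable_initialBacklog.aemeasurable]
  rfl

theorem penalty_nonneg {p : Path N M L W A Z} (hp : IsTypical S C R p) (s : Finset ℕ) :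
    0 ≤ C.V * ∑ τ ∈ s, (C.reg.f (aux p τ) - C.fmin) :=
  mul_nonneg C.V_nonneg (Finset.sum_nonneg fun τ _ => by
    rw [C.reg_f (hp.admissible τ).1]
    exact sub_nonneg.2 (C.f_bd _ (hp.admissible τ).1).1)

/-- Induction on `t`, splitting according to whether a renewal occurs at `t`. Without one the next
renewal time and hence the potential are unchanged; with one the next renewal time jumps from `t` to
the end of the interval, and the frame drift pays for the jump. -/
theorem lintegral_potential_le (hR : IsRenewalDefinition S C R) {π : Policy S C}
    {ρ : Measure (Backlog N M L)} [IsProbabilityMeasure ρ]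
    (hρ : ∀ᵐ θ ∂ρ, (∀ n, 0 ≤ θ.1 n) ∧ ∀ l, 0 ≤ θ.2.1 l) (hρL : Integrable lyapunov ρ)
    {c K : ℝ} (hd : HasFrameDrift R π ρ c K) (t : ℕ) :
    ∫⁻ p, ENNReal.ofReal (potential S C R t p) ∂π.law ρ + ENNReal.ofReal c *
      ∑ s ∈ Finset.range t, ∫⁻ p in {p | RenewsAt R p s},
        ENNReal.ofReal (∑ n, (backlog S C.reg p s).1 n) ∂π.law ρ ≤
    ENNReal.ofReal (∫ θ, lyapunov θ ∂ρ) +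
      ENNReal.ofReal K * ∑ s ∈ Finset.range t, π.law ρ {p | RenewsAt R p s} := by
  induction t with
  | zero =>
    rw [← lintegral_initial π hρL]
    simp [potential, nextRenewal]
  | succ t ih =>
    have hE := measurableSet_renewsAt hR.meas (R := R) (le_refl t)
    have hE' := pastSigma_le _ _ hE
    have h1 := hd t _ subset_rfl hE
    set E := {p | RenewsAt R p t} with hEdef
    have htyp := ae_isTypical hR π ρ hρ
    have mP : Measurable fun p : Path N M L W A Z =>
        ENNReal.ofReal (C.V * ∑ τ ∈ Finset.range t, (C.reg.f (aux p τ) - C.fmin)) :=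
      ((Finset.measurable_fun_sum _ fun τ _ =>
        (measurable_reg_f_aux τ).sub measurable_const).const_mul _).ennreal_ofReal
    -- On `E` the penalty splits into the part paid before `t`, which reappears unchanged in the
    -- potential at `t`, and the part paid during the new interval.
    have h2 : ∫⁻ p in E, ENNReal.ofReal (potential S C R (t + 1) p) ∂π.law ρ =
        ∫⁻ p in E, ENNReal.ofReal (lyapunov (backlog S C.reg p (t + frameNat R t p)) +
          C.V * ∑ i ∈ Finset.range (frameNat R t p), (C.reg.f (aux p (t + i)) - C.fmin)) ∂π.law ρ +
        ∫⁻ p in E, ENNReal.ofReal (C.V * ∑ τ ∈ Finset.range t, (C.reg.f (aux p τ) - C.fmin))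
          ∂π.law ρ := by
      rw [← lintegral_add_right _ mP]
      refine lintegral_congr_ae ((ae_restrict_iff' hE').2 ?_)
      filter_upwards [htyp] with p hp hpE
      have e0 : 0 ≤ C.V * ∑ i ∈ Finset.range (frameNat R t p),
          (C.reg.f (aux p (t + i)) - C.fmin) := by
        have := penalty_nonneg hp ((Finset.range (frameNat R t p)).map (addLeftEmbedding t))
        simpa only [Finset.sum_map, addLeftEmbedding_apply] using this
      rw [← ENNReal.ofReal_add (add_nonneg (lyapunov_nonneg _) e0) (penalty_nonneg hp _),
        potential, nextRenewal_succ_of_renewsAt hpE, Finset.sum_range_add]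
      congr 1
      ring
    have h3 : ∫⁻ p in E, ENNReal.ofReal (potential S C R t p) ∂π.law ρ =
        ∫⁻ p in E, ENNReal.ofReal (lyapunov (backlog S C.reg p t)) ∂π.law ρ +
        ∫⁻ p in E, ENNReal.ofReal (C.V * ∑ τ ∈ Finset.range t, (C.reg.f (aux p τ) - C.fmin))
          ∂π.law ρ := by
      rw [← lintegral_add_right _ mP]
      refine lintegral_congr_ae ((ae_restrict_iff' hE').2 ?_)
      filter_upwards [htyp] with p hp hpE
      rw [← ENNReal.ofReal_add (lyapunov_nonneg _) (penalty_nonneg hp _), potential,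
        nextRenewal_of_renewsAt hp.zero hp.finite hpE]
    have h4 : ∫⁻ p in Eᶜ, ENNReal.ofReal (potential S C R (t + 1) p) ∂π.law ρ =
        ∫⁻ p in Eᶜ, ENNReal.ofReal (potential S C R t p) ∂π.law ρ := by
      refine setLIntegral_congr_fun hE'.compl fun p hpE => ?_
      simp only [potential, nextRenewal_succ_of_not hpE]
    rw [← lintegral_add_compl _ hE', h3] at ih
    rw [← lintegral_add_compl _ hE', h2, h4, Finset.sum_range_succ, Finset.sum_range_succ, mul_add,
      mul_add]
    set a1 := ∫⁻ p in E, ENNReal.ofReal (lyapunov (backlog S C.reg p (t + frameNat R t p)) +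
          C.V * ∑ i ∈ Finset.range (frameNat R t p), (C.reg.f (aux p (t + i)) - C.fmin)) ∂π.law ρ
    set a2 := ∫⁻ p in E, ENNReal.ofReal (C.V * ∑ τ ∈ Finset.range t,
      (C.reg.f (aux p τ) - C.fmin)) ∂π.law ρ
    set a3 := ∫⁻ p in Eᶜ, ENNReal.ofReal (potential S C R t p) ∂π.law ρ
    set a4 := ENNReal.ofReal c * ∑ s ∈ Finset.range t, ∫⁻ p in {p | RenewsAt R p s},
        ENNReal.ofReal (∑ n, (backlog S C.reg p s).1 n) ∂π.law ρ
    set a5 := ENNReal.ofReal c * ∫⁻ p in E, ENNReal.ofReal (∑ n, (backlog S C.reg p t).1 n) ∂π.law ρ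
    set b1 := ∫⁻ p in E, ENNReal.ofReal (lyapunov (backlog S C.reg p t)) ∂π.law ρ
    calc a1 + a2 + a3 + (a4 + a5) = (a1 + a5) + (a2 + a3 + a4) := by ring
      _ ≤ (b1 + ENNReal.ofReal K * π.law ρ E) + (a2 + a3 + a4) := add_le_add_left h1 _
      _ = (b1 + a2 + a3 + a4) + ENNReal.ofReal K * π.law ρ E := by ring
      _ ≤ _ := by
        rw [← add_assoc]
        exact add_le_add_left ih _

end Step

/-! ### The renewal times -/

/-- Splitting by the value `r` of the preceding renewal time exhibits each `t_g` as a stopping time.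
-/
theorem renewalTime_succ_eq_iff {p : Path N M L W A Z} {g s : ℕ} :
    renewalTime R p (g + 1) = s ↔
      ∃ r ≤ s, renewalTime R p g = r ∧ frameLength R r p = (s - r : ℕ) := by
  constructor
  · intro h
    rw [renewalTime] at h
    have h1 : renewalTime R p g ≠ ⊤ := fun h1 => by simp [h1] at h
    obtain ⟨r, hr⟩ := ENat.ne_top_iff_exists.1 h1
    rw [← hr, ENat.toNat_natCast] at h
    have h2 : frameLength R r p ≠ ⊤ := fun h2 => by simp [h2] at h
    obtain ⟨k, hk⟩ := ENat.ne_top_iff_exists.1 h2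
    rw [← hk] at h
    have h3 : r + k = s := by exact_mod_cast h
    refine ⟨r, by lia, hr.symm, ?_⟩
    rw [← hk, ← h3, Nat.add_sub_cancel_left]
  · rintro ⟨r, hrs, h1, h2⟩
    rw [renewalTime, h1, ENat.toNat_natCast, h2]
    exact_mod_cast Nat.add_sub_cancel' hrs

theorem measurableSet_renewalTime_eq (hR : ∀ t, MeasurableSet (R t)) (g s : ℕ) :
    MeasurableSet[pastSigma N M L W A Z s] {p | renewalTime R p g = s} := by
  induction g generalizing s with
  | zero =>
    change MeasurableSet[pastSigma N M L W A Z s] {_p : Path N M L W A Z | (0 : ℕ∞) = s}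
    exact MeasurableSet.const _
  | succ g ih =>
    have : {p | renewalTime R p (g + 1) = s} = ⋃ r, ⋃ (_ : r ≤ s),
        ({p | renewalTime R p g = r} ∩ {p | frameLength R r p = (s - r : ℕ)}) := by
      ext p
      simp only [Set.mem_ofPred_eq, renewalTime_succ_eq_iff, Set.mem_iUnion, Set.mem_inter_iff,
        exists_prop]
    rw [this]
    refine MeasurableSet.iUnion fun r => MeasurableSet.iUnion fun hr => ?_
    have h1 := measurableSet_frameLength_eq hR r (s - r)
    rw [Nat.add_sub_cancel' hr] at h1
    exact (pastSigma_mono hr _ (ih r)).inter h1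

theorem renewsAt_of_renewalTime_eq {p : Path N M L W A Z} (h0 : RenewsAt R p 0) {g s : ℕ}
    (h : renewalTime R p g = s) : RenewsAt R p s := by
  cases g with
  | zero =>
    have h' : (0 : ℕ∞) = s := h
    have : (0 : ℕ) = s := by exact_mod_cast h'
    rwa [← this]
  | succ g =>
    obtain ⟨r, hr, -, h2⟩ := renewalTime_succ_eq_iff.1 h
    have h3 : frameLength R r p < ⊤ := by
      rw [h2]
      exact ENat.natCast_lt_top _
    have h4 := (frameNat_spec h3).2.2.1
    have h5 : frameNat R r p = s - r := by rw [frameNat, h2, ENat.toNat_natCast]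
    rwa [h5, Nat.add_sub_cancel' hr] at h4

theorem IsTypical.exists_renewalTime_eq {p : Path N M L W A Z} (hp : IsTypical S C R p) (g : ℕ) :
    ∃ s : ℕ, renewalTime R p g = s := by
  induction g with
  | zero => exact ⟨0, rfl⟩
  | succ g ih =>
    obtain ⟨s, hs⟩ := ih
    have h1 := frameNat_spec (hp.finite s (renewsAt_of_renewalTime_eq hp.zero hs))
    refine ⟨s + frameNat R s p, renewalTime_succ_eq_iff.2 ⟨s, Nat.le_add_right _ _, hs, ?_⟩⟩
    rw [Nat.add_sub_cancel_left, h1.1]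

theorem lintegral_eq_tsum_renewalTime [Finite N] (hR : IsRenewalDefinition S C R) {π : Policy S C}
    {ρ : Measure (Backlog N M L)} [IsProbabilityMeasure ρ]
    (hρ : ∀ᵐ θ ∂ρ, (∀ n, 0 ≤ θ.1 n) ∧ ∀ l, 0 ≤ θ.2.1 l) (g : ℕ)
    (F : Path N M L W A Z → ℝ≥0∞) :
    ∫⁻ p, F p ∂π.law ρ = ∑' s : ℕ, ∫⁻ p in {p | renewalTime R p g = s}, F p ∂π.law ρ := by
  rw [← lintegral_iUnion (fun s => pastSigma_le _ _ (measurableSet_renewalTime_eq hR.meas g s)),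
    ← setLIntegral_univ]
  · refine setLIntegral_congr ?_
    symm
    refine eventuallyEq_univ.2 ?_
    filter_upwards [ae_isTypical hR π ρ hρ] with p hp
    exact Set.mem_iUnion.2 (hp.exists_renewalTime_eq g)
  · intro i j hij
    refine Set.disjoint_left.2 fun p hp hp' => hij ?_
    exact_mod_cast hp.symm.trans hp'

/-- The same telescoping, now along the random times `t_g`. The frame drift is applied on each event
`t_g = s` and summed over `s`, which is why `HasFrameDrift` is stated for sub-events of a renewal;
the nonnegative penalty is discarded. -/
theorem sum_lintegral_renewalTime_le [Fintype N] [Fintype L] (hR : IsRenewalDefinition S C R)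
    {π : Policy S C} {ρ : Measure (Backlog N M L)} [IsProbabilityMeasure ρ]
    (hρ : ∀ᵐ θ ∂ρ, (∀ n, 0 ≤ θ.1 n) ∧ ∀ l, 0 ≤ θ.2.1 l) (hρL : Integrable lyapunov ρ)
    {c K : ℝ} (hd : HasFrameDrift R π ρ c K) (G : ℕ) :
    ∫⁻ p, ENNReal.ofReal (lyapunov (backlog S C.reg p (renewalTime R p G).toNat)) ∂π.law ρ +
      ENNReal.ofReal c * ∑ g ∈ Finset.range G, ∫⁻ p,
        ENNReal.ofReal (∑ n, (backlog S C.reg p (renewalTime R p g).toNat).1 n) ∂π.law ρ ≤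
    ENNReal.ofReal (∫ θ, lyapunov θ ∂ρ) + ENNReal.ofReal K * G := by
  induction G with
  | zero =>
    rw [← lintegral_initial π hρL]
    simp [renewalTime]
  | succ G ih =>
    have hm (s : ℕ) := measurableSet_renewalTime_eq hR.meas G s
    have htyp := ae_isTypical hR π ρ hρ
    have h1 : ∫⁻ p, ENNReal.ofReal
          (lyapunov (backlog S C.reg p (renewalTime R p (G + 1)).toNat)) ∂π.law ρ +
        ENNReal.ofReal c * ∫⁻ p,
          ENNReal.ofReal (∑ n, (backlog S C.reg p (renewalTime R p G).toNat).1 n) ∂π.law ρ ≤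
        ∫⁻ p, ENNReal.ofReal (lyapunov (backlog S C.reg p (renewalTime R p G).toNat)) ∂π.law ρ +
          ENNReal.ofReal K := by
      -- The constant is distributed over the possible values of `t_G`, whose probabilities add up
      -- to `1`.
      have e1 : ENNReal.ofReal K = ∑' s : ℕ, ENNReal.ofReal K *
          π.law ρ {p | renewalTime R p G = s} := by
        have := lintegral_eq_tsum_renewalTime hR (π := π) hρ G fun _ => ENNReal.ofReal K
        simpa only [setLIntegral_const, lintegral_const, measure_univ, mul_one,
          Measure.restrict_apply_univ] using this
      rw [lintegral_eq_tsum_renewalTime hR hρ G, lintegral_eq_tsum_renewalTime hR hρ G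
        (F := fun p => ENNReal.ofReal (∑ n, (backlog S C.reg p (renewalTime R p G).toNat).1 n)),
        lintegral_eq_tsum_renewalTime hR hρ G
        (F := fun p => ENNReal.ofReal (lyapunov (backlog S C.reg p (renewalTime R p G).toNat))),
        e1, ← ENNReal.tsum_mul_left, ← ENNReal.tsum_add, ← ENNReal.tsum_add]
      refine ENNReal.tsum_le_tsum fun s => ?_
      have hE' := pastSigma_le _ _ (hm s)
      have h2 := hd s {p | renewalTime R p G = s}
        (fun p hp => renewsAt_of_renewalTime_eq (hR.renewsAt_zero p) hp) (hm s)
      refine le_trans (add_le_add ?_ (le_of_eq ?_)) (h2.trans (le_of_eq ?_))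
      · refine lintegral_mono_ae ((ae_restrict_iff' hE').2 ?_)
        filter_upwards [htyp] with p hp hpE
        have h3 := frameNat_spec (hp.finite s (renewsAt_of_renewalTime_eq hp.zero hpE))
        have h4 : renewalTime R p (G + 1) = (s + frameNat R s p : ℕ) :=
          renewalTime_succ_eq_iff.2 ⟨s, Nat.le_add_right _ _, hpE, by
            rw [Nat.add_sub_cancel_left, h3.1]⟩
        rw [h4, ENat.toNat_natCast]
        refine ENNReal.ofReal_le_ofReal (le_add_of_nonneg_right ?_)
        have := penalty_nonneg hp ((Finset.range (frameNat R s p)).map (addLeftEmbedding s))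
        simpa only [Finset.sum_map, addLeftEmbedding_apply] using this
      · congr 1
        refine setLIntegral_congr_fun hE' fun p hpE => ?_
        rw [Set.mem_ofPred_eq] at hpE
        simp only [hpE, ENat.toNat_natCast]
      · congr 1
        refine setLIntegral_congr_fun hE' fun p hpE => ?_
        rw [Set.mem_ofPred_eq] at hpE
        simp only [hpE, ENat.toNat_natCast]
    rw [Finset.sum_range_succ, mul_add, ← add_assoc, add_right_comm]
    refine (add_le_add_left h1 _).trans ?_
    rw [add_right_comm]
    refine (add_le_add_left ih _).trans (le_of_eq ?_)
    push_cast
    ring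

end Law

section RateStability

variable {N M L W A Z : Type u} [MeasurableSpace W] [MeasurableSpace A] [MeasurableSpace Z]
  [Countable Z] [DiscreteMeasurableSpace Z] [Fintype M] [Fintype N] [Fintype L]
  {S : Network N M W A Z} {C : Program S L} {R : RenewalRule N M L W A Z}
  {π : Policy S C} {ρ : Measure (Backlog N M L)} [IsProbabilityMeasure ρ]

/-! ### Mean rate stability -/

/-- For general renewals the two compared policies may have different mean lengths; the uniform
bound `m₁` on both gives a crude `K`, and any finite `K` is enough for mean rate stability. No queue
term is retained, since ε is `0`. -/
theorem exists_hasFrameDrift (hR : IsRenewalDefinition S C R)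
    (hρ : ∀ᵐ θ ∂ρ, (∀ n, 0 ≤ θ.1 n) ∧ ∀ l, 0 ≤ θ.2.1 l)
    (hπ : SolvesShortestPath R π ρ) {B₂ : ℝ} (hB : IsDriftConstant R π B₂)
    {γ : M → ℝ} (hγ : Attains C R 0 γ) : ∃ K : ℝ, 0 ≤ K ∧ HasFrameDrift R π ρ 0 K := by
  obtain ⟨m₁, m₂, hm⟩ := hR.moments
  have hT : ∀ (π' : Policy S C) t, ∀ h ∈ R t,
      0 ≤ ∫ p, (frameNat R t p : ℝ) ∂π'.lawFrom t h ∧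
        ∫ p, (frameNat R t p : ℝ) ∂π'.lawFrom t h ≤ m₁ := fun π' t h hh => by
    refine ⟨by linarith [hR.one_le_integral_frameNat π' hh], ?_⟩
    rw [hR.integral_frameNat π' hh]
    exact ENNReal.toReal_le_coe_of_le_coe (hm π' t h hh).1
  refine ⟨B₂ + C.V * (|C.f γ| * m₁ + |C.fmin| * m₁), ?_, hasFrameDrift hR hρ hπ hB le_rfl hγ
    (fun π' t h hh => by simp) fun π' t h hh => ?_⟩
  · have := C.V_nonneg
    have := hB.1
    positivity
  · obtain ⟨h1, h2⟩ := hT π' t h hh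
    obtain ⟨h3, h4⟩ := hT π t h hh
    refine add_le_add le_rfl (mul_le_mul_of_nonneg_left ?_ C.V_nonneg)
    rw [sub_eq_add_neg, ← neg_mul]
    refine add_le_add ((mul_le_mul_of_nonneg_right (le_abs_self _) h1).trans
      (mul_le_mul_of_nonneg_left h2 (abs_nonneg _)))
      ((mul_le_mul_of_nonneg_right (neg_le_abs _) h3).trans
      (mul_le_mul_of_nonneg_left h4 (abs_nonneg _)))

/-- In one step the overshoot either decreases or, after a renewal at `t`, restarts below the length
of a new interval, adding at most `m₂`. The linear bound is crude but suffices, since only its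
square root matters. -/
theorem lintegral_nextRenewal_sub_sq_le (hR : IsRenewalDefinition S C R) {m₂ : ℝ≥0}
    (hm : ∀ t, ∀ h ∈ R t, ∫⁻ p, (frameLength R t p : ℝ≥0∞) ^ 2 ∂(π.lawFrom t h) ≤ m₂) (t : ℕ) :
    ∫⁻ p, ((nextRenewal R p t - t : ℕ) : ℝ≥0∞) ^ 2 ∂π.law ρ ≤ m₂ * t := by
  induction t with
  | zero => simp [nextRenewal]
  | succ t ih =>
    have hE := measurableSet_renewsAt hR.meas (R := R) (le_refl t)
    have hE' := pastSigma_le _ _ hE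
    rw [← lintegral_add_compl _ hE']
    have h1 : ∫⁻ p in {p | RenewsAt R p t},
        ((nextRenewal R p (t + 1) - (t + 1) : ℕ) : ℝ≥0∞) ^ 2 ∂π.law ρ ≤ m₂ := by
      calc ∫⁻ p in {p | RenewsAt R p t},
            ((nextRenewal R p (t + 1) - (t + 1) : ℕ) : ℝ≥0∞) ^ 2 ∂π.law ρ
          ≤ ∫⁻ p in {p | RenewsAt R p t}, (frameNat R t p : ℝ≥0∞) ^ 2 ∂π.law ρ := by
            refine setLIntegral_mono' hE' fun p hp => ?_
            rw [nextRenewal_succ_of_renewsAt hp]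
            gcongr
            lia
        _ = ∫⁻ p in {p | RenewsAt R p t}, ∫⁻ q, (frameNat R t q : ℝ≥0∞) ^ 2
              ∂π.lawFrom t (past t p) ∂π.law ρ :=
            (follows_law π ρ).setLIntegral (Nat.zero_le t) hE
              ((measurable_from_nat.comp (measurable_frameNat hR.meas t)).pow_const 2)
        _ ≤ ∫⁻ p in {p | RenewsAt R p t}, m₂ ∂π.law ρ := by
            refine setLIntegral_mono' hE' fun p hp => ?_
            rw [hR.lintegral_frameNat π hp]
            exact hm t _ hp
        _ ≤ m₂ := by
            rw [setLIntegral_const]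
            exact mul_le_of_le_one_right zero_le prob_le_one
    have h2 : ∫⁻ p in {p | RenewsAt R p t}ᶜ,
        ((nextRenewal R p (t + 1) - (t + 1) : ℕ) : ℝ≥0∞) ^ 2 ∂π.law ρ ≤ m₂ * t := by
      refine le_trans ?_ ((setLIntegral_le_lintegral {p | RenewsAt R p t}ᶜ _).trans ih)
      refine setLIntegral_mono' hE'.compl fun p hp => ?_
      rw [nextRenewal_succ_of_not hp]
      gcongr
      lia
    refine (add_le_add h1 h2).trans (le_of_eq ?_)
    push_cast
    ring

theorem lintegral_lyapunov_nextRenewal_le (hR : IsRenewalDefinition S C R)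
    (hρ : ∀ᵐ θ ∂ρ, (∀ n, 0 ≤ θ.1 n) ∧ ∀ l, 0 ≤ θ.2.1 l) (hρL : Integrable lyapunov ρ)
    {c K : ℝ} (hd : HasFrameDrift R π ρ c K) (t : ℕ) :
    ∫⁻ p, ENNReal.ofReal (lyapunov (backlog S C.reg p (nextRenewal R p t))) ∂π.law ρ ≤
      ENNReal.ofReal (∫ θ, lyapunov θ ∂ρ) + ENNReal.ofReal K * t := by
  have h1 := (le_add_of_nonneg_right zero_le).trans (lintegral_potential_le hR hρ hρL hd t)
  refine (lintegral_mono_ae ?_).trans (h1.trans (add_le_add_right (mul_le_mul_right ?_ _) _))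
  · filter_upwards [ae_isTypical hR π ρ hρ] with p hp
    exact ENNReal.ofReal_le_ofReal (le_add_of_nonneg_right (penalty_nonneg hp _))
  · simpa using Finset.sum_le_sum (s := Finset.range t)
      fun s _ => (prob_le_one : π.law ρ {p | RenewsAt R p s} ≤ 1)

theorem tendsto_ofReal_div_sqrt (D : ℝ) :
    Tendsto (fun t : ℕ => ENNReal.ofReal (D / √t)) atTop (𝓝 0) := by
  have h1 : Tendsto (fun t : ℕ => D / √(t : ℝ)) atTop (𝓝 0) :=
    (Real.tendsto_sqrt_atTop.comp tendsto_natCast_atTop_atTop).const_div_atTop D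
  simpa using ENNReal.tendsto_ofReal h1

/-- A process dominated by the square root of the Lyapunov function is mean rate stable. -/
theorem tendsto_lintegral_div (hR : IsRenewalDefinition S C R)
    (hρ : ∀ᵐ θ ∂ρ, (∀ n, 0 ≤ θ.1 n) ∧ ∀ l, 0 ≤ θ.2.1 l) (hρL : Integrable lyapunov ρ)
    {c K : ℝ} (hK : 0 ≤ K) (hd : HasFrameDrift R π ρ c K) {g : ℕ → Path N M L W A Z → ℝ} {b : ℝ}
    (hg : ∀ᵐ p ∂π.law ρ, ∀ t, |g (t + 1) p - g t p| ≤ b ∧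
      g t p ^ 2 ≤ 2 * lyapunov (backlog S C.reg p t)) :
    Tendsto (fun t : ℕ => (∫⁻ p, ‖g t p‖ₑ ∂π.law ρ) / (t : ℝ≥0∞)) atTop (𝓝 0) := by
  obtain ⟨m₁, m₂, hm⟩ := hR.moments
  have ha₀ : 0 ≤ ∫ θ, lyapunov θ ∂ρ := integral_nonneg lyapunov_nonneg
  set a₀ := ∫ θ, lyapunov θ ∂ρ
  have hb : 0 ≤ b := by
    obtain ⟨p, hp⟩ := hg.exists
    exact (abs_nonneg _).trans (hp 0).1
  -- In the constant, `2(a₀ + K)` comes from the Lyapunov function (using `a₀ ≤ a₀ t`), `b m₂` from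
  -- the overshoot, and `1 + b` from the two remainders `√t` produced by `hamgm`.
  refine tendsto_of_tendsto_of_tendsto_of_le_of_le' tendsto_const_nhds
    (tendsto_ofReal_div_sqrt (2 * (a₀ + K) + b * m₂ + (1 + b)))
    (Eventually.of_forall fun _ => zero_le) ?_
  filter_upwards [eventually_ge_atTop 1] with t ht
  have ht1 : (1 : ℝ) ≤ t := by exact_mod_cast ht
  have hs : 0 < √(t : ℝ) := Real.sqrt_pos.2 (by linarith)
  have hss : √(t : ℝ) * √(t : ℝ) = t := Real.mul_self_sqrt (by linarith)
  -- A pathwise substitute for Cauchy-Schwarz, scaled so that a second moment of order `t` gives a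
  -- first moment of order `√t`.
  have hamgm : ∀ x : ℝ, x ≤ x ^ 2 / √(t : ℝ) + √(t : ℝ) := fun x => by
    have : x * √(t : ℝ) ≤ x ^ 2 + √(t : ℝ) * √(t : ℝ) := by
      nlinarith [sq_nonneg (x - √(t : ℝ)), sq_nonneg (x + √(t : ℝ))]
    calc x = x * √(t : ℝ) / √(t : ℝ) := by field_simp
      _ ≤ (x ^ 2 + √(t : ℝ) * √(t : ℝ)) / √(t : ℝ) := by gcongr
      _ = _ := by field_simp
  have hpt : ∀ᵐ p ∂π.law ρ, ‖g t p‖ₑ ≤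
      ENNReal.ofReal (2 / √(t : ℝ)) *
        ENNReal.ofReal (lyapunov (backlog S C.reg p (nextRenewal R p t))) +
      ENNReal.ofReal (b / √(t : ℝ)) * ((nextRenewal R p t - t : ℕ) : ℝ≥0∞) ^ 2 +
      ENNReal.ofReal ((1 + b) * √(t : ℝ)) := by
    filter_upwards [hg, ae_isTypical hR π ρ hρ] with p hp htyp
    have h1 := abs_le_abs_add_of_step (g := fun τ => g τ p) (s := t) (fun τ _ => (hp τ).1)
      (nextRenewal_spec htyp.zero htyp.finite t).1
    have h2 := (hp (nextRenewal R p t)).2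
    set x := |g (nextRenewal R p t) p| with hx
    set k := nextRenewal R p t - t
    have h3 : x ≤ 2 * lyapunov (backlog S C.reg p (nextRenewal R p t)) / √(t : ℝ) + √(t : ℝ) :=
      (hamgm x).trans (add_le_add_left (div_le_div_of_nonneg_right
        (by rw [hx, sq_abs]; exact h2) hs.le) _)
    have h4 := mul_le_mul_of_nonneg_left (hamgm k) hb
    rw [← ofReal_norm, Real.norm_eq_abs, ← ENNReal.ofReal_mul (by positivity),
      ← ENNReal.ofReal_natCast, ← ENNReal.ofReal_pow (by positivity),
      ← ENNReal.ofReal_mul (by positivity),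
      ← ENNReal.ofReal_add (mul_nonneg (by positivity) (lyapunov_nonneg _)) (by positivity),
      ← ENNReal.ofReal_add (add_nonneg (mul_nonneg (by positivity) (lyapunov_nonneg _))
        (by positivity)) (by positivity)]
    refine ENNReal.ofReal_le_ofReal ?_
    have e1 : 2 / √(t : ℝ) * lyapunov (backlog S C.reg p (nextRenewal R p t)) =
        2 * lyapunov (backlog S C.reg p (nextRenewal R p t)) / √(t : ℝ) := by ring
    have e2 : b / √(t : ℝ) * (k : ℝ) ^ 2 = b * ((k : ℝ) ^ 2 / √(t : ℝ)) := by ring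
    rw [e1, e2]
    linarith
  have m1 : Measurable fun p : Path N M L W A Z =>
      ENNReal.ofReal (lyapunov (backlog S C.reg p (nextRenewal R p t))) :=
    (measurable_comp_nat (measurable_nextRenewal hR.meas t)
      fun k => (measurable_lyapunov_backlog k).mono (pastSigma_le _) le_rfl).ennreal_ofReal
  have m2 : Measurable fun p : Path N M L W A Z =>
      ((nextRenewal R p t - t : ℕ) : ℝ≥0∞) ^ 2 :=
    (measurable_from_nat (f := fun k : ℕ => ((k - t : ℕ) : ℝ≥0∞) ^ 2)).comp
      (measurable_nextRenewal hR.meas t)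
  have hI : ∫⁻ p, ‖g t p‖ₑ ∂π.law ρ ≤
      ENNReal.ofReal (2 / √(t : ℝ)) * (ENNReal.ofReal a₀ + ENNReal.ofReal K * t) +
      ENNReal.ofReal (b / √(t : ℝ)) * (m₂ * t) + ENNReal.ofReal ((1 + b) * √(t : ℝ)) := by
    refine (lintegral_mono_ae hpt).trans ?_
    rw [lintegral_add_right _ measurable_const, lintegral_add_right _ (m2.const_mul _),
      lintegral_const_mul _ m1, lintegral_const_mul _ m2, lintegral_const, measure_univ, mul_one]
    gcongr
    · exact lintegral_lyapunov_nextRenewal_le hR hρ hρL hd t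
    · exact lintegral_nextRenewal_sub_sq_le hR (fun t h hh => (hm π t h hh).2) t
  rw [← ENNReal.ofReal_natCast, ← ENNReal.ofReal_coe_nnreal, ← ENNReal.ofReal_mul hK,
    ← ENNReal.ofReal_add ha₀ (by positivity), ← ENNReal.ofReal_mul (by positivity),
    ← ENNReal.ofReal_mul (by positivity), ← ENNReal.ofReal_mul (by positivity),
    ← ENNReal.ofReal_add (by positivity) (by positivity),
    ← ENNReal.ofReal_add (by positivity) (by positivity)] at hI
  refine (ENNReal.div_le_div_right hI _).trans ?_
  rw [← ENNReal.ofReal_natCast, ← ENNReal.ofReal_div_of_pos (by linarith)]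
  refine ENNReal.ofReal_le_ofReal ?_
  have h5 : (2 * (a₀ + K) + b * m₂ + (1 + b)) / √(t : ℝ) =
      (2 / √(t : ℝ) * (a₀ * t + K * t) + b / √(t : ℝ) * (m₂ * t) + (1 + b) * √(t : ℝ)) / t := by
    have : (1 + b) / √(t : ℝ) = (1 + b) * √(t : ℝ) / t := by
      rw [div_eq_div_iff hs.ne' (by linarith), mul_assoc, hss]
    rw [add_div, this]
    field_simp
  rw [h5]
  gcongr
  exact le_mul_of_one_le_right ha₀ ht1

theorem tendsto_queue_div (hR : IsRenewalDefinition S C R)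
    (hρ : ∀ᵐ θ ∂ρ, (∀ n, 0 ≤ θ.1 n) ∧ ∀ l, 0 ≤ θ.2.1 l) (hρL : Integrable lyapunov ρ)
    {c K : ℝ} (hK : 0 ≤ K) (hd : HasFrameDrift R π ρ c K) (n : N) :
    Tendsto (fun t : ℕ => (∫⁻ p, ‖(backlog S C p t).1 n‖ₑ ∂(π.law ρ)) / (t : ℝ≥0∞))
      atTop (𝓝 0) := by
  refine tendsto_lintegral_div hR hρ hρL hK hd (b := S.μmax n + S.Rmax n) ?_
  filter_upwards [ae_isTypical hR π ρ hρ] with p hp t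
  refine ⟨abs_queue_step_le (hp.admissible t) n ?_, ?_⟩
  · rw [hp.backlog_eq]
    exact (hp.nonneg t).1 n
  · rw [hp.backlog_eq]
    exact (sq_le_two_mul_lyapunov _).1 n

theorem tendsto_virtual_div (hR : IsRenewalDefinition S C R)
    (hρ : ∀ᵐ θ ∂ρ, (∀ n, 0 ≤ θ.1 n) ∧ ∀ l, 0 ≤ θ.2.1 l) (hρL : Integrable lyapunov ρ)
    {c K : ℝ} (hK : 0 ≤ K) (hd : HasFrameDrift R π ρ c K) (l : L) :
    Tendsto (fun t : ℕ => (∫⁻ p, ‖(backlog S C p t).2.1 l‖ₑ ∂(π.law ρ)) / (t : ℝ≥0∞))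
      atTop (𝓝 0) := by
  obtain ⟨b, hb⟩ := C.exists_bound_h l
  refine tendsto_lintegral_div hR hρ hρL hK hd (b := |C.c l| + b) ?_
  filter_upwards [ae_isTypical hR π ρ hρ] with p hp t
  refine ⟨abs_virtual_step_le hb (hp.admissible t).1 ?_, ?_⟩
  · rw [hp.backlog_eq]
    exact (hp.nonneg t).2 l
  · rw [hp.backlog_eq]
    exact (sq_le_two_mul_lyapunov _).2.1 l

theorem tendsto_balance_div (hR : IsRenewalDefinition S C R)
    (hρ : ∀ᵐ θ ∂ρ, (∀ n, 0 ≤ θ.1 n) ∧ ∀ l, 0 ≤ θ.2.1 l) (hρL : Integrable lyapunov ρ)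
    {c K : ℝ} (hK : 0 ≤ K) (hd : HasFrameDrift R π ρ c K) (m : M) :
    Tendsto (fun t : ℕ => (∫⁻ p, ‖(backlog S C p t).2.2 m‖ₑ ∂(π.law ρ)) / (t : ℝ≥0∞))
      atTop (𝓝 0) := by
  refine tendsto_lintegral_div hR hρ hρL hK hd (b := S.xmax m - S.xmin m + C.α) ?_
  filter_upwards [ae_isTypical hR π ρ hρ] with p hp t
  constructor
  · have h1 := abs_aux_sub_le (hp.admissible t) m
    rw [abs_sub_comm] at h1
    have h2 : (backlog S C p (t + 1)).2.2 m - (backlog S C p t).2.2 m =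
        S.xhat m (point S p t) - aux p t m := by
      simp only [backlog]
      ring
    rwa [h2]
  · rw [hp.backlog_eq]
    exact (sq_le_two_mul_lyapunov _).2.2 m

end RateStability

section TimeAverages

variable {N M L W A Z : Type u} [MeasurableSpace W] [MeasurableSpace A] [MeasurableSpace Z]
  [Countable Z] [DiscreteMeasurableSpace Z] [Fintype M] [Fintype N] [Fintype L]
  {S : Network N M W A Z} {C : Program S L} {R : RenewalRule N M L W A Z}
  {π : Policy S C} {ρ : Measure (Backlog N M L)} [IsProbabilityMeasure ρ]

/-! ### Time averages -/

theorem limsup_coe_le {u v : ℕ → ℝ} {a : ℝ} (huv : ∀ᶠ t in atTop, u t ≤ v t)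
    (hv : Tendsto v atTop (𝓝 a)) : limsup (fun t => (u t : EReal)) atTop ≤ (a : EReal) := by
  have h1 : Tendsto (fun t => (v t : EReal)) atTop (𝓝 (a : EReal)) :=
    (continuous_coe_real_ereal.tendsto a).comp hv
  rw [← h1.limsup_eq]
  exact limsup_le_limsup (huv.mono fun t ht => EReal.coe_le_coe_iff.2 ht)

/-- The expected time average of the auxiliary vectors. -/
noncomputable def avgAux (π : Policy S C) (ρ : Measure (Backlog N M L)) (t : ℕ) : M → ℝ :=
  ∑ τ ∈ Finset.range t, (1 / (t : ℝ)) • ∫ p, aux p τ ∂π.law ρ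

theorem integrable_aux_apply (π : Policy S C) (ρ : Measure (Backlog N M L))
    [IsProbabilityMeasure ρ] (τ : ℕ) (m : M) :
    Integrable (fun p => aux p τ m) (π.law ρ) := by
  obtain ⟨b, hb⟩ := exists_abs_le_of_mem_Icc (S.xmin m - C.α) (S.xmax m + C.α)
  refine Integrable.of_bound ((measurable_pi_apply m).comp ((measurable_aux τ.lt_succ_self).mono
    (pastSigma_le _) le_rfl)).aestronglyMeasurable b ?_
  filter_upwards [(follows_law π ρ).ae_admissible] with p hp
  exact hb _ ((hp τ τ.zero_le).1 m).1 ((hp τ τ.zero_le).1 m).2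

theorem integrable_xhat (π : Policy S C) (ρ : Measure (Backlog N M L))
    [IsProbabilityMeasure ρ] (τ : ℕ) (m : M) :
    Integrable (fun p => S.xhat m (point S p τ)) (π.law ρ) := by
  obtain ⟨b, hb⟩ := exists_abs_le_of_mem_Icc (S.xmin m) (S.xmax m)
  refine Integrable.of_bound ((S.xhat_meas m).comp ((measurable_point S τ.lt_succ_self).mono
    (pastSigma_le _) le_rfl)).aestronglyMeasurable b ?_
  filter_upwards [(follows_law π ρ).ae_admissible] with p hp
  exact hb _ ((hp τ τ.zero_le).2.2.2 m).1 ((hp τ τ.zero_le).2.2.2 m).2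

theorem integrable_comp_aux (π : Policy S C) (ρ : Measure (Backlog N M L))
    [IsProbabilityMeasure ρ] {g : (M → ℝ) → ℝ} (hg : ContinuousOn g (S.box C.α)) (τ : ℕ) :
    Integrable (fun p => g (aux p τ)) (π.law ρ) := by
  obtain ⟨b, hb⟩ := (isCompact_box S C.α).exists_bound_of_continuousOn hg
  have hadm := (follows_law π ρ).ae_admissible
  have hm : Measurable fun p : Path N M L W A Z => (S.box C.α).indicator g (aux p τ) :=
    (measurable_indicator_of_continuousOn (measurableSet_box S _) hg).comp
      ((measurable_aux τ.lt_succ_self).mono (pastSigma_le _) le_rfl)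
  refine Integrable.of_bound (hm.aestronglyMeasurable.congr ?_) b ?_
  · filter_upwards [hadm] with p hp
    exact Set.indicator_of_mem (hp τ τ.zero_le).1 _
  · filter_upwards [hadm] with p hp
    exact hb _ (hp τ τ.zero_le).1

theorem integral_aux_mem_box (π : Policy S C) (ρ : Measure (Backlog N M L))
    [IsProbabilityMeasure ρ] (τ : ℕ) : ∫ p, aux p τ ∂π.law ρ ∈ S.box C.α :=
  (convex_box S _).integral_mem (isCompact_box S _).isClosed
    ((follows_law π ρ).ae_admissible.mono fun _ hp => (hp τ τ.zero_le).1)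
    (Integrable.of_eval fun m => integrable_aux_apply π ρ τ m)

theorem sum_weights {t : ℕ} (ht : 1 ≤ t) : ∑ _τ ∈ Finset.range t, 1 / (t : ℝ) = 1 := by
  have : (t : ℝ) ≠ 0 := by
    have : (1 : ℝ) ≤ t := by exact_mod_cast ht
    linarith
  simp [this]

theorem avgAux_mem_box (π : Policy S C) (ρ : Measure (Backlog N M L))
    [IsProbabilityMeasure ρ] {t : ℕ} (ht : 1 ≤ t) : avgAux π ρ t ∈ S.box C.α :=
  (convex_box S _).sum_mem (fun _ _ => by positivity) (sum_weights ht)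
    fun τ _ => integral_aux_mem_box π ρ τ

/-- Jensen's inequality is used twice: for the average over time and for the expectation in each
slot. Continuity on the closed box supplies the regularity that the second use needs. -/
theorem convex_avgAux_le (π : Policy S C) (ρ : Measure (Backlog N M L))
    [IsProbabilityMeasure ρ] {g : (M → ℝ) → ℝ} (hg : ConvexOn ℝ (S.box C.α) g)
    (hgc : ContinuousOn g (S.box C.α)) {t : ℕ} (ht : 1 ≤ t) :
    g (avgAux π ρ t) ≤ (1 / (t : ℝ)) * ∑ τ ∈ Finset.range t, ∫ p, g (aux p τ) ∂π.law ρ := by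
  refine (hg.map_sum_le (fun _ _ => by positivity) (sum_weights ht)
    fun τ _ => integral_aux_mem_box π ρ τ).trans ?_
  rw [Finset.mul_sum]
  refine Finset.sum_le_sum fun τ _ => ?_
  rw [smul_eq_mul]
  refine mul_le_mul_of_nonneg_left ?_ (by positivity)
  exact hg.map_integral_le hgc (isCompact_box S _).isClosed
    ((follows_law π ρ).ae_admissible.mono fun _ hp => (hp τ τ.zero_le).1)
    (Integrable.of_eval fun m => integrable_aux_apply π ρ τ m) (integrable_comp_aux π ρ hgc τ)

theorem avgPenalty_mem_box (π : Policy S C) (ρ : Measure (Backlog N M L))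
    [IsProbabilityMeasure ρ] {t : ℕ} (ht : 1 ≤ t) : avgPenalty π ρ t ∈ S.box C.α := by
  have h : ∀ τ m, S.xmin m ≤ ∫ p, S.xhat m (point S p τ) ∂π.law ρ ∧
      ∫ p, S.xhat m (point S p τ) ∂π.law ρ ≤ S.xmax m := fun τ m => by
    have h1 := (convex_Icc (S.xmin m) (S.xmax m)).integral_mem isClosed_Icc
      ((follows_law π ρ).ae_admissible.mono fun p hp => (hp τ τ.zero_le).2.2.2 m)
      (integrable_xhat π ρ τ m)
    exact h1
  have hα := C.α_nonneg
  intro m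
  have h1 := (convex_Icc (S.xmin m) (S.xmax m)).sum_mem (t := Finset.range t)
    (w := fun _ => 1 / (t : ℝ)) (fun _ _ => by positivity) (sum_weights ht)
    (z := fun τ => ∫ p, S.xhat m (point S p τ) ∂π.law ρ) fun τ _ => h τ m
  simp only [smul_eq_mul, ← Finset.mul_sum] at h1
  change S.xmin m - C.α ≤ (1 / (t : ℝ)) * _ ∧ (1 / (t : ℝ)) * _ ≤ S.xmax m + C.α
  exact ⟨by linarith [h1.1], by linarith [h1.2]⟩

theorem balance_eq (p : Path N M L W A Z) (m : M) (t : ℕ) :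
    ∑ τ ∈ Finset.range t, (S.xhat m (point S p τ) - aux p τ m) =
      (backlog S C p t).2.2 m - (backlog S C p 0).2.2 m := by
  induction t with
  | zero => simp
  | succ t ih =>
    rw [Finset.sum_range_succ, ih]
    simp only [backlog]
    ring

/-- Dropping the reflection in each update only lowers the right-hand side, and the initial value is
nonnegative. -/
theorem sum_le_virtual {p : Path N M L W A Z} (l : L) (h0 : 0 ≤ (backlog S C p 0).2.1 l) (t : ℕ) :
    ∑ τ ∈ Finset.range t, (C.h l (aux p τ) - C.c l) ≤ (backlog S C p t).2.1 l := by
  induction t with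
  | zero => simpa using h0
  | succ t ih =>
    rw [Finset.sum_range_succ]
    refine le_trans ?_ (le_max_left _ _)
    linarith

theorem lintegral_initial_balance_lt_top (hR : IsRenewalDefinition S C R)
    (hρ : ∀ᵐ θ ∂ρ, (∀ n, 0 ≤ θ.1 n) ∧ ∀ l, 0 ≤ θ.2.1 l) (hρL : Integrable lyapunov ρ) (m : M) :
    ∫⁻ p, ‖(backlog S C p 0).2.2 m‖ₑ ∂π.law ρ ≠ ⊤ := by
  have hL : Measurable fun p : Path N M L W A Z =>
      ENNReal.ofReal (lyapunov (backlog S C.reg p 0)) :=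
    ((measurable_lyapunov_backlog 0).mono (pastSigma_le _) le_rfl).ennreal_ofReal
  have h1 : ∫⁻ p, ‖(backlog S C p 0).2.2 m‖ₑ ∂π.law ρ ≤
      ∫⁻ p, (1 + 2 * ENNReal.ofReal (lyapunov (backlog S C.reg p 0))) ∂π.law ρ := by
    refine lintegral_mono_ae ?_
    filter_upwards [ae_isTypical hR π ρ hρ] with p hp
    rw [hp.backlog_eq]
    have h2 := (sq_le_two_mul_lyapunov (backlog S C.reg p 0)).2.2 m
    have h3 := lyapunov_nonneg (backlog S C.reg p 0)
    rw [← ofReal_norm, Real.norm_eq_abs, ← ENNReal.ofReal_ofNat, ← ENNReal.ofReal_mul (by norm_num),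
      ← ENNReal.ofReal_one, ← ENNReal.ofReal_add zero_le_one (by positivity)]
    refine ENNReal.ofReal_le_ofReal ?_
    rw [← sq_abs] at h2
    nlinarith [sq_nonneg (|(backlog S C.reg p 0).2.2 m| - 1),
      abs_nonneg ((backlog S C.reg p 0).2.2 m)]
  refine ne_top_of_le_ne_top ?_ h1
  rw [lintegral_add_left measurable_const, lintegral_const_mul _ hL, lintegral_initial π hρL]
  exact ENNReal.add_ne_top.2 ⟨by simp, ENNReal.mul_ne_top (by simp) ENNReal.ofReal_ne_top⟩

theorem avgPenalty_sub_avgAux (π : Policy S C) (ρ : Measure (Backlog N M L))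
    [IsProbabilityMeasure ρ] (t : ℕ) (m : M) :
    avgPenalty π ρ t m - avgAux π ρ t m = (1 / (t : ℝ)) *
      ∫ p, ((backlog S C p t).2.2 m - (backlog S C p 0).2.2 m) ∂π.law ρ := by
  have h1 : avgAux π ρ t m = (1 / (t : ℝ)) * ∑ τ ∈ Finset.range t, ∫ p, aux p τ m ∂π.law ρ := by
    rw [avgAux, Finset.sum_apply, Finset.mul_sum]
    refine Finset.sum_congr rfl fun τ _ => ?_
    rw [Pi.smul_apply, smul_eq_mul, eval_integral fun m => integrable_aux_apply π ρ τ m]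
  simp only [← balance_eq]
  have h2 : ∀ τ, Integrable (fun p => S.xhat m (point S p τ) - aux p τ m) (π.law ρ) :=
    fun τ => (integrable_xhat π ρ τ m).sub (integrable_aux_apply π ρ τ m)
  rw [h1, avgPenalty, ← mul_sub, ← Finset.sum_sub_distrib, integral_finsetSum _ fun τ _ => h2 τ]
  congr 1
  exact Finset.sum_congr rfl fun τ _ =>
    (integral_sub (integrable_xhat π ρ τ m) (integrable_aux_apply π ρ τ m)).symm

/-- Each component of the difference is `(E W_m(t) - E W_m(0)) / t`. The first part vanishes by rate
stability, the second because the finite Lyapunov mean makes `W_m(0)` integrable. -/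
theorem tendsto_avgPenalty_sub_avgAux (hR : IsRenewalDefinition S C R)
    (hρ : ∀ᵐ θ ∂ρ, (∀ n, 0 ≤ θ.1 n) ∧ ∀ l, 0 ≤ θ.2.1 l) (hρL : Integrable lyapunov ρ)
    (hW : ∀ m, Tendsto (fun t : ℕ => (∫⁻ p, ‖(backlog S C p t).2.2 m‖ₑ ∂(π.law ρ)) / (t : ℝ≥0∞))
      atTop (𝓝 0)) :
    Tendsto (fun t => ‖WithLp.toLp 2 (avgPenalty π ρ t - avgAux π ρ t)‖) atTop (𝓝 0) := by
  have h1 : Tendsto (fun t => avgPenalty π ρ t - avgAux π ρ t) atTop (𝓝 0) := by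
    refine tendsto_pi_nhds.2 fun m => ?_
    rw [Pi.zero_apply, tendsto_zero_iff_enorm_tendsto_zero]
    have h2 : Tendsto (fun t : ℕ => (∫⁻ p, ‖(backlog S C p t).2.2 m‖ₑ ∂(π.law ρ)) / (t : ℝ≥0∞) +
        (∫⁻ p, ‖(backlog S C p 0).2.2 m‖ₑ ∂(π.law ρ)) / (t : ℝ≥0∞)) atTop (𝓝 0) := by
      have h3 := ENNReal.Tendsto.const_div ENNReal.tendsto_nat_nhds_top
        (Or.inr (lintegral_initial_balance_lt_top (π := π) hR hρ hρL m))
      rw [ENNReal.div_top] at h3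
      simpa using (hW m).add h3
    refine tendsto_of_tendsto_of_tendsto_of_le_of_le' tendsto_const_nhds h2
      (Eventually.of_forall fun _ => zero_le) ?_
    filter_upwards [eventually_ge_atTop 1] with t ht
    have ht0 : (0 : ℝ) < t := by exact_mod_cast ht
    rw [Pi.sub_apply, avgPenalty_sub_avgAux, enorm_mul, ← ENNReal.add_div, ENNReal.div_eq_inv_mul]
    have h4 : ‖1 / (t : ℝ)‖ₑ = (t : ℝ≥0∞)⁻¹ := by
      rw [Real.enorm_of_nonneg (by positivity), one_div, ENNReal.ofReal_inv_of_pos ht0,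
        ENNReal.ofReal_natCast]
    rw [h4]
    refine mul_le_mul_right ((enorm_integral_le_lintegral_enorm _).trans ?_) _
    have hW0 : Measurable fun p : Path N M L W A Z => ‖(backlog S C.reg p 0).2.2 m‖ₑ :=
      (((measurable_backlog (S := S) C.measurable_reg_h 0).2.2 m).mono (pastSigma_le _)
        le_rfl).enorm
    have h5 : (fun p : Path N M L W A Z => ‖(backlog S C p 0).2.2 m‖ₑ) =
      fun p => ‖(backlog S C.reg p 0).2.2 m‖ₑ := rfl
    rw [← lintegral_add_right _ (h5 ▸ hW0)]
    exact lintegral_mono fun p => enorm_sub_le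
  have h2 : Continuous fun γ : M → ℝ => ‖WithLp.toLp 2 γ‖ := (PiLp.continuous_toLp 2 _).norm
  have h3 := (h2.tendsto 0).comp h1
  simp only [WithLp.toLp_zero, norm_zero] at h3
  exact h3

/-- Jensen's inequality applies to the auxiliary average; the Lipschitz bound moves the conclusion
to the penalty average, at the price of a term that tends to `0`. -/
theorem comp_avgPenalty_le (π : Policy S C) (ρ : Measure (Backlog N M L))
    [IsProbabilityMeasure ρ] {g : (M → ℝ) → ℝ} (hg : ConvexOn ℝ (S.box C.α) g) {β : ℝ}
    (hl : ∀ γ ∈ S.box C.α, ∀ γ' ∈ S.box C.α, |g γ - g γ'| ≤ β * ‖WithLp.toLp 2 (γ - γ')‖)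
    {t : ℕ} (ht : 1 ≤ t) :
    g (avgPenalty π ρ t) ≤ (1 / (t : ℝ)) * ∑ τ ∈ Finset.range t, ∫ p, g (aux p τ) ∂π.law ρ +
      β * ‖WithLp.toLp 2 (avgPenalty π ρ t - avgAux π ρ t)‖ := by
  have h1 := convex_avgAux_le π ρ hg (continuousOn_of_lipschitz hl) ht
  have h2 := (le_abs_self _).trans
    (hl _ (avgPenalty_mem_box π ρ ht) _ (avgAux_mem_box π ρ ht))
  linarith

/-- The constraints hold for the limiting time averages. -/
theorem limsup_h_avgPenalty_le (hR : IsRenewalDefinition S C R)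
    (hρ : ∀ᵐ θ ∂ρ, (∀ n, 0 ≤ θ.1 n) ∧ ∀ l, 0 ≤ θ.2.1 l)
    (hd : Tendsto (fun t => ‖WithLp.toLp 2 (avgPenalty π ρ t - avgAux π ρ t)‖) atTop (𝓝 0))
    (l : L)
    (hY : Tendsto (fun t : ℕ => (∫⁻ p, ‖(backlog S C p t).2.1 l‖ₑ ∂(π.law ρ)) / (t : ℝ≥0∞))
      atTop (𝓝 0)) :
    limsup (fun t : ℕ => ((C.h l (avgPenalty π ρ t) : ℝ) : EReal)) atTop ≤
      ((C.c l : ℝ) : EReal) := by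
  have h1 : Tendsto (fun t : ℕ => C.c l +
      ((∫⁻ p, ‖(backlog S C p t).2.1 l‖ₑ ∂(π.law ρ)) / (t : ℝ≥0∞)).toReal +
      C.β * ‖WithLp.toLp 2 (avgPenalty π ρ t - avgAux π ρ t)‖) atTop (𝓝 (C.c l)) := by
    have h2 := (ENNReal.tendsto_toReal ENNReal.zero_ne_top).comp hY
    simpa using (h2.const_add (C.c l)).add (hd.const_mul C.β)
  refine limsup_coe_le ?_ h1
  -- Rate stability in `ℝ≥0∞` makes the mean of `Y_l(t)` finite for all large `t`, which legitimizes
  -- the passage to real numbers.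
  filter_upwards [eventually_ge_atTop 1, hY.eventually (gt_mem_nhds ENNReal.zero_lt_top)]
    with t ht hfin
  have ht0 : (0 : ℝ) < t := by exact_mod_cast ht
  refine (comp_avgPenalty_le π ρ (C.h_convex l) (C.h_lip l) ht).trans (add_le_add_left ?_ _)
  have hfin' : ∫⁻ p, ‖(backlog S C p t).2.1 l‖ₑ ∂(π.law ρ) ≠ ⊤ := fun h => by
    rw [h, ENNReal.top_div_of_ne_top (ENNReal.natCast_ne_top t)] at hfin
    exact lt_irrefl _ hfin
  have i1 := fun τ => integrable_comp_aux π ρ (C.continuousOn_h l) τ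
  have i0 : ∀ τ, Integrable (fun p => C.h l (aux p τ) - C.c l) (π.law ρ) :=
    fun τ => (i1 τ).sub (integrable_const _)
  have i2 : Integrable (fun p => ∑ τ ∈ Finset.range t, (C.h l (aux p τ) - C.c l)) (π.law ρ) :=
    integrable_finsetSum _ fun τ _ => i0 τ
  have h3 : ∫ p, ∑ τ ∈ Finset.range t, (C.h l (aux p τ) - C.c l) ∂π.law ρ ≤
      (∫⁻ p, ‖(backlog S C p t).2.1 l‖ₑ ∂(π.law ρ)).toReal := by
    -- Since `Y_l(t) ≥ 0`, it dominates the positive part of the accumulated violation, whose mean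
    -- is a nonnegative integral comparable in `ℝ≥0∞`.
    have i3 := i2.pos_part
    refine (integral_mono i2 i3 fun p => le_max_left _ _).trans ?_
    have i4 : 0 ≤ᵐ[π.law ρ] fun p =>
        max (∑ τ ∈ Finset.range t, (C.h l (aux p τ) - C.c l)) 0 :=
      ae_of_all _ fun p => le_max_right _ _
    rw [integral_eq_lintegral_of_nonneg_ae i4 i3.1]
    refine ENNReal.toReal_mono hfin' (lintegral_mono_ae ?_)
    filter_upwards [ae_isTypical hR π ρ hρ] with p hp
    have h4 : ∀ s, 0 ≤ (backlog S C p s).2.1 l := fun s => by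
      rw [hp.backlog_eq]
      exact (hp.nonneg s).2 l
    rw [Real.enorm_of_nonneg (h4 t)]
    exact ENNReal.ofReal_le_ofReal (max_le (sum_le_virtual l (h4 0) t) (h4 t))
  rw [integral_finsetSum _ fun τ _ => i0 τ] at h3
  have h5 : ∀ τ, ∫ p, (C.h l (aux p τ) - C.c l) ∂π.law ρ =
      ∫ p, C.h l (aux p τ) ∂π.law ρ - C.c l := fun τ => by
    rw [integral_sub (i1 τ) (integrable_const _)]
    simp
  simp only [h5, Finset.sum_sub_distrib, Finset.sum_const, Finset.card_range, nsmul_eq_mul] at h3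
  rw [ENNReal.toReal_div, ENNReal.toReal_natCast, one_div, inv_mul_le_iff₀ ht0, mul_add,
    mul_div_cancel₀ _ ht0.ne']
  linarith

end TimeAverages

section TypeTwo

variable {N M L W A Z : Type u} [MeasurableSpace W] [MeasurableSpace A] [MeasurableSpace Z]
  [Countable Z] [DiscreteMeasurableSpace Z] [Fintype M] [Fintype N] [Fintype L]
  {S : Network N M W A Z} {C : Program S L}
  {π : Policy S C} {ρ : Measure (Backlog N M L)} [IsProbabilityMeasure ρ]

/-! ### Forced renewals only -/

theorem Network.φ_real_pos (S : Network N M W A Z) : (0 : ℝ) < S.φ := S.φ_pos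

theorem integral_frameNat_typeTwo (hR : IsRenewalDefinition S C (typeTwoRenewals S))
    (π : Policy S C) {t : ℕ} {h : Hist N M L W A Z t} (hh : h ∈ typeTwoRenewals S t) :
    ∫ p, (frameNat (typeTwoRenewals S) t p : ℝ) ∂π.lawFrom t h = 1 / S.φ := by
  have h1 := congrArg ENNReal.toReal (lintegral_frameLength_typeTwo hR π hh)
  rw [ENNReal.toReal_mul, ENNReal.toReal_ofReal S.φ_real_pos.le, ← hR.integral_frameNat π hh,
    ENNReal.toReal_one] at h1
  rw [eq_div_iff S.φ_real_pos.ne', mul_comm]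
  exact h1

/-- Both compared policies have mean length `1/φ`, so `f γ` and `fmin` are multiplied by the same
factor and the constants carry no loss. For general renewals the two lengths need not match. -/
theorem hasFrameDrift_typeTwo (hR : IsRenewalDefinition S C (typeTwoRenewals S))
    (hρ : ∀ᵐ θ ∂ρ, (∀ n, 0 ≤ θ.1 n) ∧ ∀ l, 0 ≤ θ.2.1 l)
    (hπ : SolvesShortestPath (typeTwoRenewals S) π ρ) {B₂ : ℝ}
    (hB : IsDriftConstant (typeTwoRenewals S) π B₂) {ε : ℝ} (hε : 0 ≤ ε) {γ : M → ℝ}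
    (hγ : Attains C (typeTwoRenewals S) ε γ) :
    HasFrameDrift (typeTwoRenewals S) π ρ (ε / S.φ) (B₂ + C.V * (C.f γ - C.fmin) / S.φ) := by
  refine hasFrameDrift hR hρ hπ hB hε hγ (fun π' t h hh => ?_) fun π' t h hh => ?_
  · rw [integral_frameNat_typeTwo hR π' hh, mul_one_div]
  · rw [integral_frameNat_typeTwo hR π' hh, integral_frameNat_typeTwo hR π hh]
    exact le_of_eq (by ring)

theorem law_renewsAt_succ_typeTwo (π : Policy S C) (ρ : Measure (Backlog N M L))
    [IsProbabilityMeasure ρ] (t : ℕ) :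
    π.law ρ {p | RenewsAt (typeTwoRenewals S) p (t + 1)} = ENNReal.ofReal S.φ := by
  have h1 := (follows_law π ρ).setLIntegral_typeTwo t.zero_le
    (measurable_const (a := (1 : ℝ≥0∞)))
  simpa only [lintegral_const, Measure.restrict_apply_univ, measure_univ, mul_one, one_mul]
    using h1

theorem sum_law_renewsAt_typeTwo_le (π : Policy S C) (ρ : Measure (Backlog N M L))
    [IsProbabilityMeasure ρ] (t : ℕ) :
    ∑ s ∈ Finset.range t, π.law ρ {p | RenewsAt (typeTwoRenewals S) p s} ≤
      1 + ENNReal.ofReal S.φ * t := by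
  cases t with
  | zero => simp
  | succ t =>
    -- The renewal at time `0` is certain and contributes the `1`; each later time contributes `φ`.
    rw [Finset.sum_range_succ', add_comm]
    refine add_le_add prob_le_one ?_
    simp only [law_renewsAt_succ_typeTwo π ρ, Finset.sum_const, Finset.card_range,
      nsmul_eq_mul, mul_comm]
    gcongr
    exact t.le_succ

/-- The potential contains the penalty up to the next renewal, which is not before `t`. As `f - fmin
≥ 0`, stopping at `t` only decreases it, and the Lyapunov part is dropped. -/
theorem sum_integral_penalty_le (hR : IsRenewalDefinition S C (typeTwoRenewals S))
    (hρ : ∀ᵐ θ ∂ρ, (∀ n, 0 ≤ θ.1 n) ∧ ∀ l, 0 ≤ θ.2.1 l) (hρL : Integrable lyapunov ρ)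
    {c K : ℝ} (hK : 0 ≤ K) (hd : HasFrameDrift (typeTwoRenewals S) π ρ c K) (t : ℕ) :
    C.V * (∑ τ ∈ Finset.range t, ∫ p, C.f (aux p τ) ∂π.law ρ - t * C.fmin) ≤
      ∫ θ, lyapunov θ ∂ρ + K * (1 + S.φ * t) := by
  have i1 := fun τ => integrable_comp_aux π ρ C.continuousOn_f τ
  have i0 : ∀ τ, Integrable (fun p => C.f (aux p τ) - C.fmin) (π.law ρ) :=
    fun τ => (i1 τ).sub (integrable_const _)
  have i2 : Integrable (fun p => ∑ τ ∈ Finset.range t, (C.f (aux p τ) - C.fmin)) (π.law ρ) :=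
    integrable_finsetSum _ fun τ _ => i0 τ
  have hφ := S.φ_real_pos
  have hA : 0 ≤ ∫ θ, lyapunov θ ∂ρ := integral_nonneg lyapunov_nonneg
  have h1 : ∫ p, C.V * ∑ τ ∈ Finset.range t, (C.f (aux p τ) - C.fmin) ∂π.law ρ =
      C.V * (∑ τ ∈ Finset.range t, ∫ p, C.f (aux p τ) ∂π.law ρ - t * C.fmin) := by
    rw [integral_const_mul, integral_finsetSum _ fun τ _ => i0 τ]
    have h2 : ∀ τ, ∫ p, (C.f (aux p τ) - C.fmin) ∂π.law ρ =
        ∫ p, C.f (aux p τ) ∂π.law ρ - C.fmin := fun τ => by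
      rw [integral_sub (i1 τ) (integrable_const _)]
      simp
    simp only [h2, Finset.sum_sub_distrib, Finset.sum_const, Finset.card_range, nsmul_eq_mul]
  have htyp := ae_isTypical hR π ρ hρ
  rw [← h1, ← ENNReal.ofReal_le_ofReal_iff (by positivity), ofReal_integral_eq_lintegral_ofReal
    (i2.const_mul _)]
  · have h3 := (le_add_of_nonneg_right zero_le).trans (lintegral_potential_le hR hρ hρL hd t)
    refine (lintegral_mono_ae ?_).trans (h3.trans ((add_le_add_right
      (mul_le_mul_right (sum_law_renewsAt_typeTwo_le π ρ t) _) _).trans (le_of_eq ?_)))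
    · filter_upwards [htyp] with p hp
      refine ENNReal.ofReal_le_ofReal ?_
      have h4 := (nextRenewal_spec hp.zero hp.finite t).1
      rw [potential]
      refine le_add_of_nonneg_of_le (lyapunov_nonneg _)
        (mul_le_mul_of_nonneg_left ?_ C.V_nonneg)
      simp only [C.reg_f (hp.admissible _).1]
      exact Finset.sum_le_sum_of_subset_of_nonneg (Finset.range_mono h4)
        fun τ _ _ => sub_nonneg.2 (C.f_bd _ (hp.admissible τ).1).1
    · rw [← ENNReal.ofReal_natCast, ← ENNReal.ofReal_mul hφ.le, ← ENNReal.ofReal_one,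
        ← ENNReal.ofReal_add zero_le_one (by positivity), ← ENNReal.ofReal_mul hK,
        ← ENNReal.ofReal_add hA (by positivity)]
  · filter_upwards [htyp] with p hp
    have h5 := penalty_nonneg hp (Finset.range t)
    simp only [C.reg_f (hp.admissible _).1] at h5
    exact h5

theorem limsup_f_avgPenalty_le (hR : IsRenewalDefinition S C (typeTwoRenewals S))
    (hρ : ∀ᵐ θ ∂ρ, (∀ n, 0 ≤ θ.1 n) ∧ ∀ l, 0 ≤ θ.2.1 l) (hρL : Integrable lyapunov ρ)
    (hπ : SolvesShortestPath (typeTwoRenewals S) π ρ) {B₂ : ℝ}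
    (hB : IsDriftConstant (typeTwoRenewals S) π B₂)
    (hd : Tendsto (fun t => ‖WithLp.toLp 2 (avgPenalty π ρ t - avgAux π ρ t)‖) atTop (𝓝 0))
    (hV : 0 < C.V) {γ : M → ℝ} (hγ : Attains C (typeTwoRenewals S) 0 γ) :
    limsup (fun t : ℕ => ((C.f (avgPenalty π ρ t) : ℝ) : EReal)) atTop ≤
      ((C.f γ + (S.φ : ℝ) * B₂ / C.V : ℝ) : EReal) := by
  have hφ := S.φ_real_pos
  have hfγ := (C.f_bd γ (hγ.mem_box hR π)).1
  have hdrift := hasFrameDrift_typeTwo hR hρ hπ hB le_rfl hγ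
  set K := B₂ + C.V * (C.f γ - C.fmin) / S.φ with hKdef
  have hK : 0 ≤ K := add_nonneg hB.1.le (div_nonneg (mul_nonneg hV.le (sub_nonneg.2 hfγ)) hφ.le)
  set a₀ := ∫ θ, lyapunov θ ∂ρ
  have h1 : Tendsto (fun t : ℕ => C.fmin + ((a₀ + K) / C.V / t + K * S.φ / C.V) +
      C.β * ‖WithLp.toLp 2 (avgPenalty π ρ t - avgAux π ρ t)‖) atTop
      (𝓝 (C.f γ + (S.φ : ℝ) * B₂ / C.V)) := by
    have h2 := (((tendsto_const_div_atTop_nhds_zero_nat ((a₀ + K) / C.V)).add_const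
      (K * S.φ / C.V)).const_add C.fmin).add (hd.const_mul C.β)
    -- The limit is evaluated from `K φ / V = φ B₂ / V + f γ - fmin`; the shift by `fmin` cancels.
    have h3 : C.fmin + (0 + K * S.φ / C.V) + C.β * 0 = C.f γ + (S.φ : ℝ) * B₂ / C.V := by
      rw [hKdef]
      field_simp
      ring
    rwa [h3] at h2
  refine limsup_coe_le ?_ h1
  filter_upwards [eventually_ge_atTop 1] with t ht
  have ht0 : (0 : ℝ) < t := by exact_mod_cast ht
  refine (comp_avgPenalty_le π ρ C.f_convex C.f_lip ht).trans (add_le_add_left ?_ _)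
  have h4 := sum_integral_penalty_le hR hρ hρL hK hdrift t
  rw [← le_div_iff₀' hV] at h4
  rw [one_div, inv_mul_le_iff₀ ht0]
  have h5 : (t : ℝ) * (C.fmin + ((a₀ + K) / C.V / t + K * S.φ / C.V)) =
      t * C.fmin + (a₀ + K * (1 + S.φ * t)) / C.V := by
    field_simp
    ring
  rw [h5]
  linarith

/-- The algorithm does not depend on γ, so the bound may be used for attained vectors whose values
approach the infimum; no minimizer is required. -/
theorem limsup_f_avgPenalty_le_optimalValue (hR : IsRenewalDefinition S C (typeTwoRenewals S))
    (hρ : ∀ᵐ θ ∂ρ, (∀ n, 0 ≤ θ.1 n) ∧ ∀ l, 0 ≤ θ.2.1 l) (hρL : Integrable lyapunov ρ)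
    (hπ : SolvesShortestPath (typeTwoRenewals S) π ρ) {B₂ : ℝ}
    (hB : IsDriftConstant (typeTwoRenewals S) π B₂)
    (hd : Tendsto (fun t => ‖WithLp.toLp 2 (avgPenalty π ρ t - avgAux π ρ t)‖) atTop (𝓝 0))
    (hV : 0 < C.V) (hA3 : ∃ γ : M → ℝ, Attains C (typeTwoRenewals S) 0 γ) :
    limsup (fun t : ℕ => ((C.f (avgPenalty π ρ t) : ℝ) : EReal)) atTop ≤
      ((optimalValue C (typeTwoRenewals S) + (S.φ : ℝ) * B₂ / C.V : ℝ) : EReal) := by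
  refine EReal.le_of_forall_lt_iff_le.1 fun z hz => ?_
  have h1 : optimalValue C (typeTwoRenewals S) < z - (S.φ : ℝ) * B₂ / C.V := by
    have := EReal.coe_lt_coe_iff.1 hz
    linarith
  obtain ⟨γ₀, hγ₀⟩ := hA3
  obtain ⟨-, ⟨γ, hγ, rfl⟩, h2⟩ := exists_lt_of_csInf_lt
    (show (C.f '' {γ | Attains C (typeTwoRenewals S) 0 γ}).Nonempty from ⟨_, γ₀, hγ₀, rfl⟩) h1
  refine (limsup_f_avgPenalty_le hR hρ hρL hπ hB hd hV hγ).trans (EReal.coe_le_coe_iff.2 ?_)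
  linarith

/-- `Q_n(t)` is known at `t`, while a renewal at `t + 1` has probability `φ` independently of it.
Restricting to that renewal therefore costs the factor `φ`, and moving from `t` to `t + 1` costs at
most `μmax`. -/
theorem lintegral_queue_le (hR : IsRenewalDefinition S C (typeTwoRenewals S))
    (hρ : ∀ᵐ θ ∂ρ, (∀ n, 0 ≤ θ.1 n) ∧ ∀ l, 0 ≤ θ.2.1 l) (n : N) (t : ℕ) :
    ENNReal.ofReal S.φ * ∫⁻ p, ‖(backlog S C p t).1 n‖ₑ ∂π.law ρ ≤
      ∫⁻ p in {p | RenewsAt (typeTwoRenewals S) p (t + 1)},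
        ENNReal.ofReal (∑ n, (backlog S C.reg p (t + 1)).1 n) ∂π.law ρ +
      ENNReal.ofReal (S.μmax n) := by
  have htyp := ae_isTypical hR π ρ hρ
  have hE' := pastSigma_le _ _ (measurableSet_renewsAt hR.meas (le_refl (t + 1)))
  have h1 : ∫⁻ p, ‖(backlog S C p t).1 n‖ₑ ∂π.law ρ =
      ∫⁻ p, ‖(backlog S C.reg p t).1 n‖ₑ ∂π.law ρ :=
    lintegral_congr_ae (htyp.mono fun p hp => by simp only [hp.backlog_eq])
  have hm : Measurable[pastSigma N M L W A Z t] fun p => ‖(backlog S C.reg p t).1 n‖ₑ :=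
    measurable_enorm.comp ((measurable_backlog (S := S) C.measurable_reg_h t).1 n)
  rw [h1, ← (follows_law π ρ).setLIntegral_typeTwo t.zero_le hm]
  refine le_trans (lintegral_mono_ae (g := fun p =>
    ENNReal.ofReal (∑ n, (backlog S C.reg p (t + 1)).1 n) + ENNReal.ofReal (S.μmax n))
    ((ae_restrict_iff' hE').2 ?_)) ?_
  · filter_upwards [htyp] with p hp _
    have h2 := queue_le_succ_add (C := C.reg) (hp.admissible t) n
    have h3 := Finset.single_le_sum (fun i _ => (hp.nonneg (t + 1)).1 i) (Finset.mem_univ n)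
    rw [Real.enorm_of_nonneg ((hp.nonneg t).1 n)]
    exact (ENNReal.ofReal_le_ofReal (h2.trans (add_le_add_left h3 _))).trans
      ENNReal.ofReal_add_le
  · rw [lintegral_add_right _ measurable_const, setLIntegral_const]
    exact add_le_add_right (mul_le_of_le_one_right zero_le prob_le_one) _

theorem limsup_avg_queue_lt_top (hR : IsRenewalDefinition S C (typeTwoRenewals S))
    (hρ : ∀ᵐ θ ∂ρ, (∀ n, 0 ≤ θ.1 n) ∧ ∀ l, 0 ≤ θ.2.1 l) (hρL : Integrable lyapunov ρ)
    {c K : ℝ} (hc : 0 < c) (hd : HasFrameDrift (typeTwoRenewals S) π ρ c K) (n : N) :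
    limsup (fun t : ℕ =>
      (∑ τ ∈ Finset.range t, ∫⁻ p, ‖(backlog S C p τ).1 n‖ₑ ∂(π.law ρ)) / (t : ℝ≥0∞)) atTop
        < ⊤ := by
  have hφ : ENNReal.ofReal S.φ ≠ 0 := (ENNReal.ofReal_pos.2 S.φ_real_pos).ne'
  have hc' : ENNReal.ofReal c ≠ 0 := (ENNReal.ofReal_pos.2 hc).ne'
  set a₀ := ∫ θ, lyapunov θ ∂ρ
  -- Dividing by `c` comes from the telescoped drift, adding `μmax` from the shift by one slot, and
  -- dividing by `φ` from restricting to renewals.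
  set D := ((ENNReal.ofReal a₀ + 2 * ENNReal.ofReal K) / ENNReal.ofReal c +
    ENNReal.ofReal (S.μmax n)) / ENNReal.ofReal S.φ
  have hD : D < ⊤ := by
    refine ENNReal.div_lt_top (ENNReal.add_ne_top.2 ⟨(ENNReal.div_lt_top ?_ hc').ne,
      ENNReal.ofReal_ne_top⟩) hφ
    exact ENNReal.add_ne_top.2 ⟨ENNReal.ofReal_ne_top,
      ENNReal.mul_ne_top (by simp) ENNReal.ofReal_ne_top⟩
  refine lt_of_le_of_lt (limsup_le_of_le (a := D) isCobounded_le_of_bot ?_) hD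
  filter_upwards [eventually_ge_atTop 1] with t ht
  have ht1 : (1 : ℝ≥0∞) ≤ t := by exact_mod_cast ht
  refine ENNReal.div_le_of_le_mul ?_
  rw [← ENNReal.mul_le_mul_iff_right hφ ENNReal.ofReal_ne_top, Finset.mul_sum]
  refine (Finset.sum_le_sum fun τ _ => lintegral_queue_le hR hρ n τ).trans ?_
  rw [Finset.sum_add_distrib]
  have h1 := (le_add_of_nonneg_left zero_le).trans
    (lintegral_potential_le hR hρ hρL hd (t + 1))
  rw [Finset.sum_range_succ'] at h1
  -- The sum runs up to time `t` because `Q(t - 1)` is compared with a renewal at `t`; then `t + 1 ≤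
  -- 2t` for `t ≥ 1`.
  have h2 : ∑ s ∈ Finset.range (t + 1), π.law ρ {p | RenewsAt (typeTwoRenewals S) p s} ≤
      2 * t := by
    refine (Finset.sum_le_sum fun s _ => prob_le_one).trans ?_
    simp only [Finset.sum_const, Finset.card_range, nsmul_eq_mul, mul_one, two_mul]
    push_cast
    gcongr
  have h3 : ∑ τ ∈ Finset.range t, ∫⁻ p in {p | RenewsAt (typeTwoRenewals S) p (τ + 1)},
      ENNReal.ofReal (∑ n, (backlog S C.reg p (τ + 1)).1 n) ∂π.law ρ ≤
      (ENNReal.ofReal a₀ + 2 * ENNReal.ofReal K) / ENNReal.ofReal c * t := by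
    rw [ENNReal.mul_comm_div, ← mul_div_assoc, ENNReal.le_div_iff_mul_le (Or.inl hc')
      (Or.inl ENNReal.ofReal_ne_top), mul_comm]
    refine (mul_le_mul_right (le_add_of_nonneg_right zero_le) _).trans (h1.trans ?_)
    refine (add_le_add_right (mul_le_mul_right h2 _) _).trans ?_
    rw [add_mul]
    refine add_le_add (le_mul_of_one_le_right zero_le ht1) (le_of_eq (by ring))
  refine (add_le_add_left h3 _).trans ?_
  rw [Finset.sum_const, Finset.card_range, nsmul_eq_mul, mul_comm (t : ℝ≥0∞), ← add_mul,
    ← mul_assoc, ENNReal.mul_div_cancel hφ ENNReal.ofReal_ne_top]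

/-- Telescoping over `G` intervals bounds `ε/φ` times the queue sum by the initial Lyapunov mean
plus `K G`. Dividing by `G ε/φ` and replacing `f γ` by `fmax` gives the stated constant. -/
theorem avg_queue_renewalTime_le (hR : IsRenewalDefinition S C (typeTwoRenewals S))
    (hρ : ∀ᵐ θ ∂ρ, (∀ n, 0 ≤ θ.1 n) ∧ ∀ l, 0 ≤ θ.2.1 l) (hρL : Integrable lyapunov ρ)
    (hπ : SolvesShortestPath (typeTwoRenewals S) π ρ) {B₂ : ℝ}
    (hB : IsDriftConstant (typeTwoRenewals S) π B₂) {ε : ℝ} (hε : 0 < ε) {γ : M → ℝ}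
    (hγ : Attains C (typeTwoRenewals S) ε γ) {G : ℕ} (hG : 0 < G) :
    (∑ g ∈ Finset.range G, ∑ n,
      ∫⁻ p, ‖(backlog S C p (renewalTime (typeTwoRenewals S) p g).toNat).1 n‖ₑ ∂(π.law ρ)) /
        (G : ℝ≥0∞) ≤
    ENNReal.ofReal (((S.φ : ℝ) * B₂ + C.V * (C.fmax - C.fmin)) / ε +
      (S.φ : ℝ) * (∫ θ, lyapunov θ ∂ρ) / (ε * G)) := by
  have hφ := S.φ_real_pos
  have hG0 : (0 : ℝ) < G := by exact_mod_cast hG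
  have hfγ := C.f_bd γ (hγ.mem_box hR π)
  have hV := C.V_nonneg
  have hA : 0 ≤ ∫ θ, lyapunov θ ∂ρ := integral_nonneg lyapunov_nonneg
  have h1 := (le_add_of_nonneg_left zero_le).trans (sum_lintegral_renewalTime_le hR hρ hρL
    (hasFrameDrift_typeTwo hR hρ hπ hB hε.le hγ) G)
  have htyp := ae_isTypical hR π ρ hρ
  have hmT (g : ℕ) : Measurable fun p : Path N M L W A Z =>
      (renewalTime (typeTwoRenewals S) p g).toNat := by
    refine (measurable_of_countable ENat.toNat).comp (ENat.measurable_iff.2 fun s => ?_)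
    exact pastSigma_le _ _ (measurableSet_renewalTime_eq hR.meas g s)
  have h2 : ∀ g, ∑ n, ∫⁻ p,
      ‖(backlog S C p (renewalTime (typeTwoRenewals S) p g).toNat).1 n‖ₑ ∂(π.law ρ) =
      ∫⁻ p, ENNReal.ofReal (∑ n,
        (backlog S C.reg p (renewalTime (typeTwoRenewals S) p g).toNat).1 n) ∂π.law ρ := fun g => by
    have h3 : ∀ n, ∫⁻ p,
        ‖(backlog S C p (renewalTime (typeTwoRenewals S) p g).toNat).1 n‖ₑ ∂(π.law ρ) = ∫⁻ p,
        ENNReal.ofReal ((backlog S C.reg p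
          (renewalTime (typeTwoRenewals S) p g).toNat).1 n) ∂(π.law ρ) := fun n => by
      refine lintegral_congr_ae (htyp.mono fun p hp => ?_)
      simp only
      rw [hp.backlog_eq, Real.enorm_of_nonneg ((hp.nonneg _).1 n)]
    simp only [h3]
    rw [← lintegral_finsetSum _ fun n _ => (measurable_comp_nat (hmT g)
      fun k => ((measurable_backlog (S := S) C.measurable_reg_h k).1 n).mono (pastSigma_le _)
        le_rfl).ennreal_ofReal]
    refine lintegral_congr_ae (htyp.mono fun p hp => ?_)
    exact (ENNReal.ofReal_sum_of_nonneg fun n _ => (hp.nonneg _).1 n).symm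
  simp only [h2]
  set q₀ := ∑ g ∈ Finset.range G, ∫⁻ p, ENNReal.ofReal (∑ n,
        (backlog S C.reg p (renewalTime (typeTwoRenewals S) p g).toNat).1 n) ∂π.law ρ
  set K := B₂ + C.V * (C.f γ - C.fmin) / S.φ with hKdef
  have hK : 0 ≤ K :=
    add_nonneg hB.1.le (div_nonneg (mul_nonneg hV (sub_nonneg.2 hfγ.1)) hφ.le)
  rw [← ENNReal.ofReal_natCast G, ← ENNReal.ofReal_mul hK,
    ← ENNReal.ofReal_add hA (by positivity)] at h1
  have hc : 0 < ε / (S.φ : ℝ) := div_pos hε hφ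
  rw [mul_comm, ← ENNReal.le_div_iff_mul_le (Or.inl (ENNReal.ofReal_pos.2 hc).ne')
    (Or.inl ENNReal.ofReal_ne_top), ← ENNReal.ofReal_div_of_pos hc] at h1
  refine (ENNReal.div_le_div_right h1 _).trans ?_
  rw [← ENNReal.ofReal_natCast G, ← ENNReal.ofReal_div_of_pos hG0]
  refine ENNReal.ofReal_le_ofReal ?_
  have h4 : (∫ θ, lyapunov θ ∂ρ + K * G) / (ε / (S.φ : ℝ)) / G =
      ((S.φ : ℝ) * B₂ + C.V * (C.f γ - C.fmin)) / ε +
        (S.φ : ℝ) * (∫ θ, lyapunov θ ∂ρ) / (ε * G) := by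
    rw [hKdef]
    field_simp
    ring
  rw [h4]
  have h5 := hfγ.2
  gcongr

end TypeTwo

end MarkovNet

/-! ### The performance theorem -/

open MarkovNet in
theorem mainTheorem3 {N M L W A Z : Type u} [Fintype N] [Fintype M] [Fintype L]
    [MeasurableSpace W] [MeasurableSpace A]
    [MeasurableSpace Z] [Countable Z] [DiscreteMeasurableSpace Z]
    (S : Network N M W A Z) (C : Program S L)
    (R : RenewalRule N M L W A Z) (hR : IsRenewalDefinition S C R)
    (hA3 : ∃ γopt : M → ℝ, Attains C R 0 γopt)
    (ρ : Measure (Backlog N M L)) [IsProbabilityMeasure ρ]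
    (hρ : ∀ᵐ θ ∂ρ, (∀ n, 0 ≤ θ.1 n) ∧ ∀ l, 0 ≤ θ.2.1 l)
    (hρL : Integrable lyapunov ρ)
    (π : Policy S C) (hπ : SolvesShortestPath R π ρ)
    (B₂ : ℝ) (hB₂ : IsDriftConstant R π B₂) :
    ((∀ n, Tendsto (fun t : ℕ =>
        (∫⁻ p, ‖(backlog S C p t).1 n‖ₑ ∂(π.law ρ)) / (t : ℝ≥0∞)) atTop (𝓝 0)) ∧
      (∀ l, Tendsto (fun t : ℕ =>
        (∫⁻ p, ‖(backlog S C p t).2.1 l‖ₑ ∂(π.law ρ)) / (t : ℝ≥0∞)) atTop (𝓝 0)) ∧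
      (∀ m, Tendsto (fun t : ℕ =>
        (∫⁻ p, ‖(backlog S C p t).2.2 m‖ₑ ∂(π.law ρ)) / (t : ℝ≥0∞)) atTop (𝓝 0))) ∧
    (∀ l, limsup (fun t : ℕ => ((C.h l (avgPenalty π ρ t) : ℝ) : EReal)) atTop ≤
      ((C.c l : ℝ) : EReal)) ∧
    (R = typeTwoRenewals S → 0 < C.V →
      limsup (fun t : ℕ => ((C.f (avgPenalty π ρ t) : ℝ) : EReal)) atTop ≤
        ((optimalValue C R + (S.φ : ℝ) * B₂ / C.V : ℝ) : EReal)) ∧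
    (R = typeTwoRenewals S → ∀ ε : ℝ, 0 < ε → (∃ γstar : M → ℝ, Attains C R ε γstar) →
      (∀ n, limsup (fun t : ℕ =>
        (∑ τ ∈ Finset.range t, ∫⁻ p, ‖(backlog S C p τ).1 n‖ₑ ∂(π.law ρ)) / (t : ℝ≥0∞)) atTop
          < ⊤) ∧
      ∀ G : ℕ, 0 < G →
        (∑ g ∈ Finset.range G, ∑ n,
          ∫⁻ p, ‖(backlog S C p (renewalTime R p g).toNat).1 n‖ₑ ∂(π.law ρ)) / (G : ℝ≥0∞) ≤
        ENNReal.ofReal (((S.φ : ℝ) * B₂ + C.V * (C.fmax - C.fmin)) / ε +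
          (S.φ : ℝ) * (∫ θ, lyapunov θ ∂ρ) / (ε * G))) := by
  obtain ⟨γ₀, hγ₀⟩ := hA3
  -- Any attained vector will do here: rate stability and the constraints only need some finite
  -- drift constant, regardless of how good `f γ₀` is.
  obtain ⟨K, hK, hd⟩ := exists_hasFrameDrift hR hρ hπ hB₂ hγ₀
  have hQ := tendsto_queue_div hR hρ hρL hK hd
  have hY := tendsto_virtual_div hR hρ hρL hK hd
  have hW := tendsto_balance_div hR hρ hρL hK hd
  have hdiff := tendsto_avgPenalty_sub_avgAux hR hρ hρL hW
  refine ⟨⟨hQ, hY, hW⟩, fun l => limsup_h_avgPenalty_le hR hρ hdiff l (hY l), ?_, ?_⟩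
  · rintro rfl hV
    exact limsup_f_avgPenalty_le_optimalValue hR hρ hρL hπ hB₂ hdiff hV ⟨γ₀, hγ₀⟩
  · rintro rfl ε hε ⟨γ, hγ⟩
    exact ⟨fun n => limsup_avg_queue_lt_top hR hρ hρL (div_pos hε S.φ_real_pos)
        (hasFrameDrift_typeTwo hR hρ hπ hB₂ hε.le hγ) n,
      fun G hG => avg_queue_renewalTime_le hR hρ hρL hπ hB₂ hε hγ hG⟩
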